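/- **Setting.** There are $K\ge 1$ arms. The mean rewards $\mu_1,\dots,\mu_K\in[0,1]$ are independent, $\mu_i\sim\mathcal P_i$; given them, all samples are independent and a sample of arm $i$ is Bernoulli with mean $\mu_i$. Let $\mu_i^0=\mathbb E[\mu_i]$; arms are indexed so that $\mu_1^0\ge\dots\ge\mu_K^0$. For $\delta>0$ the instance is *$\delta$-easy* if $\min_i \mathbb E[(\mu_i-\mu_1^0)_+]>\delta$ and $\mathbb E_{\mu\sim\mathcal P_i}[(\mu_j^0-\mu)_+]\ge\delta$ for all $i,j$. An algorithm recommends an arm $A_t$ in each round $t$, the recommendation is followed and the reward is observed by the algorithm; it is *BIC* if $\mathbb E[\mu_i-\mu_j\mid A_t=i]\ge 0$ for all rounds $t$ and arms $i,j$ with $\Pr[A_t=i]>0$. **Algorithm.** *Exploitation of depth $d$* plays an arm with the largest posterior mean reward given, for each arm, its first $d$ samples (all available ones if there are fewer), ties being broken in favour of the smallest index. Let $\mathrm{ZEROS}_{j,n}$ be the event that the first $n$ samples of each arm $i<j$ are $0$. For a constant $C_{\rm pad}$ put $\lambda=\delta/10$, $N_{\rm pad}=\lceil C_{\rm pad}\,\delta^{-2}\log(1/\delta)\rceil$,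 $n_\lambda=1+\lceil1/\lambda\rceil$, $N_{\rm boot}=\min\{n\in\mathbb{N}:\mathbb E[\mu_j-\mu_i\mid \mathrm{ZEROS}_{j,n}]>0\ \forall i<j\}$, $z_j=\Pr[\mathrm{ZEROS}_{j,N_{\rm boot}}]$, and let $L$ be the least integer with $z_j(1+\lambda)^L\ge1$ for all $j$. Let $\widehat\pi_j$ be exploitation based on the first $N_{\rm pad}$ samples of arm $j$ and no other data. A *padded phase* plays $j_0$ if $\widehat\pi_{j_0}=j_0$, and otherwise exploits with depth $N_{\rm pad}$; *exploring* means playing $j_0$. The same arm is played throughout a phase. Draw independently a uniformly random arm $j_0$ and a uniformly random permutation $\theta$ of the arms. Then: 1. Run $K$ exploitation phases of depth and length $N_{\rm boot}$. 2. For $N_{\rm pad}$ rounds: explore if $\mathrm{ZEROS}_{j_0,N_{\rm boot}}$ has been observed, else exploit with depth $N_{\rm boot}$. 3. For $N_{\rm pad}$ rounds: with probability $\lambda z_{j_0}/(1+\lambda z_{j_0})$ explore; otherwise run a padded phase if an exploration has already happened, and exploit with depth $N_{\rm pad}$ if not. 4. For $k=0,\dots,L-1$, a phase of $N_{\rm pad}$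 rounds, with $p=\min(1,z_{j_0}(1+\lambda)^k)$: a padded phase if an exploration has already happened or $p=1$; otherwise explore with probability $\min(1,\frac{p}{1-p}\lambda)$, and exploit with depth $N_{\rm pad}$ with the remaining probability. 5. For $m=1,\dots,K$: draw $\ell_0$ uniformly from $\{1,\dots,n_\lambda\}$; for $\ell=1,\dots,n_\lambda$, a phase of $N$ rounds which plays arm $\theta(m)$ if $\ell=\ell_0$ and is a padded phase otherwise. **Theorem.** There is an absolute constant $C_0$ such that for every $C_{\rm pad}\ge C_0$ there are constants $C,a$ (depending only on $C_{\rm pad}$) such that for every $\delta$-easy instance with $K$ arms and every $N\in\mathbb N$: the algorithm is BIC; it runs for a deterministic number $$T\le C\,(1+\log(1/\delta))^{a}\Big(\frac{KN}{\delta}+\frac{K}{\delta^4}\Big)$$ of rounds (in particular linear in $K$); and almost surely each arm is sampled at least $N$ times in these $T$ rounds. Moreover the algorithm can be implemented by one program (independent of the instance, of $N$ and of $C_{\rm pad}$), on a unit-cost real random access machine whose memory initially holds the parameters $K,N,N_{\rm boot},N_{\rm pad},\lambda,n_\lambda,L,(z_j)_j$ and the random draws, such that each round takes $O(1)$ steps,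 with an absolute constant, plus at most one call to an exploitation routine (data set $\mapsto$ arm with the largest posterior mean reward), on a data set with at most $C(1+\log(1/\delta))^a\,\delta^{-2}$ samples per arm. -/

import Mathlib

open MeasureTheory ProbabilityTheory

noncomputable section

namespace IncExp

/-! ### Priors -/

/-- Mean of a distribution over `[0,1]`. -/
def mean (P : Measure unitInterval) : ℝ := ∫ x, (x : ℝ) ∂P

/-- The largest prior mean reward over a collection of priors. -/
def maxMean (C : Set (Measure unitInterval)) : ℝ := sSup (mean '' C)

/-- A collection of priors is `δ`-easy: `inf_{P ∈ C} E_{μ ∼ P} (μ - maxMean C)₊ > δ`. -/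
def EasyCollection (C : Set (Measure unitInterval)) (δ : ℝ) : Prop :=
  δ < sInf ((fun P : Measure unitInterval => ∫ x, max ((x : ℝ) - maxMean C) 0 ∂P) '' C)

/-- A collection of priors is `δ`-non-dominant: `E (μ_j⁰ - μ_i)₊ ≥ δ` whenever the priors of the
arms `i` and `j` come from the collection. -/
def NonDominant (C : Set (Measure unitInterval)) (δ : ℝ) : Prop :=
  ∀ P ∈ C, ∀ Q ∈ C, δ ≤ ∫ x, max (mean Q - (x : ℝ)) 0 ∂P

/-- A `δ`-easy problem instance. -/
def EasyInstance {K : ℕ} (P : Fin K → Measure unitInterval) (δ : ℝ) : Prop :=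
  EasyCollection (Set.range P) δ ∧ NonDominant (Set.range P) δ

/-! ### The environment: mean rewards and rewards -/

/-- The mean rewards `μ_i`, and a table of thresholds that generates the rewards. -/
abbrev Env (K : ℕ) := (Fin K → unitInterval) × (Fin K × ℕ → unitInterval)

/-- The mean rewards are independent, `μ_i ∼ P_i`; the thresholds are independent of them and
i.i.d. uniform on `[0,1]`. -/
def envLaw {K : ℕ} (P : Fin K → Measure unitInterval) : Measure (Env K) :=
  (Measure.pi P).prod (Measure.infinitePi fun _ : Fin K × ℕ => (volume : Measure unitInterval))

/-- The reward (`0` or `1`) of the `n`-th sample (`n = 0, 1, …`) of arm `i`. Given the mean rewards,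
all these rewards are independent, and that of arm `i` is Bernoulli with mean `μ_i`. -/
def reward {K : ℕ} (e : Env K) (i : Fin K) (n : ℕ) : ℕ := if e.2 (i, n) < e.1 i then 1 else 0

/-- The number of ones among the first `n` samples of arm `i`. -/
def successes {K : ℕ} (e : Env K) (i : Fin K) (n : ℕ) : ℕ := ∑ k ∈ Finset.range n, reward e i k

/-- The event that the first `n` samples of each arm `i < j` return reward `0`. -/
def zeros {K : ℕ} (j : Fin K) (n : ℕ) : Set (Env K) :=
  {e | ∀ i < j, ∀ k < n, reward e i k = 0}

/-! ### Exploitation -/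

/-- Posterior mean (Bayes' rule, Bernoulli likelihood) of a mean reward with prior `P`, given `n`
samples of which `s` returned reward `1`. -/
def postMean (P : Measure unitInterval) (n s : ℕ) : ℝ :=
  (∫ x, (x : ℝ) * ((x : ℝ) ^ s * (1 - (x : ℝ)) ^ (n - s)) ∂P) /
    ∫ x, (x : ℝ) ^ s * (1 - (x : ℝ)) ^ (n - s) ∂P

theorem argmax_nonempty {K : ℕ} [NeZero K] (f : Fin K → ℝ) :
    {i : Fin K | ∀ k, f k ≤ f i}.toFinite.toFinset.Nonempty := by
  obtain ⟨i, hi⟩ := Finite.exists_max f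
  exact ⟨i, by simpa using hi⟩

/-- The maximizer of `f`; ties are broken in favour of the smallest index. -/
def argmax {K : ℕ} [NeZero K] (f : Fin K → ℝ) : Fin K :=
  {i : Fin K | ∀ k, f k ≤ f i}.toFinite.toFinset.min' (argmax_nonempty f)

/-- Exploitation: an arm with the largest posterior mean reward, given, for each arm `i`,
`n i` samples of which `s i` returned reward `1`. -/
def exploit {K : ℕ} [NeZero K] (P : Fin K → Measure unitInterval) (n s : Fin K → ℕ) : Fin K :=
  argmax fun i => postMean (P i) (n i) (s i)

/-! ### The algorithm -/

/-- `N_boot`: the smallest `N₀` with `E[μ_j - μ_i | zeros j N₀] > 0` for all arms `i < j`. -/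
def bootN {K : ℕ} (P : Fin K → Measure unitInterval) : ℕ :=
  sInf {n | ∀ i j : Fin K, i < j →
    0 < ∫ e, ((e.1 j : ℝ) - (e.1 i : ℝ)) ∂((envLaw P)[|zeros j n])}

/-- Parameters of the algorithm. -/
structure Params (K : ℕ) where
  /-- padding `λ` -/
  lam : ℝ
  /-- `N_boot` -/
  nBoot : ℕ
  /-- `N_pad` -/
  nPad : ℕ
  /-- `zProb j = Pr[zeros j N_boot]` -/
  zProb : Fin K → ℝ
  /-- number of phases in the main (growth) loop -/
  nGrow : ℕ
  /-- number `n_λ` of phases for each arm in the final loop -/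
  nLam : ℕ
  /-- target number of samples of each arm -/
  nTarget : ℕ

/-- The parameters: `λ = δ/10`, `N_pad = ⌈Cpad δ⁻² log(1/δ)⌉`, `n_λ = 1 + ⌈1/λ⌉`. The growth loop
has as many phases as are needed to bring the exploration probability
`min(1, Pr[zeros j N_boot] (1+λ)^k)` to `1` for every choice of the arm `j`, so that its length does
not depend on the random arm `j₀`. -/
def params {K : ℕ} (P : Fin K → Measure unitInterval) (δ Cpad : ℝ) (N : ℕ) : Params K where
  lam := δ / 10
  nBoot := bootN P
  nPad := ⌈Cpad * (1 / δ) ^ 2 * Real.log (1 / δ)⌉₊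
  zProb := fun j => (envLaw P).real (zeros j (bootN P))
  nGrow := sInf {k | ∀ j, 1 ≤ (envLaw P).real (zeros j (bootN P)) * (1 + δ / 10) ^ k}
  nLam := 1 + ⌈(δ / 10)⁻¹⌉₊
  nTarget := N

instance permMeasurableSpace (K : ℕ) : MeasurableSpace (Equiv.Perm (Fin K)) := ⊤

/-- The internal randomness of the algorithm: the arm `j₀`, the permutation `θ`, the phases `ℓ₀` of
the final loop (one for each of its `K` iterations), and a sequence of coins. -/
abbrev Seed (K n : ℕ) := Fin K × Equiv.Perm (Fin K) × (Fin K → Fin n) × (ℕ → unitInterval)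

/-- All components are independent and uniform. -/
def seedLaw (K n : ℕ) : Measure (Seed K n) :=
  (uniformOn Set.univ).prod ((uniformOn Set.univ).prod ((uniformOn Set.univ).prod
    (Measure.infinitePi fun _ : ℕ => (volume : Measure unitInterval))))

/-- Sample space: environment and internal randomness. -/
abbrev Outcome {K : ℕ} (prm : Params K) := Env K × Seed K prm.nLam

/-- The law of the environment and of the (independent) internal randomness. -/
def law {K : ℕ} (P : Fin K → Measure unitInterval) (prm : Params K) : Measure (Outcome prm) :=
  (envLaw P).prod (seedLaw K prm.nLam)

section Algorithm

variable {K : ℕ} [NeZero K] (P : Fin K → Measure unitInterval) (prm : Params K)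

/-- State between phases: number of samples collected so far from each arm, and whether an
exploration phase (for arm `j₀`) has happened. Together with the rewards of these samples, this is
all that the algorithm looks at. -/
structure State (K : ℕ) where
  pulls : Fin K → ℕ
  explored : Bool

/-- The arm chosen by exploitation of depth `d`: for each arm, condition on the first `d` samples
(or on all available samples, if there are fewer than `d`). -/
def exploitArm (d : ℕ) (e : Env K) (st : State K) : Fin K :=
  exploit P (fun i => min (st.pulls i) d) (fun i => successes e i (min (st.pulls i) d))

/-- The policy `π̂_j`: exploitation based on the first `N_pad` samples of arm `j` and no other
information. -/
def piHat (j : Fin K) (e : Env K) (st : State K) : Fin K :=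
  exploit P (fun i => if i = j then min (st.pulls i) prm.nPad else 0)
    (fun i => if i = j then successes e i (min (st.pulls i) prm.nPad) else 0)

/-- Padded phase of depth `N_pad`: use `π̂_j` to decide whether to play arm `j`; if it does not
recommend arm `j`, exploit based on the available data. -/
def paddedArm (j : Fin K) (e : Env K) (st : State K) : Fin K :=
  if piHat P prm j e st = j then j else exploitArm P prm.nPad e st

/-- The event `zeros j N_boot` has been observed. -/
def zerosSeen (j : Fin K) (e : Env K) (st : State K) : Prop :=
  ∀ i < j, prm.nBoot ≤ st.pulls i ∧ successes e i prm.nBoot = 0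

open Classical in
/-- The arm played in phase `q`, and whether an exploration phase for `j₀` has happened by the end
of phase `q`. The phases are: `K` exploitation phases and one more phase (setup), one bootstrapping
phase, `nGrow` phases that grow the exploration probability, and `K` blocks of `nLam` phases that
explore the arms in the random order `θ`. -/
def phaseArm (q : ℕ) (st : State K) (ω : Outcome prm) : Fin K × Bool :=
  let e := ω.1
  let j₀ := ω.2.1
  let θ := ω.2.2.1
  let ℓ₀ := ω.2.2.2.1
  let coin : ℕ → ℝ := fun k => ω.2.2.2.2 k
  if q < K then
    (exploitArm P prm.nBoot e st, st.explored)
  else if q = K then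
    if zerosSeen prm j₀ e st then (j₀, true)
    else (exploitArm P prm.nBoot e st, st.explored)
  else if q = K + 1 then
    if coin 0 ≤ prm.lam * prm.zProb j₀ / (1 + prm.lam * prm.zProb j₀) then (j₀, true)
    else if st.explored then (paddedArm P prm j₀ e st, true)
    else (exploitArm P prm.nPad e st, false)
  else if q < K + 2 + prm.nGrow then
    let k := q - (K + 2)
    let p := min 1 (prm.zProb j₀ * (1 + prm.lam) ^ k)
    if st.explored ∨ 1 ≤ p then (paddedArm P prm j₀ e st, st.explored)
    else if coin (k + 1) ≤ min 1 (p / (1 - p) * prm.lam) then (j₀, true)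
    else (exploitArm P prm.nPad e st, false)
  else
    let r := q - (K + 2 + prm.nGrow)
    let m : Fin K := Fin.ofNat K (r / prm.nLam)
    if r % prm.nLam = ℓ₀ m then (θ m, st.explored)
    else (paddedArm P prm j₀ e st, st.explored)

/-- The number of rounds in phase `q`. -/
def phaseLen (q : ℕ) : ℕ :=
  if q < K then prm.nBoot else if q < K + 2 + prm.nGrow then prm.nPad else prm.nTarget

/-- The total number of phases. -/
def numPhases : ℕ := K + 2 + prm.nGrow + K * prm.nLam

/-- The round in which phase `q` starts (rounds are numbered from `0`). -/
def phaseStart (q : ℕ) : ℕ := ∑ k ∈ Finset.range q, phaseLen prm k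

/-- The total number of rounds. -/
def horizon : ℕ := phaseStart prm (numPhases prm)

/-- The phase that contains round `t < horizon`. -/
def phaseOf (t : ℕ) : ℕ := Nat.findGreatest (fun q => phaseStart prm q ≤ t) (numPhases prm)

/-- The state at the beginning of phase `q`. -/
def stateAt (ω : Outcome prm) : ℕ → State K
  | 0 => ⟨fun _ => 0, false⟩
  | q + 1 =>
    let st := stateAt ω q
    let d := phaseArm P prm q st ω
    ⟨Function.update st.pulls d.1 (st.pulls d.1 + phaseLen prm q), d.2⟩

/-- The arm recommended (and played) in round `t`. -/
def action (t : ℕ) (ω : Outcome prm) : Fin K :=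
  (phaseArm P prm (phaseOf prm t) (stateAt P prm ω (phaseOf prm t)) ω).1

/-- The number of samples of arm `i` collected in rounds `0, …, t - 1`. -/
def samples (t : ℕ) (i : Fin K) (ω : Outcome prm) : ℕ :=
  ((Finset.range t).filter fun s => action P prm s ω = i).card

/-- The reward observed in round `t`. -/
def roundReward (t : ℕ) (ω : Outcome prm) : ℕ :=
  reward ω.1 (action P prm t ω) (samples P prm t (action P prm t ω) ω)

/-- Bayesian incentive-compatibility in the first `T` rounds: when all recommendations are followed,
`E[μ_i - μ_j | A_t = i] ≥ 0` for all rounds `t` and arms `i, j` with `Pr[A_t = i] > 0`. -/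
def IsBIC (T : ℕ) : Prop :=
  ∀ t < T, ∀ i j : Fin K, 0 < law P prm {ω | action P prm t ω = i} →
    0 ≤ ∫ ω, ((ω.1.1 i : ℝ) - (ω.1.1 j : ℝ)) ∂((law P prm)[|{ω | action P prm t ω = i}])

end Algorithm

/-! ### A machine model with a step count

A unit-cost random access machine: finitely many arrays of natural numbers and of real numbers, with
a cost of one for each operation (arithmetic operation, comparison, memory access, control step). -/

/-- Memory: `nat a i` and `real a i` are the entries with index `i` of the arrays number `a`. -/
structure Mem where
  nat : ℕ → ℕ → ℕ
  real : ℕ → ℕ → ℝ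

/-- Overwrite an entry of an array of natural numbers. -/
def Mem.setNat (m : Mem) (a i v : ℕ) : Mem :=
  { m with nat := Function.update m.nat a (Function.update (m.nat a) i v) }

/-- Overwrite an entry of an array of real numbers. -/
def Mem.setReal (m : Mem) (a i : ℕ) (v : ℝ) : Mem :=
  { m with real := Function.update m.real a (Function.update (m.real a) i v) }

/-- Expressions of type `ℕ`; array names are literals, indices are computed. -/
inductive NExp
  | lit (c : ℕ)
  | get (a : ℕ) (i : NExp)
  | add (x y : NExp)
  | sub (x y : NExp)
  | mul (x y : NExp)

def NExp.eval (m : Mem) : NExp → ℕ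
  | lit c => c
  | get a i => m.nat a (i.eval m)
  | add x y => x.eval m + y.eval m
  | sub x y => x.eval m - y.eval m
  | mul x y => x.eval m * y.eval m

def NExp.cost : NExp → ℕ
  | lit _ => 1
  | get _ i => i.cost + 1
  | add x y => x.cost + y.cost + 1
  | sub x y => x.cost + y.cost + 1
  | mul x y => x.cost + y.cost + 1

/-- Expressions of type `ℝ`. -/
inductive RExp
  | lit (c : ℕ)
  | get (a : ℕ) (i : NExp)
  | add (x y : RExp)
  | sub (x y : RExp)
  | mul (x y : RExp)
  | div (x y : RExp)

def RExp.eval (m : Mem) : RExp → ℝ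
  | lit c => c
  | get a i => m.real a (i.eval m)
  | add x y => x.eval m + y.eval m
  | sub x y => x.eval m - y.eval m
  | mul x y => x.eval m * y.eval m
  | div x y => x.eval m / y.eval m

def RExp.cost : RExp → ℕ
  | lit _ => 1
  | get _ i => i.cost + 1
  | add x y => x.cost + y.cost + 1
  | sub x y => x.cost + y.cost + 1
  | mul x y => x.cost + y.cost + 1
  | div x y => x.cost + y.cost + 1

/-- Tests. -/
inductive Test
  | nle (x y : NExp)
  | rle (x y : RExp)

def Test.eval (m : Mem) : Test → Prop
  | nle x y => x.eval m ≤ y.eval m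
  | rle x y => x.eval m ≤ y.eval m

def Test.cost : Test → ℕ
  | nle x y => x.cost + y.cost + 1
  | rle x y => x.cost + y.cost + 1

/-- Programs. `call a b d` calls the exploitation routine on the data set with `nat a i` samples of
arm `i`, of which `nat b i` returned reward `1`, and writes the answer to `nat d 0`. -/
inductive Prog
  | skip
  | setNat (a : ℕ) (i v : NExp)
  | setReal (a : ℕ) (i : NExp) (v : RExp)
  | seq (c d : Prog)
  | branch (b : Test) (c d : Prog)
  | loop (b : Test) (c : Prog)
  | call (a b d : ℕ)

/-- `Exec E c m m' T l`: when started in the memory `m`, the program `c` halts with the memory `m'`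
after `T` steps, having called the exploitation routine `E` on the data sets in the list `l`. -/
inductive Exec (E : (ℕ → ℕ) → (ℕ → ℕ) → ℕ) :
    Prog → Mem → Mem → ℕ → List ((ℕ → ℕ) × (ℕ → ℕ)) → Prop
  | skip (m : Mem) : Exec E .skip m m 1 []
  | setNat (a : ℕ) (i v : NExp) (m : Mem) :
      Exec E (.setNat a i v) m (m.setNat a (i.eval m) (v.eval m)) (i.cost + v.cost + 1) []
  | setReal (a : ℕ) (i : NExp) (v : RExp) (m : Mem) :
      Exec E (.setReal a i v) m (m.setReal a (i.eval m) (v.eval m)) (i.cost + v.cost + 1) []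
  | seq {c d : Prog} {m₁ m₂ m₃ : Mem} {T₁ T₂ : ℕ} {l₁ l₂ : List ((ℕ → ℕ) × (ℕ → ℕ))}
      (h₁ : Exec E c m₁ m₂ T₁ l₁) (h₂ : Exec E d m₂ m₃ T₂ l₂) :
      Exec E (.seq c d) m₁ m₃ (T₁ + T₂) (l₁ ++ l₂)
  | branchTrue {b : Test} {c d : Prog} {m₁ m₂ : Mem} {T : ℕ} {l : List ((ℕ → ℕ) × (ℕ → ℕ))}
      (hb : b.eval m₁) (h : Exec E c m₁ m₂ T l) : Exec E (.branch b c d) m₁ m₂ (b.cost + T + 1) l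
  | branchFalse {b : Test} {c d : Prog} {m₁ m₂ : Mem} {T : ℕ} {l : List ((ℕ → ℕ) × (ℕ → ℕ))}
      (hb : ¬ b.eval m₁) (h : Exec E d m₁ m₂ T l) : Exec E (.branch b c d) m₁ m₂ (b.cost + T + 1) l
  | loopTrue {b : Test} {c : Prog} {m₁ m₂ m₃ : Mem} {T₁ T₂ : ℕ}
      {l₁ l₂ : List ((ℕ → ℕ) × (ℕ → ℕ))}
      (hb : b.eval m₁) (h₁ : Exec E c m₁ m₂ T₁ l₁) (h₂ : Exec E (.loop b c) m₂ m₃ T₂ l₂) :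
      Exec E (.loop b c) m₁ m₃ (b.cost + T₁ + T₂ + 1) (l₁ ++ l₂)
  | loopFalse {b : Test} {c : Prog} {m : Mem} (hb : ¬ b.eval m) :
      Exec E (.loop b c) m m (b.cost + 1) []
  | call (a b d : ℕ) (m : Mem) :
      Exec E (.call a b d) m (m.setNat d 0 (E (m.nat a) (m.nat b))) 1 [(m.nat a, m.nat b)]

section Implementation

variable {K : ℕ} [NeZero K] (P : Fin K → Measure unitInterval) (prm : Params K)

/-- The exploitation routine: arms and data sets are given by natural numbers. -/
def exploitRoutine (n s : ℕ → ℕ) : ℕ := (exploit P (fun i => n i) (fun i => s i) : Fin K)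

/-- The memory before the first round. It holds the parameters and the internal randomness:
`nat 0 = (K, N_boot, N_pad, nGrow, nLam, N, j₀)`, `nat 1 = θ`, `nat 2 = ℓ₀`, `real 0 = (λ)`,
`real 1 = zProb`, `real 2 = coins`. The entry `nat 3 0` is reserved for the latest reward, the entry
`nat 3 1` for the recommendation. Everything else is `0`. -/
def initMem (ω : Outcome prm) : Mem where
  nat := fun a i =>
    if a = 0 then
      [K, prm.nBoot, prm.nPad, prm.nGrow, prm.nLam, prm.nTarget, (ω.2.1 : ℕ)].getD i 0
    else if a = 1 then (if h : i < K then (ω.2.2.1 ⟨i, h⟩ : ℕ) else 0)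
    else if a = 2 then (if h : i < K then (ω.2.2.2.1 ⟨i, h⟩ : ℕ) else 0)
    else 0
  real := fun a i =>
    if a = 0 then (if i = 0 then prm.lam else 0)
    else if a = 1 then (if h : i < K then prm.zProb ⟨i, h⟩ else 0)
    else if a = 2 then (ω.2.2.2.2 i : ℝ)
    else 0

/-- The reward of the previous round (`0` before round `0`). -/
def lastReward (ω : Outcome prm) : ℕ → ℕ
  | 0 => 0
  | t + 1 => roundReward P prm t ω

/-- The program `c`, run once per round on the reward of the previous round, implements the
algorithm for the given outcome, and in each round it makes at most `B` steps, one of which may be a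
call to the exploitation routine, on a data set with at most `S` samples of each arm. Here `mem t`
is the memory before round `t`. -/
def Implements (c : Prog) (B : ℕ) (S : ℝ) (ω : Outcome prm) : Prop :=
  ∃ mem : ℕ → Mem, mem 0 = initMem prm ω ∧
    ∀ t < horizon prm, ∃ (T : ℕ) (l : List ((ℕ → ℕ) × (ℕ → ℕ))),
      Exec (exploitRoutine P) c ((mem t).setNat 3 0 (lastReward P prm ω t)) (mem (t + 1)) T l ∧
      (mem (t + 1)).nat 3 1 = action P prm t ω ∧
      T ≤ B ∧ l.length ≤ 1 ∧ ∀ q ∈ l, ∀ i < K, q.2 i ≤ q.1 i ∧ (q.1 i : ℝ) ≤ S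

end Implementation

end IncExp

end

set_option linter.unusedSectionVars false

namespace IncExp

/-! ### A single prior -/

section OnePrior

variable (P : Measure unitInterval) [IsProbabilityMeasure P]

/-! The arm is constant in each phase, so BIC amounts to $E[(\mu_i-\mu_j)1_{A=i}]\ge 0$ for the arm
$A$ of each phase. Fix the internal randomness. An event decided by the collected data splits into
cylinders of rewards, and on a cylinder the posterior mean of an arm depends on its own counts only
(`setIntegral_gap_cyl`). Hence exploitation has nonnegative gain, even when restricted to an event
decided by the data that it uses (`setIntegral_gap_nonneg`, `setIntegral_exploitArm_nonneg`).

Exploring arm $i$ costs at most the probability of doing so, and padding pays for it. If $j_0=i$ has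
been explored, $\hat\pi_i$ sees $N_{pad}$ samples of $i$ and estimates $\mu_i$ with mean error at
most $1/(2\sqrt{N_{pad}})\le\delta/2$. So the event $\hat\pi_i=i$ has gain at least $\lambda$. On
ZEROS the gain is at least $\lambda z_i$: the zeros leave the posterior means of the competitors
below the best prior mean among them (`sum_gain_ge`, `soloExploit_gain`). For a fixed seed, the
event that $j_0$ has been explored is everything or exactly ZEROS (`section_explored`), so these two
gains suffice. A late phase is therefore BIC once exploring $i$ is at most $\lambda$ times as likely
as a padded phase with $j_0=i$ (`Balanced`, `gap_late`).

The coins are tuned to this balance. In the phase after bootstrapping it holds with equality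
(`balanced_start`). In phase $k$ of the growth loop, $j_0$ has been explored with probability at
least $p_k=\min(1,z(1+\lambda)^k)$ (`growth_le`), so exploring with conditional probability at most
$\lambda p_k/(1-p_k)$ is affordable (`balanced_grow`). When $p_k$ reaches 1, the flag is set surely
and not only almost surely (`coinExplored_of_growth`). In the final loop $\theta(m)$ and $j_0$ are
both uniform and a block has at least $1+1/\lambda$ phases (`balanced_final`).

For the length of the run: about $1/\delta$ zeros push a posterior mean below every prior mean
(`postMean_zeros_lt`), so $N_{boot}\le 1+1/\delta$. By Jensen $z_j\ge\delta^{N_{boot}K}$, so the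
growth loop has $O(K\delta^{-2}\log(1/\delta))$ phases, each of $O(\delta^{-2}\log(1/\delta))$
rounds.

The program has no loops, so its cost per round is bounded by a constant. A padded phase may need
two calls, one for $\hat\pi$ and one for exploitation. The value of $\hat\pi$ is therefore computed
in advance, in rounds that are not the first of their phase, and kept in a table indexed by the
number of successes. The invariants `Ready` and `Finished` say which entries are present. -/

theorem integrable_of_continuous {f : unitInterval → ℝ} (hf : Continuous f) : Integrable f P :=
  hf.integrable_of_hasCompactSupport (HasCompactSupport.of_compactSpace f)

/-- Likelihood of `s` ones in `n` Bernoulli samples (in a fixed order). -/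
noncomputable def lik (n s : ℕ) (x : unitInterval) : ℝ := (x : ℝ) ^ s * (1 - (x : ℝ)) ^ (n - s)

theorem continuous_lik (n s : ℕ) : Continuous (lik n s) := by
  unfold lik; fun_prop

theorem lik_nonneg (n s : ℕ) (x : unitInterval) : 0 ≤ lik n s x :=
  mul_nonneg (pow_nonneg x.2.1 _) (pow_nonneg (sub_nonneg.2 x.2.2) _)

theorem postMean_mul (n s : ℕ) :
    postMean P n s * ∫ x, lik n s x ∂P = ∫ x, (x : ℝ) * lik n s x ∂P := by
  have hD : 0 ≤ ∫ x, lik n s x ∂P := integral_nonneg (lik_nonneg n s)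
  rcases hD.eq_or_lt with h | h
  -- If the data have probability zero, the quotient takes its default value, but the numerator
  -- vanishes as well. So the identity needs no positivity hypothesis.
  · have h1 : ∫ x, (x : ℝ) * lik n s x ∂P ≤ ∫ x, lik n s x ∂P :=
      integral_mono (integrable_of_continuous P (continuous_subtype_val.mul (continuous_lik n s)))
        (integrable_of_continuous P (continuous_lik n s))
        fun x => mul_le_of_le_one_left (lik_nonneg n s x) x.2.2
    have h2 : 0 ≤ ∫ x, (x : ℝ) * lik n s x ∂P :=
      integral_nonneg fun x => mul_nonneg x.2.1 (lik_nonneg n s x)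
    rw [← h, mul_zero]
    linarith
  · exact div_mul_cancel₀ _ h.ne'

theorem integral_sub_mul_lik (c : ℝ) (n s : ℕ) :
    ∫ x, ((x : ℝ) - c) * lik n s x ∂P = (postMean P n s - c) * ∫ x, lik n s x ∂P := by
  have h1 : Integrable (fun x : unitInterval => (x : ℝ) * lik n s x) P :=
    integrable_of_continuous P (continuous_subtype_val.mul (continuous_lik n s))
  have h2 : Integrable (fun x : unitInterval => c * lik n s x) P :=
    (integrable_of_continuous P (continuous_lik n s)).const_mul c
  rw [sub_mul (postMean P n s), postMean_mul, ← integral_const_mul, ← integral_sub h1 h2]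
  simp only [sub_mul]

theorem postMean_zero : postMean P 0 0 = mean P := by
  simp [postMean, mean]

theorem mean_nonneg (P : Measure unitInterval) : 0 ≤ mean P := integral_nonneg fun x => x.2.1

theorem mean_le_one : mean P ≤ 1 := by
  have := integral_mono (integrable_of_continuous P continuous_subtype_val)
    (integrable_const (1 : ℝ)) fun x : unitInterval => x.2.2
  simpa [mean] using this

/-- The mean absolute deviation of a binomial frequency. -/
theorem sum_abs_bernstein_le {n : ℕ} (hn : 0 < n) (x : unitInterval) :
    ∑ k : Fin (n + 1), |(x : ℝ) - (k : ℝ) / n| * bernstein n k x ≤ 1 / (2 * √n) := by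
  have hn' : (0 : ℝ) < n := by exact_mod_cast hn
  have hv := bernstein.variance hn.ne' x
  have hp := bernstein.probability n x
  have h1 : (∑ k : Fin (n + 1), |(x : ℝ) - (k : ℝ) / n| * bernstein n k x) ^ 2 ≤ 1 / (4 * n) := by
    -- Cauchy–Schwarz: the squared mean deviation is at most the variance $x(1-x)/n\le 1/(4n)$ times
    -- the total mass 1.
    have hcs := Finset.sum_mul_sq_le_sq_mul_sq Finset.univ
      (fun k : Fin (n + 1) => |(x : ℝ) - (k : ℝ) / n| * √(bernstein n k x))
      (fun k : Fin (n + 1) => √(bernstein n k x))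
    have e1 : ∀ k : Fin (n + 1), |(x : ℝ) - (k : ℝ) / n| * √(bernstein n k x) *
        √(bernstein n k x) = |(x : ℝ) - (k : ℝ) / n| * bernstein n k x := fun k => by
      rw [mul_assoc, Real.mul_self_sqrt bernstein_nonneg]
    have e2 : ∀ k : Fin (n + 1), (|(x : ℝ) - (k : ℝ) / n| * √(bernstein n k x)) ^ 2 =
        (x - bernstein.z k : ℝ) ^ 2 * bernstein n k x := fun k => by
      rw [mul_pow, Real.sq_sqrt bernstein_nonneg, sq_abs]; rfl
    have e3 : ∀ k : Fin (n + 1), √(bernstein n k x) ^ 2 = bernstein n k x := fun k =>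
      Real.sq_sqrt bernstein_nonneg
    simp only [e1, e2, e3] at hcs
    rw [hv, hp, mul_one] at hcs
    refine hcs.trans ?_
    rw [div_le_div_iff₀ hn' (by positivity)]
    nlinarith [sq_nonneg ((x : ℝ) - 1 / 2)]
  have h2 : (1 / (2 * √n)) ^ 2 = 1 / (4 * (n : ℝ)) := by
    rw [div_pow, mul_pow, Real.sq_sqrt hn'.le]; norm_num
  rw [← h2] at h1
  exact (abs_le_of_sq_le_sq' h1 (by positivity)).2

theorem bernstein_eq_lik (n k : ℕ) (x : unitInterval) :
    bernstein n k x = n.choose k * lik n k x := by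
  rw [bernstein_apply, lik, mul_assoc]

/-- The gain of the decision rule based on `n` samples that accepts a reference value `c` at most
equal to `m`: it is almost as good as with full knowledge of the mean reward. -/
theorem sum_gain_ge {n : ℕ} (hn : 0 < n) {c m : ℝ} (hcm : c ≤ m) (G : ℕ → Prop) [DecidablePred G]
    (hG : ∀ s ≤ n, G s → c ≤ postMean P n s) (hG' : ∀ s ≤ n, ¬ G s → postMean P n s ≤ c) :
    ∫ x, max ((x : ℝ) - m) 0 ∂P - 1 / (2 * √n) ≤
      ∑ s ∈ Finset.range (n + 1) with G s, (n.choose s : ℝ) * ∫ x, ((x : ℝ) - c) * lik n s x ∂P := by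
  have hi : ∀ (a : ℝ) (s : ℕ), Integrable (fun x : unitInterval => ((x : ℝ) - a) * lik n s x) P :=
    fun a s => integrable_of_continuous P (by have := continuous_lik n s; fun_prop)
  have hsplit := fun s => integral_sub_mul_lik P c n s
  have hD : ∀ s, 0 ≤ ∫ x, lik n s x ∂P := fun s => integral_nonneg (lik_nonneg n s)
  -- `G` is the optimal rule for the reference value `c`: it keeps only nonnegative terms and drops
  -- only nonpositive ones. So it beats the naive rule that accepts when the empirical frequency
  -- reaches `m`. Replacing `m` by the smaller `c` only increases each term.
  have h1 : ∑ s ∈ Finset.range (n + 1),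
      (if m ≤ (s : ℝ) / n then (n.choose s : ℝ) * ∫ x, ((x : ℝ) - m) * lik n s x ∂P else 0) ≤
      ∑ s ∈ Finset.range (n + 1) with G s,
        (n.choose s : ℝ) * ∫ x, ((x : ℝ) - c) * lik n s x ∂P := by
    rw [Finset.sum_filter]
    refine Finset.sum_le_sum fun s hs => ?_
    have hs' : s ≤ n := Nat.lt_succ_iff.1 (Finset.mem_range.1 hs)
    have hmc : (n.choose s : ℝ) * ∫ x, ((x : ℝ) - m) * lik n s x ∂P ≤
        (n.choose s : ℝ) * ∫ x, ((x : ℝ) - c) * lik n s x ∂P :=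
      mul_le_mul_of_nonneg_left (integral_mono (hi m s) (hi c s) fun x =>
        mul_le_mul_of_nonneg_right (by linarith) (lik_nonneg n s x)) (Nat.cast_nonneg _)
    by_cases hGs : G s
    · have : 0 ≤ (n.choose s : ℝ) * ∫ x, ((x : ℝ) - c) * lik n s x ∂P := by
        rw [hsplit]
        exact mul_nonneg (Nat.cast_nonneg _) (mul_nonneg (sub_nonneg.2 (hG s hs' hGs)) (hD s))
      rw [if_pos hGs]
      split_ifs <;> linarith
    · have : (n.choose s : ℝ) * ∫ x, ((x : ℝ) - c) * lik n s x ∂P ≤ 0 := by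
        rw [hsplit]
        exact mul_nonpos_of_nonneg_of_nonpos (Nat.cast_nonneg _)
          (mul_nonpos_of_nonpos_of_nonneg (sub_nonpos.2 (hG' s hs' hGs)) (hD s))
      rw [if_neg hGs]
      split_ifs <;> linarith
  refine le_trans ?_ h1
  have h2 : ∑ s ∈ Finset.range (n + 1),
      (if m ≤ (s : ℝ) / n then (n.choose s : ℝ) * ∫ x, ((x : ℝ) - m) * lik n s x ∂P else 0) =
      ∫ x, ∑ s ∈ Finset.range (n + 1),
        (if m ≤ (s : ℝ) / n then ((x : ℝ) - m) * ((n.choose s : ℝ) * lik n s x) else 0) ∂P := by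
    rw [integral_finsetSum]
    · refine Finset.sum_congr rfl fun s _ => ?_
      split_ifs
      · rw [← integral_const_mul]
        exact integral_congr_ae (.of_forall fun x => by ring)
      · simp
    · intro s _
      split_ifs
      · exact integrable_of_continuous P (by have := continuous_lik n s; fun_prop)
      · simp
  rw [h2]
  have h3 : ∫ x, max ((x : ℝ) - m) 0 ∂P - 1 / (2 * √n) =
      ∫ x, (max ((x : ℝ) - m) 0 - 1 / (2 * √n)) ∂P := by
    rw [integral_sub (integrable_of_continuous P (by fun_prop)) (integrable_const _)]
    simp
  rw [h3]
  refine integral_mono (integrable_of_continuous P (by fun_prop)) ?_ fun x => ?_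
  · refine integrable_finsetSum _ fun s _ => ?_
    split_ifs
    · exact integrable_of_continuous P (by have := continuous_lik n s; fun_prop)
    · simp
  · have hb := sum_abs_bernstein_le hn x
    have hp := bernstein.probability n x
    simp only [bernstein_eq_lik] at hb hp
    rw [Fin.sum_univ_eq_sum_range (fun s => |(x : ℝ) - (s : ℝ) / n| * (n.choose s * lik n s x))] at hb
    rw [Fin.sum_univ_eq_sum_range (fun s => (n.choose s * lik n s x))] at hp
    have : max ((x : ℝ) - m) 0 = ∑ s ∈ Finset.range (n + 1),
        max ((x : ℝ) - m) 0 * (n.choose s * lik n s x) := by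
      rw [← Finset.mul_sum, hp, mul_one]
    -- Termwise, the naive rule loses at most the estimation error against full knowledge:
    -- $(x-m)1_{m\le s/n}\ge(x-m)_+-|x-s/n|$.
    have h4 : ∑ s ∈ Finset.range (n + 1), max ((x : ℝ) - m) 0 * (n.choose s * lik n s x) -
        ∑ s ∈ Finset.range (n + 1), |(x : ℝ) - (s : ℝ) / n| * (n.choose s * lik n s x) ≤
        ∑ s ∈ Finset.range (n + 1),
        (if m ≤ (s : ℝ) / n then ((x : ℝ) - m) * ((n.choose s : ℝ) * lik n s x) else 0) := by
      rw [← Finset.sum_sub_distrib]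
      refine Finset.sum_le_sum fun s _ => ?_
      have hw : 0 ≤ (n.choose s : ℝ) * lik n s x :=
        mul_nonneg (Nat.cast_nonneg _) (lik_nonneg n s x)
      rw [← sub_mul]
      split_ifs with h
      · refine mul_le_mul_of_nonneg_right ?_ hw
        rcases le_total m x with h' | h'
        · rw [max_eq_left (by linarith)]; linarith [abs_nonneg ((x : ℝ) - (s : ℝ) / n)]
        · rw [max_eq_right (by linarith)]; linarith [neg_abs_le ((x : ℝ) - (s : ℝ) / n)]
      · refine mul_nonpos_of_nonpos_of_nonneg ?_ hw
        push Not at h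
        rw [sub_nonpos]
        refine max_le ?_ (abs_nonneg _)
        linarith [le_abs_self ((x : ℝ) - (s : ℝ) / n)]
    simp only
    linarith

/-- With $t=y/a$, Bernoulli's inequality gives $1+nt\le(1+t)^n$, and $(1+t)^n(1-t)^n\le1$; hence
$nt(1-t)^n\le1$. The spare factor $a\le1$ is discarded. In `postMean_zeros_lt` this bounds the
contribution of the means above the reference value. -/
theorem mul_pow_sub_le {y a : ℝ} (hy : 0 ≤ y) (hya : y ≤ a) (ha : a ≤ 1) {n : ℕ} (hn : 0 < n) :
    n * (y * (a - y) ^ n) ≤ a ^ n := by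
  rcases hy.eq_or_lt with rfl | hy
  · simp; positivity
  have ha0 : 0 < a := hy.trans_le hya
  have h1 : 1 + (n : ℝ) * (y / a) ≤ (1 + y / a) ^ n :=
    one_add_mul_le_pow (by have : 0 < y / a := by positivity
                           linarith) n
  have hya' : y / a ≤ 1 := (div_le_one ha0).2 hya
  have h2 : (1 + y / a) ^ n * (1 - y / a) ^ n ≤ 1 := by
    rw [← mul_pow]
    refine pow_le_one₀ (by nlinarith [div_pos hy ha0]) (by nlinarith [sq_nonneg (y / a)])
  have h3 : n * (y / a) * (1 - y / a) ^ n ≤ 1 := by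
    have : 0 ≤ (1 - y / a) ^ n := pow_nonneg (by linarith) _
    nlinarith
  have h4 : (a - y) ^ n = a ^ n * (1 - y / a) ^ n := by
    rw [← mul_pow]; congr 1; field_simp
  have h5 : n * (y * (a - y) ^ n) = (n * (y / a) * (1 - y / a) ^ n) * (a * a ^ n) := by
    rw [h4]; field_simp
  rw [h5]
  calc _ ≤ 1 * (a * a ^ n) := mul_le_mul_of_nonneg_right h3 (by positivity)
    _ ≤ a ^ n := by nlinarith [pow_pos ha0 n]

/-- After about `1/δ` zeros, the posterior mean drops below the reference value. -/
theorem postMean_zeros_lt {c δ : ℝ} (hδ : δ ≤ ∫ x, max (c - (x : ℝ)) 0 ∂P) (hc0 : 0 ≤ c)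
    (hc : c < 1) {n : ℕ} (hn : 1 / δ < n) (hδ0 : 0 < δ) : postMean P n 0 < c := by
  have hn0 : (0 : ℝ) < n := lt_trans (by positivity) hn
  have hn0' : 0 < n := by exact_mod_cast hn0
  have ha : 0 < 1 - c := by linarith
  -- Below `c` the likelihood of the zeros is at least $(1-c)^n$. Above `c` the negative part is at
  -- most $(1-c)^n/n$, by `mul_pow_sub_le` with $y=x-c$ and $a=1-c$. After integration the gain
  -- $\delta$ outweighs $1/n$.
  have hpt : ∀ x : unitInterval, (1 - c) ^ n * (max (c - (x : ℝ)) 0 - 1 / n) ≤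
      (c - x) * lik n 0 x := fun x => by
    have hl : lik n 0 x = (1 - (x : ℝ)) ^ n := by simp [lik]
    rw [hl]
    rcases le_total (x : ℝ) c with h | h
    · rw [max_eq_left (by linarith)]
      have : (1 - c) ^ n ≤ (1 - (x : ℝ)) ^ n := pow_le_pow_left₀ ha.le (by linarith) n
      have h1 : 0 < (1 - c) ^ n * (1 / n) := by positivity
      nlinarith
    · rw [max_eq_right (by linarith)]
      have h1 := mul_pow_sub_le (y := x - c) (a := 1 - c) (by linarith) (by linarith [x.2.2])
        (by linarith) hn0'
      have h2 : (1 - c) - (x - c) = 1 - (x : ℝ) := by ring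
      rw [h2] at h1
      have h3 : (x - c) * (1 - (x : ℝ)) ^ n ≤ (1 - c) ^ n * (1 / n) := by
        rw [mul_one_div, le_div_iff₀ hn0]; linarith
      linarith
  have h1 := integral_mono (integrable_of_continuous P (by fun_prop))
    (integrable_of_continuous P (by have := continuous_lik n 0; fun_prop)) hpt
  rw [integral_const_mul, integral_sub (integrable_of_continuous P (by fun_prop))
    (integrable_const _)] at h1
  simp only [integral_const, probReal_univ, smul_eq_mul, one_mul] at h1
  have h2 : 0 < (1 - c) ^ n * (∫ x, max (c - (x : ℝ)) 0 ∂P - 1 / n) := by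
    refine mul_pos (by positivity) (sub_pos.2 (lt_of_lt_of_le ?_ hδ))
    rwa [one_div_lt hn0 hδ0]
  have h3 : ∫ x, (c - (x : ℝ)) * lik n 0 x ∂P = -((postMean P n 0 - c) * ∫ x, lik n 0 x ∂P) := by
    rw [← integral_sub_mul_lik, ← integral_neg]
    exact integral_congr_ae (.of_forall fun x => by ring)
  rw [h3] at h1
  by_contra hcon
  push Not at hcon
  have := mul_nonneg (sub_nonneg.2 hcon)
    (integral_nonneg (μ := P) (lik_nonneg n 0))
  linarith

/-- Jensen's inequality for $(1-x)^n$, in the form of the tangent line at the mean (Bernoulli's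
inequality), which is then integrated. -/
theorem integral_lik_zeros_ge (n : ℕ) (h : mean P < 1) :
    (1 - mean P) ^ n ≤ ∫ x, lik n 0 x ∂P := by
  have ha : 0 < 1 - mean P := by linarith
  have hpt : ∀ x : unitInterval,
      (1 - mean P) ^ n * (1 + n * ((1 - (x : ℝ)) / (1 - mean P) - 1)) ≤ lik n 0 x := fun x => by
    have hx : 0 ≤ (1 - (x : ℝ)) / (1 - mean P) := div_nonneg (by linarith [x.2.2]) ha.le
    have h1 := one_add_mul_le_pow (a := (1 - (x : ℝ)) / (1 - mean P) - 1) (by linarith) n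
    have h2 : lik n 0 x = (1 - mean P) ^ n * (1 + ((1 - (x : ℝ)) / (1 - mean P) - 1)) ^ n := by
      rw [← mul_pow]; simp only [lik]; simp; congr 1; field_simp
    rw [h2]
    exact mul_le_mul_of_nonneg_left h1 (by positivity)
  have h1 := integral_mono (integrable_of_continuous P (by fun_prop))
    (integrable_of_continuous P (continuous_lik n 0)) hpt
  refine le_trans (le_of_eq ?_) h1
  rw [integral_const_mul, integral_add (integrable_const _)
    (integrable_of_continuous P (by fun_prop)), integral_const_mul, integral_sub
    (integrable_of_continuous P (by fun_prop)) (integrable_const _), integral_div,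
    integral_sub (integrable_const _) (integrable_of_continuous P (by fun_prop))]
  simp only [integral_const, probReal_univ, smul_eq_mul, one_mul]
  rw [show ∫ x, (x : ℝ) ∂P = mean P from rfl, div_self ha.ne']
  simp

end OnePrior

end IncExp

namespace IncExp

/-! ### Cylinders of rewards -/

section Environment

variable {K : ℕ}

/-- The environments in which the first `n i` samples of each arm `i` return the rewards `r i`. -/
def cyl (n : Fin K → ℕ) (r : Fin K → ℕ → ℕ) : Set (Env K) :=
  {e | ∀ i, ∀ k < n i, reward e i k = r i k}

theorem reward_eq_zero_or_one (e : Env K) (i : Fin K) (k : ℕ) :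
    reward e i k = 0 ∨ reward e i k = 1 := by
  unfold reward; split_ifs <;> simp

theorem reward_le_one (e : Env K) (i : Fin K) (k : ℕ) : reward e i k ≤ 1 := by
  rcases reward_eq_zero_or_one e i k with h | h <;> omega

theorem successes_succ (e : Env K) (i : Fin K) (n : ℕ) :
    successes e i (n + 1) = successes e i n + reward e i n := Finset.sum_range_succ _ _

theorem successes_le (e : Env K) (i : Fin K) (n : ℕ) : successes e i n ≤ n := by
  induction n with
  | zero => simp [successes]
  | succ n ih => rw [successes_succ]; have := reward_le_one e i n; omega

theorem successes_congr {e e' : Env K} {i : Fin K} {n : ℕ}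
    (h : ∀ k < n, reward e' i k = reward e i k) : successes e' i n = successes e i n :=
  Finset.sum_congr rfl fun k hk => h k (Finset.mem_range.1 hk)

theorem successes_eq_zero_iff {e : Env K} {i : Fin K} {n : ℕ} :
    successes e i n = 0 ↔ ∀ k < n, reward e i k = 0 := by
  simp [successes]

theorem measurable_reward (i : Fin K) (k : ℕ) : Measurable fun e : Env K => reward e i k := by
  unfold reward
  refine Measurable.ite (measurableSet_lt ?_ ?_) measurable_const measurable_const <;> fun_prop

theorem measurable_successes (i : Fin K) (n : ℕ) : Measurable fun e : Env K => successes e i n :=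
  Finset.measurable_fun_sum _ fun k _ => measurable_reward i k

theorem measurableSet_cyl (n : Fin K → ℕ) (r : Fin K → ℕ → ℕ) : MeasurableSet (cyl n r) := by
  have : cyl n r = ⋂ i, ⋂ k, ⋂ (_ : k < n i), {e | reward e i k = r i k} := by
    ext e; simp [cyl]
  rw [this]
  exact .iInter fun i => .iInter fun k => .iInter fun _ =>
    measurable_reward i k (measurableSet_singleton _)

theorem prod_likelihood (x : unitInterval) (r : ℕ → ℕ) (hr : ∀ k, r k = 0 ∨ r k = 1) (n : ℕ) :
    ∏ k ∈ Finset.range n, (if r k = 1 then (x : ℝ) else 1 - x) =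
      lik n (∑ k ∈ Finset.range n, r k) x := by
  unfold lik
  induction n with
  | zero => simp
  | succ n ih =>
    have hle : ∑ k ∈ Finset.range n, r k ≤ n := by
      calc _ ≤ ∑ k ∈ Finset.range n, 1 :=
            Finset.sum_le_sum fun k _ => by rcases hr k with h | h <;> omega
        _ = n := by simp
    rw [Finset.prod_range_succ, ih, Finset.sum_range_succ]
    rcases hr n with h | h
    · rw [h, if_neg (by norm_num), add_zero, Nat.sub_add_comm hle, pow_succ (1 - (x : ℝ))]; ring
    · rw [h, if_pos rfl, Nat.add_sub_add_right, pow_succ (x : ℝ)]; ring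

/-- For fixed mean rewards a cylinder is a box in the thresholds: reward 1 confines a threshold to
an interval of length $x_i$, reward 0 to one of length $1-x_i$. -/
theorem thresholds_cyl (x : Fin K → unitInterval) (n : Fin K → ℕ) (r : Fin K → ℕ → ℕ)
    (hr : ∀ i k, r i k = 0 ∨ r i k = 1) :
    (Measure.infinitePi fun _ : Fin K × ℕ => (volume : Measure unitInterval)).real
      {u | (x, u) ∈ cyl n r} = ∏ i, lik (n i) (∑ k ∈ Finset.range (n i), r i k) (x i) := by
  classical
  let s : Finset (Fin K × ℕ) :=
    Finset.univ.biUnion fun i => (Finset.range (n i)).image fun k => (i, k)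
  let t : Fin K × ℕ → Set unitInterval := fun p => if r p.1 p.2 = 1 then Set.Iio (x p.1)
    else Set.Ici (x p.1)
  have hs : ∀ p : Fin K × ℕ, p ∈ s ↔ p.1 ∈ Finset.univ ∧ p.2 ∈ Finset.range (n p.1) := by
    rintro ⟨i, k⟩; simp [s]
  have hset : {u | (x, u) ∈ cyl n r} = Set.pi (s : Set (Fin K × ℕ)) t := by
    ext u
    simp only [cyl, Set.mem_ofPred_eq, Set.mem_pi, Finset.mem_coe, hs, Prod.forall, Finset.mem_univ,
      Finset.mem_range, true_and]
    refine forall_congr' fun i => forall_congr' fun k => imp_congr_right fun _ => ?_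
    simp only [reward, t]
    rcases hr i k with h | h <;> simp [h]
  have ht : ∀ p, MeasurableSet (t p) := fun p => by
    simp only [t]; split_ifs
    exacts [measurableSet_Iio, measurableSet_Ici]
  rw [hset, measureReal_def, Measure.infinitePi_pi _ fun p _ => ht p, ENNReal.toReal_prod]
  rw [Finset.prod_finset_product' s Finset.univ (fun i => Finset.range (n i)) hs
    (f := fun i k => ((volume : Measure unitInterval) (t (i, k))).toReal)]
  refine Finset.prod_congr rfl fun i _ => ?_
  rw [← prod_likelihood (x i) (r i) (hr i)]
  refine Finset.prod_congr rfl fun k _ => ?_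
  simp only [t]
  split_ifs
  · rw [unitInterval.volume_Iio, ENNReal.toReal_ofReal (x i).2.1]
  · rw [unitInterval.volume_Ici, ENNReal.toReal_ofReal (sub_nonneg.2 (x i).2.2)]

variable (P : Fin K → Measure unitInterval) [∀ i, IsProbabilityMeasure (P i)]

instance : IsProbabilityMeasure (envLaw P) := by unfold envLaw; infer_instance

theorem integrable_env {f : (Fin K → unitInterval) → ℝ} (hf : Continuous f) :
    Integrable (fun e : Env K => f e.1) (envLaw P) := by
  have h : Integrable f (Measure.pi P) :=
    hf.integrable_of_hasCompactSupport (HasCompactSupport.of_compactSpace f)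
  unfold envLaw
  exact h.comp_fst _

/-- Fubini: the thresholds are integrated first, then the product prior splits over the arms.
Product test functions cover both uses, the probability of a cylinder and the mean reward of one
arm. -/
theorem setIntegral_cyl (n : Fin K → ℕ) (r : Fin K → ℕ → ℕ)
    (hr : ∀ i k, r i k = 0 ∨ r i k = 1) {f : Fin K → unitInterval → ℝ}
    (hf : ∀ i, Continuous (f i)) :
    ∫ e in cyl n r, ∏ i, f i (e.1 i) ∂(envLaw P) =
      ∏ i, ∫ x, f i x * lik (n i) (∑ k ∈ Finset.range (n i), r i k) x ∂(P i) := by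
  have hc : Continuous fun x : Fin K → unitInterval => ∏ i, f i (x i) := by fun_prop
  have hm := measurableSet_cyl n r
  rw [← integral_indicator hm, envLaw, integral_prod]
  · rw [← integral_fintype_prod_eq_prod
      (f := fun i x => f i x * lik (n i) (∑ k ∈ Finset.range (n i), r i k) x)]
    refine integral_congr_ae (.of_forall fun x => ?_)
    simp only
    rw [Finset.prod_mul_distrib, ← thresholds_cyl x n r hr]
    have : (fun u => (cyl n r).indicator (fun e : Env K => ∏ i, f i (e.1 i)) (x, u)) =
        {u | (x, u) ∈ cyl n r}.indicator fun _ => ∏ i, f i (x i) := by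
      ext u; simp [Set.indicator]
    have hm' : MeasurableSet {u | (x, u) ∈ cyl n r} := measurable_prodMk_left hm
    rw [this, integral_indicator hm', setIntegral_const, smul_eq_mul,
      mul_comm]
  · exact (integrable_env P hc).indicator hm

theorem measure_cyl (n : Fin K → ℕ) (r : Fin K → ℕ → ℕ) (hr : ∀ i k, r i k = 0 ∨ r i k = 1) :
    (envLaw P).real (cyl n r) =
      ∏ i, ∫ x, lik (n i) (∑ k ∈ Finset.range (n i), r i k) x ∂(P i) := by
  have := setIntegral_cyl P n r hr (f := fun _ _ => 1) fun _ => continuous_const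
  simpa using this

theorem setIntegral_mean_cyl (n : Fin K → ℕ) (r : Fin K → ℕ → ℕ)
    (hr : ∀ i k, r i k = 0 ∨ r i k = 1) (i : Fin K) :
    ∫ e in cyl n r, (e.1 i : ℝ) ∂(envLaw P) =
      postMean (P i) (n i) (∑ k ∈ Finset.range (n i), r i k) * (envLaw P).real (cyl n r) := by
  classical
  have h := setIntegral_cyl P n r hr (f := fun k x => if k = i then (x : ℝ) else 1) fun k => by
    by_cases h : k = i
    · simp only [h, if_true]; fun_prop
    · simp only [h, if_false]; fun_prop
  rw [measure_cyl P n r hr]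
  have h1 : ∀ e : Env K, ∏ k, (if k = i then (e.1 k : ℝ) else 1) = e.1 i := fun e => by simp
  simp only [h1] at h
  rw [h, ← Finset.mul_prod_erase _ _ (Finset.mem_univ i), ← Finset.mul_prod_erase _
    (fun i => ∫ x, lik (n i) (∑ k ∈ Finset.range (n i), r i k) x ∂(P i)) (Finset.mem_univ i),
    ← mul_assoc, postMean_mul]
  simp only [if_true]
  congr 1
  refine Finset.prod_congr rfl fun k hk => ?_
  simp [Finset.ne_of_mem_erase hk]

theorem integrable_gap (i j : Fin K) :
    Integrable (fun e : Env K => (e.1 i : ℝ) - (e.1 j : ℝ)) (envLaw P) :=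
  integrable_env P (f := fun x => (x i : ℝ) - (x j : ℝ)) (by fun_prop)

theorem setIntegral_gap_cyl (n : Fin K → ℕ) (r : Fin K → ℕ → ℕ)
    (hr : ∀ i k, r i k = 0 ∨ r i k = 1) (i j : Fin K) :
    ∫ e in cyl n r, ((e.1 i : ℝ) - (e.1 j : ℝ)) ∂(envLaw P) =
      (postMean (P i) (n i) (∑ k ∈ Finset.range (n i), r i k) -
        postMean (P j) (n j) (∑ k ∈ Finset.range (n j), r j k)) * (envLaw P).real (cyl n r) := by
  rw [integral_sub (integrable_env P (f := fun x => (x i : ℝ)) (by fun_prop)).integrableOn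
    (integrable_env P (f := fun x => (x j : ℝ)) (by fun_prop)).integrableOn,
    setIntegral_mean_cyl P n r hr, setIntegral_mean_cyl P n r hr, sub_mul]

/-- If membership in `B` is decided by adaptively collected data (`N e i` samples of each arm `i`),
and the posterior mean of arm `i` given these data is at least that of arm `j`, then arm `i` is at
least as good as arm `j` on `B`. -/
theorem setIntegral_gap_nonneg {B : Set (Env K)} (N : Env K → Fin K → ℕ)
    (hB : ∀ e ∈ B, ∀ e' : Env K, (∀ i, ∀ k < N e i, reward e' i k = reward e i k) →
      e' ∈ B ∧ N e' = N e) (i j : Fin K)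
    (hij : ∀ e ∈ B, postMean (P j) (N e j) (successes e j (N e j)) ≤
      postMean (P i) (N e i) (successes e i (N e i))) :
    0 ≤ ∫ e in B, ((e.1 i : ℝ) - (e.1 j : ℝ)) ∂(envLaw P) := by
  -- `B` is cut according to the complete record of the observed data. There are countably many
  -- records. Since the data decide both membership in `B` and the sample counts, each nonempty
  -- piece is a whole cylinder; in particular the measurability of `B` need not be assumed.
  let S : (Σ n : Fin K → ℕ, ∀ i, Fin (n i) → ℕ) → Set (Env K) := fun v =>
    {e ∈ B | N e = v.1 ∧ ∀ i (k : Fin (v.1 i)), reward e i k = v.2 i k}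
  have hS : ∀ v e, e ∈ S v → S v = cyl (N e) (reward e) := by
    rintro ⟨n, r⟩ e ⟨heB, rfl, hr⟩
    ext e'
    constructor
    · rintro ⟨_, _, h⟩ i k hk
      rw [h i ⟨k, hk⟩, ← hr i ⟨k, hk⟩]
    · intro h
      obtain ⟨h1, h2⟩ := hB e heB e' h
      exact ⟨h1, h2, fun i k => (h i k k.2).trans (hr i k)⟩
  have hU : B = ⋃ v, S v := by
    ext e
    simp only [Set.mem_iUnion]
    exact ⟨fun h => ⟨⟨N e, fun i k => reward e i k⟩, h, rfl, fun _ _ => rfl⟩, fun ⟨_, h⟩ => h.1⟩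
  have hmeas : ∀ v, MeasurableSet (S v) := fun v => by
    rcases (S v).eq_empty_or_nonempty with h | ⟨e, he⟩
    · rw [h]; exact .empty
    · rw [hS v e he]; exact measurableSet_cyl _ _
  have hdis : Pairwise (Function.onFun Disjoint S) := by
    rintro ⟨n, r⟩ ⟨n', r'⟩ hne
    refine Set.disjoint_left.2 fun e h1 h2 => hne ?_
    obtain ⟨_, rfl, h1⟩ := h1
    obtain ⟨_, h2, h3⟩ := h2
    simp only at h2
    subst h2
    congr 1
    funext i k
    exact (h1 i k).symm.trans (h3 i k)
  rw [hU, integral_iUnion hmeas hdis (integrable_gap P i j).integrableOn]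
  refine tsum_nonneg fun v => ?_
  rcases (S v).eq_empty_or_nonempty with h | ⟨e, he⟩
  · rw [h]; simp
  · rw [hS v e he, setIntegral_gap_cyl P _ _ (reward_eq_zero_or_one e)]
    exact mul_nonneg (sub_nonneg.2 (hij e he.1)) measureReal_nonneg

/-! ### Exploitation -/

theorem le_argmax [NeZero K] (f : Fin K → ℝ) (k : Fin K) : f k ≤ f (argmax f) := by
  have := Finset.min'_mem _ (argmax_nonempty f)
  rw [Set.Finite.mem_toFinset] at this
  exact this k

theorem argmax_le [NeZero K] {f : Fin K → ℝ} {i : Fin K} (h : ∀ k, f k ≤ f i) : argmax f ≤ i :=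
  Finset.min'_le _ _ (by simpa using h)

theorem argmax_eq [NeZero K] {f : Fin K → ℝ} {i : Fin K} (h : ∀ k, f k ≤ f i)
    (h' : ∀ k < i, f k < f i) : argmax f = i := by
  by_contra hne
  exact absurd (h' _ (lt_of_le_of_ne (argmax_le h) hne)) (not_lt.2 (le_argmax f i))

theorem sum_indicator_range {n : ℕ} {A : Finset ℕ} (hA : A ⊆ Finset.range n) :
    ∑ k ∈ Finset.range n, (if k ∈ A then 1 else 0) = A.card := by
  rw [Finset.sum_ite_mem, Finset.inter_eq_right.2 hA, Finset.card_eq_sum_ones]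

/-- Exploitation based on `n` samples of arm `j`, of which `s` returned reward `1`. -/
noncomputable def soloExploit [NeZero K] (j : Fin K) (n s : ℕ) : Fin K :=
  exploit P (fun i => if i = j then n else 0) (fun i => if i = j then s else 0)

/-- The rule compares the posterior mean of `j` with the best prior mean `c` of the other arms, so
it is the optimal rule of `sum_gain_ge`. On the cylinder of zeros the arm `i` has posterior mean at
most `c` by `hz`, so the gap to `i` is at least the gap to `c`. The cylinder contains no data on
`j`, hence its probability factors out. Without zeros this gives `gain_univ`, with zeros below `j`
it gives `gain_zeros`. -/
theorem soloExploit_gain [NeZero K] {j i : Fin K} (hij : i ≠ j) {n : ℕ} (hn : 0 < n) {m : ℝ}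
    (hm : ∀ i, mean (P i) ≤ m) (nz : Fin K → ℕ) (hnz : nz j = 0)
    (hz : ∀ i ≠ j, ∃ k ≠ j, postMean (P i) (nz i) 0 ≤ mean (P k)) :
    (∫ x, max ((x : ℝ) - m) 0 ∂(P j) - 1 / (2 * √n)) * (envLaw P).real (cyl nz 0) ≤
      ∫ e in cyl nz 0 ∩ {e | soloExploit P j n (successes e j n) = j},
        ((e.1 j : ℝ) - (e.1 i : ℝ)) ∂(envLaw P) := by
  classical
  obtain ⟨⟨l, hl⟩, hlmax⟩ := haveI : Nonempty {k // k ≠ j} := ⟨⟨i, hij⟩⟩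
    Finite.exists_max fun k : {k // k ≠ j} => mean (P k)
  set c := mean (P l)
  have hc : ∀ k ≠ j, mean (P k) ≤ c := fun k hk => hlmax ⟨k, hk⟩
  have hzc : ∀ k ≠ j, postMean (P k) (nz k) 0 ≤ c := fun k hk => by
    obtain ⟨k', hk', h⟩ := hz k hk
    exact h.trans (hc k' hk')
  let G : ℕ → Prop := fun s => soloExploit P j n s = j
  have hgain := sum_gain_ge (P j) hn (hm l) G
    (fun s _ hs => by
      have := le_argmax (fun i => postMean (P i) (if i = j then n else 0) (if i = j then s else 0)) l
      change soloExploit P j n s = j at hs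
      simp only [soloExploit, exploit] at hs
      rw [hs] at this
      simpa [hl, postMean_zero] using this)
    (fun s _ hs => by
      have := le_argmax (fun i => postMean (P i) (if i = j then n else 0) (if i = j then s else 0)) j
      change soloExploit P j n s ≠ j at hs
      simp only [soloExploit, exploit] at hs
      simp only [hs, if_true, if_false, postMean_zero] at this
      exact this.trans (hc _ hs))
  -- `A` is the set of those samples of `j` that return 1; all other recorded rewards are 0. The
  -- event is the disjoint union of the cylinders of these tables over the sets `A` whose size is
  -- accepted.
  let R : Finset ℕ → Fin K → ℕ → ℕ := fun A i k => if i = j ∧ k ∈ A then 1 else 0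
  have hR : ∀ A i k, R A i k = 0 ∨ R A i k = 1 := fun A i k => by simp only [R]; split_ifs <;> simp
  let n' : Fin K → ℕ := Function.update nz j n
  let S := (Finset.range n).powerset.filter fun A => G A.card
  have hsum : ∀ A ⊆ Finset.range n, ∑ k ∈ Finset.range (n' j), R A j k = A.card := fun A hA => by
    simp only [n', Function.update_self, R, true_and]
    exact sum_indicator_range hA
  have hsum0 : ∀ A, ∀ k ≠ j, ∑ l ∈ Finset.range (n' k), R A k l = 0 := fun A k hk => by
    simp [R, hk]
  have hn' : ∀ k ≠ j, n' k = nz k := fun k hk => Function.update_of_ne hk _ _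
  have hsucc : ∀ A ⊆ Finset.range n, ∀ e ∈ cyl n' (R A), successes e j n = A.card := by
    intro A hA e he
    rw [← hsum A hA]
    simp only [n', Function.update_self, successes]
    refine Finset.sum_congr rfl fun k hk => he j k ?_
    simpa [n'] using hk
  have hset : cyl nz 0 ∩ {e | soloExploit P j n (successes e j n) = j} =
      ⋃ A ∈ S, cyl n' (R A) := by
    ext e
    simp only [Set.mem_inter_iff, Set.mem_iUnion, exists_prop]
    constructor
    · rintro ⟨h1, h2⟩
      have hcyl : e ∈ cyl n' (R ((Finset.range n).filter fun k => reward e j k = 1)) := by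
        intro k l hkl
        by_cases hk : k = j
        · subst hk
          simp only [n', Function.update_self] at hkl
          rcases reward_eq_zero_or_one e k l with h | h <;> simp [R, hkl, h]
        · rw [hn' k hk] at hkl
          simp [R, hk, h1 k l hkl]
      refine ⟨_, Finset.mem_filter.2 ⟨Finset.mem_powerset.2 (Finset.filter_subset _ _), ?_⟩, hcyl⟩
      rw [← hsucc _ (Finset.filter_subset _ _) e hcyl]
      exact h2
    · rintro ⟨A, hA, he⟩
      obtain ⟨hA, hAG⟩ := Finset.mem_filter.1 hA
      refine ⟨fun k l hkl => ?_, ?_⟩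
      · have hk : k ≠ j := by rintro rfl; omega
        have := he k l (by rwa [hn' k hk])
        simpa [R, hk] using this
      · rw [Set.mem_ofPred_eq, hsucc A (Finset.mem_powerset.1 hA) e he]
        exact hAG
  have hdis : (S : Set (Finset ℕ)).Pairwise (Function.onFun Disjoint fun A => cyl n' (R A)) := by
    intro A hA A' hA' hne
    refine Set.disjoint_left.2 fun e h1 h2 => hne ?_
    have hA := Finset.mem_powerset.1 (Finset.mem_filter.1 hA).1
    have hA' := Finset.mem_powerset.1 (Finset.mem_filter.1 hA').1
    have key : ∀ k < n, (k ∈ A ↔ k ∈ A') := fun k hk => by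
      have e1 := h1 j k (by simpa [n'] using hk)
      have e2 := h2 j k (by simpa [n'] using hk)
      rw [e1] at e2
      simp only [R, true_and] at e2
      by_cases ha : k ∈ A <;> by_cases hb : k ∈ A' <;> simp_all
    ext k
    exact ⟨fun h => (key k (Finset.mem_range.1 (hA h))).1 h,
      fun h => (key k (Finset.mem_range.1 (hA' h))).2 h⟩
  rw [hset, integral_biUnion_finset S (fun A _ => measurableSet_cyl _ _) hdis
    fun A _ => (integrable_gap P j i).integrableOn]
  have hcylA : ∀ A ⊆ Finset.range n, (envLaw P).real (cyl n' (R A)) =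
      (∫ x, lik n A.card x ∂(P j)) * (envLaw P).real (cyl nz 0) := by
    intro A hA
    rw [measure_cyl P n' (R A) (hR A), measure_cyl P nz 0 (by simp),
      ← Finset.mul_prod_erase _ _ (Finset.mem_univ j), ← Finset.mul_prod_erase _
      (fun i => ∫ x, lik (nz i) (∑ k ∈ Finset.range (nz i), (0 : Fin K → ℕ → ℕ) i k) x ∂(P i))
      (Finset.mem_univ j), hsum A hA]
    have h1 : ∫ x, lik (nz j) (∑ k ∈ Finset.range (nz j), (0 : Fin K → ℕ → ℕ) j k) x ∂(P j) = 1 := by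
      simp [hnz, lik]
    rw [h1, one_mul]
    simp only [n', Function.update_self]
    congr 1
    refine Finset.prod_congr rfl fun k hk => ?_
    have hk := Finset.ne_of_mem_erase hk
    rw [hsum0 A k hk, Function.update_of_ne hk]
    simp
  have hterm : ∀ A ∈ S, (∫ x, ((x : ℝ) - c) * lik n A.card x ∂(P j)) * (envLaw P).real (cyl nz 0) ≤
      ∫ e in cyl n' (R A), ((e.1 j : ℝ) - (e.1 i : ℝ)) ∂(envLaw P) := by
    intro A hA
    have hA := Finset.mem_powerset.1 (Finset.mem_filter.1 hA).1
    rw [setIntegral_gap_cyl P _ _ (hR A), hcylA A hA, integral_sub_mul_lik, hsum A hA,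
      hsum0 A i hij, hn' i hij, mul_assoc]
    have hnj : n' j = n := Function.update_self _ _ _
    rw [hnj]
    refine mul_le_mul_of_nonneg_right (sub_le_sub_left (hzc i hij) _) ?_
    exact mul_nonneg (integral_nonneg (lik_nonneg n _)) measureReal_nonneg
  refine le_trans ?_ (Finset.sum_le_sum hterm)
  rw [← Finset.sum_mul]
  refine mul_le_mul_of_nonneg_right (hgain.trans (le_of_eq ?_)) measureReal_nonneg
  -- Only the size of `A` enters, so grouping the sets by size produces the binomial coefficients of
  -- `sum_gain_ge`.
  simp only [S]
  rw [Finset.sum_filter, Finset.sum_filter, Finset.sum_powerset_apply_card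
    (fun s => if G s then ∫ x, ((x : ℝ) - c) * lik n s x ∂(P j) else 0), Finset.card_range]
  refine Finset.sum_congr rfl fun s _ => ?_
  split_ifs
  · rw [nsmul_eq_mul]
  · simp

end Environment

end IncExp

namespace IncExp

/-! ### The parameters -/

section Parameters

variable {K : ℕ}

theorem zeros_eq_cyl (j : Fin K) (n : ℕ) : zeros j n = cyl (fun i => if i < j then n else 0) 0 := by
  ext e
  simp only [zeros, cyl, Set.mem_ofPred_eq]
  refine forall_congr' fun i => ?_
  by_cases h : i < j <;> simp [h]

theorem measurableSet_zeros (j : Fin K) (n : ℕ) : MeasurableSet (zeros j n) := by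
  rw [zeros_eq_cyl]; exact measurableSet_cyl _ _

variable (P : Fin K → Measure unitInterval) [∀ i, IsProbabilityMeasure (P i)]

theorem measure_zeros (j : Fin K) (n : ℕ) :
    (envLaw P).real (zeros j n) = ∏ i, ∫ x, lik (if i < j then n else 0) 0 x ∂(P i) := by
  rw [zeros_eq_cyl, measure_cyl P _ _ (by simp)]
  simp

theorem integral_lik_zeros_le_one (Q : Measure unitInterval) [IsProbabilityMeasure Q] (n : ℕ) :
    ∫ x, lik n 0 x ∂Q ≤ 1 := by
  have := integral_mono (integrable_of_continuous Q (continuous_lik n 0))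
    (integrable_const (1 : ℝ)) fun x => by
      simp only [lik, pow_zero, one_mul]
      exact pow_le_one₀ (sub_nonneg.2 x.2.2) (by linarith [x.2.1])
  simpa using this

/-- Each of the `K` factors is at least $(1-\mathrm{mean})^n\ge\delta^n$ by Jensen, or equal to 1.
The bound is crude, but only its logarithm, which is linear in `K`, matters for the length of the
growth loop. -/
theorem pow_le_measure_zeros {δ : ℝ} (hδ : 0 < δ) (h : ∀ i, mean (P i) ≤ 1 - δ) (hδ1 : δ ≤ 1)
    (j : Fin K) (n : ℕ) : δ ^ (n * K) ≤ (envLaw P).real (zeros j n) := by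
  rw [measure_zeros, pow_mul]
  have : (δ ^ n) ^ K = ∏ _i : Fin K, δ ^ n := by simp
  rw [this]
  refine Finset.prod_le_prod (fun i _ => by positivity) fun i _ => ?_
  have h1 := integral_lik_zeros_ge (P i) (if i < j then n else 0) (by linarith [h i])
  refine le_trans ?_ h1
  split_ifs
  · exact pow_le_pow_left₀ hδ.le (by linarith [h i]) n
  · simpa using pow_le_one₀ hδ.le hδ1

/-- The factor of arm 0 is at most `1 - mean (P 0)`. Consequently the growth can start at 1 only for
`j = 0`, where the event of zeros is empty of conditions and therefore sure. -/
theorem measure_zeros_lt_one [NeZero K] {j : Fin K} (hj : j ≠ 0) {n : ℕ} (hn : n ≠ 0)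
    (h0 : 0 < mean (P 0)) : (envLaw P).real (zeros j n) < 1 := by
  have hlt : 0 < j := lt_of_le_of_ne (Fin.zero_le j) hj.symm
  rw [measure_zeros, ← Finset.mul_prod_erase _ _ (Finset.mem_univ 0)]
  have h1 : ∏ i ∈ Finset.univ.erase 0, ∫ x, lik (if i < j then n else 0) 0 x ∂(P i) ≤ 1 :=
    Finset.prod_le_one (fun i _ => integral_nonneg (lik_nonneg _ _)) fun i _ =>
      integral_lik_zeros_le_one _ _
  have h2 : ∫ x, lik n 0 x ∂(P 0) ≤ 1 - mean (P 0) := by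
    have := integral_mono (integrable_of_continuous (P 0) (continuous_lik n 0))
      (integrable_of_continuous (P 0) (f := fun x => 1 - (x : ℝ)) (by fun_prop)) fun x => by
        simp only [lik, pow_zero, one_mul, Nat.sub_zero]
        exact pow_le_of_le_one (sub_nonneg.2 x.2.2) (by linarith [x.2.1]) hn
    rw [integral_sub (integrable_const _) (integrable_of_continuous (P 0) (by fun_prop))] at this
    simpa [mean] using this
  rw [if_pos hlt]
  have h3 : 0 ≤ ∫ x, lik n 0 x ∂(P 0) := integral_nonneg (lik_nonneg _ _)
  nlinarith

theorem integral_cond {Ω : Type*} [MeasurableSpace Ω] (μ : Measure Ω) (s : Set Ω) (f : Ω → ℝ) :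
    ∫ x, f x ∂(μ[|s]) = (μ.real s)⁻¹ * ∫ x in s, f x ∂μ := by
  rw [ProbabilityTheory.cond, integral_smul_measure, smul_eq_mul, ENNReal.toReal_inv,
    measureReal_def]

theorem integral_cond_zeros_pos_iff {i j : Fin K} (hij : i < j) {n : ℕ}
    (hpos : 0 < (envLaw P).real (zeros j n)) :
    0 < ∫ e, ((e.1 j : ℝ) - (e.1 i : ℝ)) ∂((envLaw P)[|zeros j n]) ↔
      postMean (P i) n 0 < mean (P j) := by
  rw [integral_cond, mul_pos_iff_of_pos_left (inv_pos.2 hpos), zeros_eq_cyl,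
    setIntegral_gap_cyl P _ _ (by simp), ← zeros_eq_cyl, mul_pos_iff_of_pos_right hpos]
  simp [hij, postMean_zero]

/-- What the analysis of the algorithm needs to know about its parameters. -/
structure WellTuned [NeZero K] (prm : Params K) : Prop where
  anti : Antitone fun i => mean (P i)
  lam_pos : 0 < prm.lam
  boot : ∀ i j : Fin K, i < j → postMean (P i) prm.nBoot 0 < mean (P j)
  boot_zero : prm.nBoot = 0 → K = 1
  boot_le_pad : prm.nBoot ≤ prm.nPad
  three_le_pad : 3 ≤ prm.nPad
  z_eq : ∀ j, prm.zProb j = (envLaw P).real (zeros j prm.nBoot)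
  z_pos : ∀ j, 0 < prm.zProb j
  z_lt_one : ∀ j, j ≠ 0 → prm.zProb j < 1
  grow : ∀ j, 1 ≤ prm.zProb j * (1 + prm.lam) ^ prm.nGrow
  le_nLam : prm.lam⁻¹ + 1 ≤ prm.nLam
  gain_univ : ∀ i j : Fin K, i ≠ j → prm.lam ≤
    ∫ e in {e | soloExploit P j prm.nPad (successes e j prm.nPad) = j},
      ((e.1 j : ℝ) - (e.1 i : ℝ)) ∂(envLaw P)
  gain_zeros : ∀ i j : Fin K, i ≠ j → prm.lam * prm.zProb j ≤
    ∫ e in zeros j prm.nBoot ∩ {e | soloExploit P j prm.nPad (successes e j prm.nPad) = j},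
      ((e.1 j : ℝ) - (e.1 i : ℝ)) ∂(envLaw P)

omit [∀ i, IsProbabilityMeasure (P i)] in
theorem maxMean_eq [NeZero K] (hanti : Antitone fun i => mean (P i)) :
    maxMean (Set.range P) = mean (P 0) := by
  refine le_antisymm (csSup_le ⟨_, _, ⟨0, rfl⟩, rfl⟩ ?_) (le_csSup ?_ ⟨_, ⟨0, rfl⟩, rfl⟩)
  · rintro _ ⟨_, ⟨i, rfl⟩, rfl⟩
    exact hanti (Fin.zero_le i)
  · refine ⟨mean (P 0), ?_⟩
    rintro _ ⟨_, ⟨i, rfl⟩, rfl⟩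
    exact hanti (Fin.zero_le i)

omit [∀ i, IsProbabilityMeasure (P i)] in
theorem EasyInstance.gain [NeZero K] {δ : ℝ} (hanti : Antitone fun i => mean (P i))
    (h : EasyInstance P δ) (i : Fin K) : δ < ∫ x, max ((x : ℝ) - mean (P 0)) 0 ∂(P i) := by
  have h1 : δ < sInf _ := h.1
  rw [maxMean_eq P hanti] at h1
  refine h1.trans_le (csInf_le ⟨0, ?_⟩ ⟨_, ⟨i, rfl⟩, rfl⟩)
  rintro _ ⟨_, ⟨i, rfl⟩, rfl⟩
  exact integral_nonneg fun x => le_max_right _ _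

omit [∀ i, IsProbabilityMeasure (P i)] in
theorem EasyInstance.loss {δ : ℝ} (h : EasyInstance P δ) (i j : Fin K) :
    δ ≤ ∫ x, max (mean (P j) - (x : ℝ)) 0 ∂(P i) := h.2 _ ⟨i, rfl⟩ _ ⟨j, rfl⟩

/-! ### Consequences of easiness for the parameters -/

section Easy

variable [NeZero K] {P} {δ : ℝ} (hδ : 0 < δ) (hanti : Antitone fun i => mean (P i))
  (h : EasyInstance P δ)
include hδ hanti h

omit hδ in
theorem mean_zero_lt : mean (P 0) < 1 - δ := by
  have h1 := h.gain P hanti 0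
  have h2 := integral_mono (integrable_of_continuous (P 0)
    (f := fun x => max ((x : ℝ) - mean (P 0)) 0) (by fun_prop))
    (integrable_const (1 - mean (P 0))) fun x =>
      max_le (by simpa using x.2.2) (sub_nonneg.2 (mean_le_one _))
  simp at h2
  linarith

omit hδ in
theorem mean_lt (i : Fin K) : mean (P i) < 1 - δ :=
  (hanti (Fin.zero_le i)).trans_lt (mean_zero_lt hanti h)

omit hδ hanti in
theorem le_mean (j : Fin K) : δ ≤ mean (P j) := by
  have h1 := h.loss P 0 j
  have h2 := integral_mono (integrable_of_continuous (P 0)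
    (f := fun x => max (mean (P j) - (x : ℝ)) 0) (by fun_prop))
    (integrable_const (mean (P j))) fun x => max_le (by simpa using x.2.1) (mean_nonneg _)
  simp at h2
  linarith

omit hδ in
theorem delta_lt_half : δ < 1 / 2 := by
  linarith [le_mean h 0, mean_lt hanti h 0]

theorem one_half_le_log : 1 / 2 ≤ Real.log (1 / δ) := by
  have h1 := delta_lt_half hanti h
  have h2 : Real.log 2 ≤ Real.log (1 / δ) := Real.log_le_log (by norm_num) (by
    rw [le_div_iff₀ hδ]; linarith)
  linarith [Real.log_two_gt_d9]

theorem measure_zeros_pos (j : Fin K) (n : ℕ) : 0 < (envLaw P).real (zeros j n) :=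
  lt_of_lt_of_le (by positivity) (pow_le_measure_zeros P hδ (fun i => (mean_lt hanti h i).le)
    (by linarith [delta_lt_half hanti h]) j n)

/-- All events of zeros have positive probability, so conditioning is genuine and the criterion
turns into a comparison of a posterior with a prior mean. -/
theorem bootN_eq : bootN P = sInf {n | ∀ i j : Fin K, i < j → postMean (P i) n 0 < mean (P j)} := by
  unfold bootN
  congr 1
  ext n
  exact forall_congr' fun i => forall_congr' fun j => forall_congr' fun hij =>
    integral_cond_zeros_pos_iff P hij (measure_zeros_pos hδ hanti h j n)

theorem floor_mem_boot (i j : Fin K) :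
    postMean (P i) (⌊1 / δ⌋₊ + 1) 0 < mean (P j) :=
  postMean_zeros_lt (P i) (h.loss P i j) (mean_nonneg _)
    (by linarith [mean_lt hanti h j]) (by push_cast; exact Nat.lt_floor_add_one _) hδ

theorem bootN_le : bootN P ≤ ⌊1 / δ⌋₊ + 1 := by
  rw [bootN_eq hδ hanti h]
  exact Nat.sInf_le fun i j _ => floor_mem_boot hδ hanti h i j

theorem bootN_le_real : (bootN P : ℝ) ≤ 1 / δ + 1 := by
  have h1 : ((bootN P : ℕ) : ℝ) ≤ ((⌊1 / δ⌋₊ + 1 : ℕ) : ℝ) := by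
    exact_mod_cast bootN_le hδ hanti h
  push_cast at h1
  linarith [Nat.floor_le (show 0 ≤ 1 / δ by positivity)]

theorem bootN_spec (i j : Fin K) (hij : i < j) : postMean (P i) (bootN P) 0 < mean (P j) := by
  have := Nat.sInf_mem (s := {n | ∀ i j : Fin K, i < j → postMean (P i) n 0 < mean (P j)})
    ⟨_, fun i j _ => floor_mem_boot hδ hanti h i j⟩
  rw [← bootN_eq hδ hanti h] at this
  exact this i j hij

/-- Without samples the criterion would ask a later arm to have the strictly larger prior mean,
against the ordering of the arms. -/
theorem eq_one_of_bootN_eq_zero (h0 : bootN P = 0) : K = 1 := by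
  by_contra hK
  have hK2 : 2 ≤ K := by have := NeZero.pos K; omega
  have hlt : (⟨0, by omega⟩ : Fin K) < ⟨1, by omega⟩ := Fin.mk_lt_mk.2 one_pos
  have h1 := bootN_spec hδ hanti h _ _ hlt
  rw [h0, postMean_zero] at h1
  exact absurd (hanti hlt.le) (not_le.2 h1)

theorem params_nPad_ge {Cpad : ℝ} (hC : 100 ≤ Cpad) (N : ℕ) :
    50 / δ ^ 2 ≤ ((params P δ Cpad N).nPad : ℝ) := by
  refine le_trans ?_ (Nat.le_ceil _)
  have h1 := one_half_le_log hδ hanti h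
  have h2 : (1 / δ) ^ 2 = 1 / δ ^ 2 := by rw [one_div_pow]
  rw [h2]
  have h3 : 0 < 1 / δ ^ 2 := by positivity
  calc 50 / δ ^ 2 = 100 * (1 / δ ^ 2) * (1 / 2) := by ring
    _ ≤ Cpad * (1 / δ ^ 2) * Real.log (1 / δ) := by gcongr

/-- Take logarithms in $\delta^{N_{boot}K}(1+\delta/10)^k\ge1$. The factor $20/\delta$ comes from
$\log(1+\delta/10)\ge\delta/20$, a consequence of $\log x\ge1-1/x$. -/
theorem exists_nGrow (j : Fin K) (k : ℕ)
    (hk : bootN P * K * Real.log (1 / δ) * (20 / δ) ≤ k) :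
    1 ≤ (envLaw P).real (zeros j (bootN P)) * (1 + δ / 10) ^ k := by
  have hd := delta_lt_half hanti h
  have h1 := pow_le_measure_zeros P hδ (fun i => (mean_lt hanti h i).le) (by linarith) j (bootN P)
  refine le_trans ?_ (mul_le_mul_of_nonneg_right h1 (by positivity))
  have hlog : δ / 20 ≤ Real.log (1 + δ / 10) := by
    have := Real.one_sub_inv_le_log_of_pos (show 0 < 1 + δ / 10 by positivity)
    refine le_trans ?_ this
    have : 1 - (1 + δ / 10)⁻¹ = (δ / 10) / (1 + δ / 10) := by field_simp; ring
    rw [this, div_le_div_iff₀ (by norm_num) (by positivity)]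
    nlinarith
  rw [← Real.log_nonneg_iff (by positivity), Real.log_mul (by positivity) (by positivity),
    Real.log_pow, Real.log_pow]
  have h2 : Real.log (1 / δ) = - Real.log δ := by rw [one_div, Real.log_inv]
  rw [h2] at hk
  have h3 : (bootN P * K * -Real.log δ * (20 / δ)) * (δ / 20) ≤ k * Real.log (1 + δ / 10) :=
    mul_le_mul hk hlog (by positivity) (by positivity)
  have h4 : (bootN P * K * -Real.log δ * (20 / δ)) * (δ / 20) = -(bootN P * K * Real.log δ) := by
    field_simp
  rw [h4] at h3
  push_cast
  linarith

theorem params_nGrow_le (Cpad : ℝ) (N : ℕ) : ((params P δ Cpad N).nGrow : ℝ) ≤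
    bootN P * K * Real.log (1 / δ) * (20 / δ) + 1 := by
  have h0 : 0 ≤ bootN P * K * Real.log (1 / δ) * (20 / δ) := by
    have := one_half_le_log hδ hanti h
    positivity
  have h1 : (params P δ Cpad N).nGrow ≤ ⌈bootN P * K * Real.log (1 / δ) * (20 / δ)⌉₊ :=
    Nat.sInf_le fun j => exists_nGrow hδ hanti h j _ (Nat.le_ceil _)
  calc ((params P δ Cpad N).nGrow : ℝ) ≤ ⌈bootN P * K * Real.log (1 / δ) * (20 / δ)⌉₊ := by
        exact_mod_cast h1
    _ ≤ _ := (Nat.ceil_lt_add_one h0).le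

theorem params_grow (Cpad : ℝ) (N : ℕ) (j : Fin K) :
    1 ≤ (envLaw P).real (zeros j (bootN P)) * (1 + δ / 10) ^ (params P δ Cpad N).nGrow :=
  Nat.sInf_mem (s := {k | ∀ j, 1 ≤ (envLaw P).real (zeros j (bootN P)) * (1 + δ / 10) ^ k})
    ⟨_, fun j => exists_nGrow hδ hanti h j _ (Nat.le_ceil _)⟩ j

theorem wellTuned_params {Cpad : ℝ} (hC : 100 ≤ Cpad) (N : ℕ) :
    WellTuned P (params P δ Cpad N) := by
  have hd := delta_lt_half hanti h
  have hpad := params_nPad_ge hδ hanti h hC N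
  have hinv : 2 ≤ 1 / δ := by rw [le_div_iff₀ hδ]; linarith
  have hpad' : 50 * (1 / δ) ^ 2 ≤ ((params P δ Cpad N).nPad : ℝ) := by
    refine le_trans (le_of_eq ?_) hpad; rw [one_div_pow]; ring
  have hpos : 0 < (params P δ Cpad N).nPad := by
    have : (0 : ℝ) < (params P δ Cpad N).nPad := lt_of_lt_of_le (by positivity) hpad
    exact_mod_cast this
  -- $N_{pad}\ge50/\delta^2$ makes the estimation error at most $\delta/2$, which leaves more than
  -- $\delta/2$ of the gain $\delta$.
  have hgain : ∀ j : Fin K, δ / 10 ≤ ∫ x, max ((x : ℝ) - mean (P 0)) 0 ∂(P j) -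
      1 / (2 * √((params P δ Cpad N).nPad : ℝ)) := fun j => by
    have h1 := h.gain P hanti j
    have h2 : 1 / δ ≤ √((params P δ Cpad N).nPad : ℝ) :=
      Real.le_sqrt_of_sq_le (by nlinarith [sq_nonneg (1 / δ)])
    have h3 : 1 / (2 * √((params P δ Cpad N).nPad : ℝ)) ≤ 1 / (2 * (1 / δ)) :=
      one_div_le_one_div_of_le (by positivity) (by linarith)
    have h4 : 1 / (2 * (1 / δ)) = δ / 2 := by field_simp
    linarith
  refine
    { anti := hanti
      lam_pos := by change 0 < δ / 10; positivity
      boot := bootN_spec hδ hanti h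
      boot_zero := eq_one_of_bootN_eq_zero hδ hanti h
      boot_le_pad := ?_
      three_le_pad := ?_
      z_eq := fun _ => rfl
      z_pos := fun j => measure_zeros_pos hδ hanti h j _
      z_lt_one := fun j hj => ?_
      grow := params_grow hδ hanti h Cpad N
      le_nLam := ?_
      gain_univ := fun i j hij => ?_
      gain_zeros := fun i j hij => ?_ }
  · have h1 := bootN_le_real hδ hanti h
    have : ((bootN P : ℕ) : ℝ) ≤ (params P δ Cpad N).nPad := by nlinarith
    exact_mod_cast this
  · have : ((3 : ℕ) : ℝ) ≤ (params P δ Cpad N).nPad := by push_cast; nlinarith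
    exact_mod_cast this
  · refine measure_zeros_lt_one P hj (fun h0 => ?_) (hδ.trans_le (le_mean h 0))
    have := eq_one_of_bootN_eq_zero hδ hanti h h0
    subst this
    exact hj (Subsingleton.elim _ _)
  · change (δ / 10)⁻¹ + 1 ≤ ((1 + ⌈(δ / 10)⁻¹⌉₊ : ℕ) : ℝ)
    push_cast
    linarith [Nat.le_ceil ((δ / 10)⁻¹)]
  · have h1 := soloExploit_gain P hij hpos (m := mean (P 0)) (fun i => hanti (Fin.zero_le i))
      (fun _ => 0) rfl fun k hk => ⟨k, hk, by rw [postMean_zero]⟩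
    have h2 : cyl (fun _ : Fin K => 0) 0 = Set.univ := by ext; simp [cyl]
    rw [h2, Set.univ_inter, probReal_univ, mul_one] at h1
    exact (hgain j).trans h1
  · have h1 := soloExploit_gain P hij hpos (m := mean (P 0)) (fun i => hanti (Fin.zero_le i))
      (fun k => if k < j then bootN P else 0) (by simp) fun k hk => by
        by_cases hkj : k < j
        -- The comparison arm must differ from `j`. Arm 0 does, because some arm precedes `j`, and
        -- its prior mean dominates that of `j`.
        · refine ⟨0, (Fin.zero_le k |>.trans_lt hkj).ne, ?_⟩
          simp only [hkj, if_true]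
          exact (bootN_spec hδ hanti h k j hkj).le.trans (hanti (Fin.zero_le j))
        · exact ⟨k, hk, by simp [hkj, postMean_zero]⟩
    rw [← zeros_eq_cyl] at h1
    exact (mul_le_mul_of_nonneg_right (hgain j) measureReal_nonneg).trans h1

end Easy

end Parameters

end IncExp

namespace IncExp

/-! ### The process of states -/

section States

variable {K : ℕ} [NeZero K] (P : Fin K → Measure unitInterval) (prm : Params K)

/-- The environments `e` and `e'` agree on the first `d` samples of each arm in the state `st`. -/
def Agree (d : ℕ) (st : State K) (e e' : Env K) : Prop :=
  ∀ i, ∀ k < min (st.pulls i) d, reward e' i k = reward e i k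

variable {P prm}

theorem Agree.successes {d d' : ℕ} {st : State K} {e e' : Env K} (h : Agree d st e e')
    (hd : d' ≤ d) (i : Fin K) : successes e' i (min (st.pulls i) d') =
      successes e i (min (st.pulls i) d') :=
  successes_congr fun k hk => h i k (hk.trans_le (min_le_min_left _ hd))

theorem Agree.exploitArm {d d' : ℕ} {st : State K} {e e' : Env K} (h : Agree d st e e')
    (hd : d' ≤ d) : exploitArm P d' e' st = exploitArm P d' e st := by
  unfold IncExp.exploitArm
  simp only [h.successes hd]

theorem Agree.piHat {d : ℕ} {st : State K} {e e' : Env K} (h : Agree d st e e')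
    (hd : prm.nPad ≤ d) (j : Fin K) : piHat P prm j e' st = piHat P prm j e st := by
  unfold IncExp.piHat
  simp only [h.successes hd]

theorem Agree.paddedArm {d : ℕ} {st : State K} {e e' : Env K} (h : Agree d st e e')
    (hd : prm.nPad ≤ d) (j : Fin K) : paddedArm P prm j e' st = paddedArm P prm j e st := by
  unfold IncExp.paddedArm
  rw [h.piHat hd, h.exploitArm hd]

theorem Agree.zerosSeen {d : ℕ} {st : State K} {e e' : Env K} (h : Agree d st e e')
    (hd : prm.nBoot ≤ d) (j : Fin K) : zerosSeen prm j e' st ↔ zerosSeen prm j e st := by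
  refine forall_congr' fun i => imp_congr_right fun _ => and_congr_right fun hi => ?_
  have := h.successes hd i
  rw [min_eq_right hi] at this
  rw [this]

/-- The two depths are kept apart because the first `K + 1` phases look only at data of depth
`nBoot`, and exploitation of that depth is optimal only for events decided by these data. -/
theorem Agree.phaseArm {d q : ℕ} {st : State K} {e e' : Env K} (h : Agree d st e e')
    (hd : prm.nBoot ≤ d) (hq : q ≤ K ∨ prm.nPad ≤ d) (s : Seed K prm.nLam) :
    phaseArm P prm q st (e', s) = phaseArm P prm q st (e, s) := by
  classical
  unfold IncExp.phaseArm
  rcases hq with hq | hq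
  · rcases hq.lt_or_eq with hq | rfl
    · simp only [hq, if_true, h.exploitArm hd]
    · simp only [lt_irrefl, if_false, if_true, h.exploitArm hd]
      exact if_congr (h.zerosSeen hd s.1) rfl rfl
  · simp only [h.exploitArm hd, h.exploitArm hq, h.paddedArm hq]
    exact if_congr Iff.rfl rfl (if_congr Iff.rfl (if_congr (h.zerosSeen hd s.1) rfl rfl) rfl)

theorem pulls_le_succ (ω : Outcome prm) (q : ℕ) (i : Fin K) :
    (stateAt P prm ω q).pulls i ≤ (stateAt P prm ω (q + 1)).pulls i := by
  simp only [stateAt]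
  rcases eq_or_ne i (phaseArm P prm q (stateAt P prm ω q) ω).1 with h | h
  · rw [h, Function.update_self]; omega
  · rw [Function.update_of_ne h]

theorem pulls_mono (ω : Outcome prm) (i : Fin K) :
    Monotone fun q => (stateAt P prm ω q).pulls i :=
  monotone_nat_of_le_succ fun q => pulls_le_succ ω q i

/-- The counts in the state are themselves random, but they are decided by the samples already seen:
counts never decrease, so agreement on the current data includes agreement on the data of all
earlier phases, and induction applies. -/
theorem stateAt_congr {d : ℕ} {e e' : Env K} (s : Seed K prm.nLam) (hd : prm.nBoot ≤ d) {q : ℕ}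
    (hq : q ≤ K + 1 ∨ prm.nPad ≤ d) (h : Agree d (stateAt P prm (e, s) q) e e') :
    stateAt P prm (e', s) q = stateAt P prm (e, s) q := by
  induction q with
  | zero => rfl
  | succ q ih =>
    have h' : Agree d (stateAt P prm (e, s) q) e e' := fun i k hk =>
      h i k (hk.trans_le (min_le_min_right _ (pulls_le_succ _ q i)))
    have h1 := ih (hq.imp_left fun h => by omega) h'
    have h2 := h'.phaseArm (P := P) hd (q := q) (hq.imp_left fun h => by omega) s
    simp only [stateAt, h1, h2]

variable [∀ i, IsProbabilityMeasure (P i)]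

/-- Exploitation is optimal on each event that is decided by the data. -/
theorem setIntegral_exploitArm_nonneg {d q : ℕ} (hd : prm.nBoot ≤ d)
    (hq : q ≤ K + 1 ∨ prm.nPad ≤ d) (s : Seed K prm.nLam) (R : Env K → State K → Prop)
    (hR : ∀ st e e', Agree d st e e' → R e st → R e' st) (i j : Fin K) :
    0 ≤ ∫ e in {e | R e (stateAt P prm (e, s) q) ∧
      exploitArm P d e (stateAt P prm (e, s) q) = i}, ((e.1 i : ℝ) - (e.1 j : ℝ)) ∂(envLaw P) := by
  refine setIntegral_gap_nonneg P (fun e k => min ((stateAt P prm (e, s) q).pulls k) d) ?_ i j ?_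
  · rintro e ⟨h1, h2⟩ e' (h : Agree d _ e e')
    have h3 := stateAt_congr s hd hq h
    refine ⟨⟨?_, ?_⟩, by simp only [h3]⟩
    · rw [h3]; exact hR _ e e' h h1
    · rw [h3, h.exploitArm le_rfl, h2]
  · rintro e ⟨-, h2⟩
    have := le_argmax (fun i => postMean (P i) (min ((stateAt P prm (e, s) q).pulls i) d)
      (successes e i (min ((stateAt P prm (e, s) q).pulls i) d))) j
    change exploit P _ _ = i at h2
    unfold exploit at h2
    rwa [h2] at this

/-! ### Exploration -/

/-- As long as only zeros appear, exploitation walks through the arms in order: by `boot` a tried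
arm has fallen below the prior mean of every later arm, and among the untried arms the smallest
index wins. -/
theorem stateAt_of_zeros (h : WellTuned P prm) {e : Env K} (s : Seed K prm.nLam) {j : Fin K}
    (he : e ∈ zeros j prm.nBoot) {q : ℕ} (hq : q ≤ j) :
    stateAt P prm (e, s) q = ⟨fun i => if (i : ℕ) < q then prm.nBoot else 0, false⟩ := by
  induction q with
  | zero => simp [stateAt]
  | succ q ih =>
    have hqK : q < K := by omega
    have ih := ih (by omega)
    simp only [stateAt, ih]
    have harm : exploitArm P prm.nBoot e
        ⟨fun i => if (i : ℕ) < q then prm.nBoot else 0, false⟩ = ⟨q, hqK⟩ := by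
      have hval : ∀ i : Fin K, postMean (P i) (min (if (i : ℕ) < q then prm.nBoot else 0) prm.nBoot)
          (successes e i (min (if (i : ℕ) < q then prm.nBoot else 0) prm.nBoot)) =
          if (i : ℕ) < q then postMean (P i) prm.nBoot 0 else mean (P i) := fun i => by
        split_ifs with hi
        · have : successes e i prm.nBoot = 0 := successes_eq_zero_iff.2
            (he i (Fin.lt_def.2 (by omega)))
          rw [min_self, this]
        · simp [successes, postMean_zero]
      unfold exploitArm exploit
      simp only [hval]
      refine argmax_eq (fun k => ?_) fun k hk => ?_
      · simp only [lt_irrefl, if_false]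
        split_ifs with hk
        · exact (h.boot k ⟨q, hqK⟩ (Fin.lt_def.2 hk)).le
        · exact h.anti (Fin.le_def.2 (not_lt.1 hk))
      · simp only [lt_irrefl, if_false, show (k : ℕ) < q from hk, if_true]
        exact h.boot k ⟨q, hqK⟩ hk
    have hphase : phaseArm P prm q ⟨fun i => if (i : ℕ) < q then prm.nBoot else 0, false⟩ (e, s) =
        (⟨q, hqK⟩, false) := by
      unfold phaseArm
      simp only [hqK, if_true, harm]
    rw [hphase]
    congr 1
    funext i
    by_cases hi : i = ⟨q, hqK⟩
    · subst hi
      simp [phaseLen, hqK]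
    · rw [Function.update_of_ne hi]
      have : (i : ℕ) ≠ q := fun h => hi (Fin.ext h)
      by_cases h1 : (i : ℕ) < q
      · rw [if_pos h1, if_pos (by omega)]
      · rw [if_neg h1, if_neg (by omega)]

theorem zerosSeen_iff (h : WellTuned P prm) (e : Env K) (s : Seed K prm.nLam) (j : Fin K) :
    zerosSeen prm j e (stateAt P prm (e, s) K) ↔ e ∈ zeros j prm.nBoot := by
  constructor
  · intro h1 i hi
    exact successes_eq_zero_iff.1 (h1 i hi).2
  · intro h1 i hi
    refine ⟨?_, successes_eq_zero_iff.2 (h1 i hi)⟩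
    have h2 := pulls_mono (P := P) (prm := prm) (e, s) i (show (j : ℕ) ≤ K from j.2.le)
    simp only [stateAt_of_zeros h s h1 le_rfl] at h2
    rwa [if_pos (Fin.lt_def.1 hi)] at h2

omit [∀ i, IsProbabilityMeasure (P i)]

theorem explored_false (ω : Outcome prm) {q : ℕ} (hq : q ≤ K) :
    (stateAt P prm ω q).explored = false := by
  induction q with
  | zero => rfl
  | succ q ih =>
    have hqK : q < K := by omega
    simp only [stateAt, phaseArm, hqK, if_true]
    exact ih hqK.le

theorem phaseLen_of_mem (prm : Params K) {q : ℕ} (h1 : K ≤ q) (h2 : q < K + 2 + prm.nGrow) :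
    phaseLen prm q = prm.nPad := by
  rw [phaseLen, if_neg (by omega), if_pos h2]

/-- The flag can only be raised by a phase that plays `j₀` for `nPad` rounds. Hence `piHat` never
runs on fewer than `nPad` samples in a padded phase. -/
theorem pulls_of_explored (ω : Outcome prm) (q : ℕ) (h : (stateAt P prm ω q).explored = true) :
    prm.nPad ≤ (stateAt P prm ω q).pulls ω.2.1 := by
  induction q with
  | zero => simp [stateAt] at h
  | succ q ih =>
    by_cases hq : (stateAt P prm ω q).explored = true
    · exact (ih hq).trans (pulls_le_succ ω q _)
    · have harm : (phaseArm P prm q (stateAt P prm ω q) ω).1 = ω.2.1 ∧ K ≤ q ∧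
          q < K + 2 + prm.nGrow := by
        simp only [stateAt] at h
        rw [Bool.not_eq_true] at hq
        unfold phaseArm at h ⊢
        simp only [hq] at h ⊢
        split_ifs at h ⊢ <;> first | exact ⟨rfl, by omega, by omega⟩ | simp_all
      simp only [stateAt, harm.1, Function.update_self, phaseLen_of_mem prm harm.2.1 harm.2.2]
      omega

/-- The `k`-th coin. -/
def coin (s : Seed K prm.nLam) (k : ℕ) : ℝ := s.2.2.2 k

theorem coin_le_one (s : Seed K prm.nLam) (k : ℕ) : coin s k ≤ 1 := (s.2.2.2 k).2.2

variable (prm) in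
/-- Exploration probability in the phase before the growth loop. -/
noncomputable def startProb (j : Fin K) : ℝ :=
  prm.lam * prm.zProb j / (1 + prm.lam * prm.zProb j)

variable (prm) in
/-- The quantity `p` in phase `k` of the growth loop. -/
noncomputable def growth (j : Fin K) (k : ℕ) : ℝ := min 1 (prm.zProb j * (1 + prm.lam) ^ k)

variable (prm) in
/-- Exploration probability in phase `k` of the growth loop, if there was no exploration before. -/
noncomputable def growProb (j : Fin K) (k : ℕ) : ℝ :=
  min 1 (growth prm j k / (1 - growth prm j k) * prm.lam)

/-- One of the coins before phase `k` of the growth loop asks for exploration. -/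
def CoinExplored (k : ℕ) (s : Seed K prm.nLam) : Prop :=
  coin s 0 ≤ startProb prm s.1 ∨
    ∃ l < k, growth prm s.1 l < 1 ∧ coin s (l + 1) ≤ growProb prm s.1 l

/-- Phase `q > K` explores in the sense that the arm does not depend on the rewards; `x` tells
whether an exploration phase for `j₀` has happened before. -/
def Exploring (q : ℕ) (x : Bool) (s : Seed K prm.nLam) : Prop :=
  if q = K + 1 then coin s 0 ≤ startProb prm s.1
  else if q < K + 2 + prm.nGrow then
    x = false ∧ coin s (q - (K + 2) + 1) ≤ growProb prm s.1 (q - (K + 2))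
  else (q - (K + 2 + prm.nGrow)) % prm.nLam =
    s.2.2.1 (Fin.ofNat K ((q - (K + 2 + prm.nGrow)) / prm.nLam))

/-- The arm played in an exploring phase. -/
def target (q : ℕ) (s : Seed K prm.nLam) : Fin K :=
  if q < K + 2 + prm.nGrow then s.1
  else s.2.1 (Fin.ofNat K ((q - (K + 2 + prm.nGrow)) / prm.nLam))

theorem growth_mono (h0 : 0 ≤ prm.lam) (j : Fin K) (hz : 0 ≤ prm.zProb j) :
    Monotone (growth prm j) := fun k l hkl => by
  unfold growth
  refine min_le_min_left _ (mul_le_mul_of_nonneg_left (pow_le_pow_right₀ ?_ hkl) hz)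
  linarith

variable [∀ i, IsProbabilityMeasure (P i)] (h : WellTuned P prm)
include h

theorem explored_boot (e : Env K) (s : Seed K prm.nLam) :
    (stateAt P prm (e, s) (K + 1)).explored = true ↔ e ∈ zeros s.1 prm.nBoot := by
  rw [← zerosSeen_iff h e s]
  simp only [stateAt, phaseArm, lt_irrefl, if_false, if_true]
  split_ifs with h1
  · simp [h1]
  · simp [h1, explored_false]

theorem explored_start (e : Env K) (s : Seed K prm.nLam) :
    (stateAt P prm (e, s) (K + 2)).explored = true ↔
      e ∈ zeros s.1 prm.nBoot ∨ coin s 0 ≤ startProb prm s.1 := by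
  rw [← explored_boot h e s]
  have h1 : stateAt P prm (e, s) (K + 2) = ⟨_, (phaseArm P prm (K + 1)
    (stateAt P prm (e, s) (K + 1)) (e, s)).2⟩ := rfl
  rw [h1]
  simp only [phaseArm, show ¬ K + 1 < K by omega, show K + 1 ≠ K by omega, if_false, if_true]
  split_ifs with h2 h3
  · simpa [coin, startProb] using Or.inr h2
  · simp [h3]
  · simpa [h3, coin, startProb] using h2

/-- If the next step would carry $p$ to 1, then $p(1+\lambda)\ge1$, that is $p\lambda\ge1-p$, and
the minimum in the exploration probability is attained by 1. -/
theorem growProb_eq_one {j : Fin K} {k : ℕ} (h1 : growth prm j k < 1)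
    (h2 : 1 ≤ growth prm j (k + 1)) : growProb prm j k = 1 := by
  have hl := h.lam_pos
  have h3 : 1 ≤ prm.zProb j * (1 + prm.lam) ^ (k + 1) := h2.trans (min_le_right _ _)
  have h4 : growth prm j k = prm.zProb j * (1 + prm.lam) ^ k := by
    unfold growth at h1 ⊢
    rcases min_lt_iff.1 h1 with h | h
    · linarith
    · exact min_eq_right h.le
  refine min_eq_left ?_
  rw [div_mul_eq_mul_div, le_div_iff₀ (by linarith)]
  rw [pow_succ, ← mul_assoc, ← h4] at h3
  linarith

/-- Either $p$ equals 1 from the start, which forces `j₀ = 0` and a sure event of zeros, or it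
reaches 1 at a step whose coin has threshold 1, and every coin is at most 1. So no exceptional null
set appears. -/
theorem coinExplored_of_growth {k : ℕ} {s : Seed K prm.nLam} (hs : 1 ≤ growth prm s.1 k) (e : Env K) :
    e ∈ zeros s.1 prm.nBoot ∨ CoinExplored k s := by
  induction k with
  | zero =>
    left
    have : s.1 = 0 := by
      by_contra hne
      have h1 := h.z_lt_one s.1 hne
      have h2 : growth prm s.1 0 ≤ prm.zProb s.1 := by simp [growth]
      linarith
    rw [this]
    intro i hi
    exact absurd hi (not_lt.2 (Fin.zero_le i))
  | succ k ih =>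
    by_cases hk : growth prm s.1 k < 1
    · refine .inr (.inr ⟨k, k.lt_succ_self, hk, ?_⟩)
      rw [growProb_eq_one h hk hs]
      exact coin_le_one s _
    · refine (ih (not_lt.1 hk)).imp_right fun h1 => h1.imp_right ?_
      rintro ⟨l, hl, h2⟩
      exact ⟨l, by omega, h2⟩

theorem explored_grow (e : Env K) (s : Seed K prm.nLam) {k : ℕ} (hk : k ≤ prm.nGrow) :
    (stateAt P prm (e, s) (K + 2 + k)).explored = true ↔
      e ∈ zeros s.1 prm.nBoot ∨ CoinExplored k s := by
  induction k with
  | zero => rw [add_zero, explored_start h e s]; simp [CoinExplored]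
  | succ k ih =>
    have ih := ih (by omega)
    have h1 : stateAt P prm (e, s) (K + 2 + (k + 1)) = ⟨_, (phaseArm P prm (K + 2 + k)
      (stateAt P prm (e, s) (K + 2 + k)) (e, s)).2⟩ := rfl
    have h2 : CoinExplored (k + 1) s ↔ CoinExplored k s ∨
        (growth prm s.1 k < 1 ∧ coin s (k + 1) ≤ growProb prm s.1 k) := by
      unfold CoinExplored
      rw [or_assoc]
      refine or_congr_right ⟨?_, ?_⟩
      · rintro ⟨l, hl, h3⟩
        rcases (Nat.lt_succ_iff.1 hl).lt_or_eq with hl | rfl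
        · exact .inl ⟨l, hl, h3⟩
        · exact .inr h3
      · rintro (⟨l, hl, h3⟩ | h3)
        · exact ⟨l, by omega, h3⟩
        · exact ⟨k, by omega, h3⟩
    rw [h1, h2, ← or_assoc, ← ih]
    simp only [phaseArm, show ¬ K + 2 + k < K by omega, show K + 2 + k ≠ K by omega,
      show K + 2 + k ≠ K + 1 by omega, show K + 2 + k < K + 2 + prm.nGrow by omega, if_false,
      if_true, show K + 2 + k - (K + 2) = k by omega]
    have hnot : ∀ (a b : Prop), ¬ (a ∨ b) → ¬ a := fun a b h ha => h (.inl ha)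
    split_ifs with h3 h4
    · rcases h3 with h3 | h3
      · simp [h3]
      · simp [ih.2 (coinExplored_of_growth h h3 e)]
    · simp only [true_iff]
      push Not at h3
      exact .inr ⟨h3.2, h4⟩
    · push Not at h3
      simp only [false_iff, not_or, not_and]
      exact ⟨h3.1, fun _ => h4⟩

theorem explored_final (ω : Outcome prm) {q : ℕ} (hq : K + 2 + prm.nGrow ≤ q) :
    (stateAt P prm ω q).explored = true := by
  induction q, hq using Nat.le_induction with
  | base =>
    rw [explored_grow h ω.1 ω.2 le_rfl]
    refine coinExplored_of_growth h ?_ ω.1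
    exact le_min le_rfl (h.grow ω.2.1)
  | succ q hq ih =>
    simp only [stateAt, phaseArm, show ¬ q < K by omega, show q ≠ K by omega,
      show q ≠ K + 1 by omega, show ¬ q < K + 2 + prm.nGrow by omega, if_false]
    split_ifs <;> exact ih

theorem piHat_of_explored {ω : Outcome prm} {q : ℕ} (hx : (stateAt P prm ω q).explored = true) :
    piHat P prm ω.2.1 ω.1 (stateAt P prm ω q) =
      soloExploit P ω.2.1 prm.nPad (successes ω.1 ω.2.1 prm.nPad) := by
  have h1 := pulls_of_explored ω q hx
  unfold piHat soloExploit
  congr 1 <;> funext i <;> by_cases hi : i = ω.2.1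
  · subst hi; simp [h1]
  · simp [hi]
  · subst hi; simp [h1]
  · simp [hi]

open Classical in
/-- The arm played in the phases after the bootstrapping phase. -/
theorem phaseArm_late (ω : Outcome prm) {q : ℕ} (hq : K < q) :
    phaseArm P prm q (stateAt P prm ω q) ω =
      if Exploring q (stateAt P prm ω q).explored ω.2 then (target q ω.2, true)
      else if (stateAt P prm ω q).explored = true then
        (paddedArm P prm ω.2.1 ω.1 (stateAt P prm ω q), true)
      else (exploitArm P prm.nPad ω.1 (stateAt P prm ω q), false) := by
  by_cases h1 : q = K + 1
  · have h2 : q < K + 2 + prm.nGrow := by omega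
    subst h1
    simp only [phaseArm, Exploring, target, h2, if_true, if_false, show ¬ K + 1 < K by omega,
      show K + 1 ≠ K by omega]
    rfl
  · by_cases h2 : q < K + 2 + prm.nGrow
    · simp only [phaseArm, Exploring, target, show ¬ q < K by omega, show q ≠ K by omega, h1, h2,
        if_true, if_false]
      by_cases hx : (stateAt P prm ω q).explored = true
      · simp [hx]
      -- The clause `1 ≤ p` of the algorithm is redundant: by then `j₀` has been explored.
      · have hp : ¬ 1 ≤ growth prm ω.2.1 (q - (K + 2)) := fun hp => by
          have h3 := (explored_grow h ω.1 ω.2 (k := q - (K + 2)) (by omega)).2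
            (coinExplored_of_growth h hp ω.1)
          rw [show K + 2 + (q - (K + 2)) = q by omega] at h3
          exact hx h3
        unfold growth at hp
        rw [if_neg (by tauto)]
        simp only [hx, growProb, growth, coin]
        simp
    · have hx := explored_final h ω (not_lt.1 h2)
      simp only [phaseArm, Exploring, target, show ¬ q < K by omega, show q ≠ K by omega, h1, h2,
        if_false, hx, if_true]

end States

end IncExp

namespace IncExp

/-! ### Measurability -/

/-- There are countably many states, so with the discrete σ-algebra every measurability question
reduces to a fixed state (`measurable_comp_stateAt`). -/
instance stateMeasurableSpace (K : ℕ) : MeasurableSpace (State K) := ⊤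

instance (K : ℕ) : DiscreteMeasurableSpace (State K) := ⟨fun _ => trivial⟩

instance (K : ℕ) : DiscreteMeasurableSpace (Equiv.Perm (Fin K)) := ⟨fun _ => trivial⟩

instance (K : ℕ) : Countable (State K) :=
  Function.Injective.countable (f := fun st : State K => (st.pulls, st.explored))
    fun st st' h => by
      cases st; cases st'; simpa using h

section Measurability

variable {K : ℕ} [NeZero K] (P : Fin K → Measure unitInterval) (prm : Params K)

theorem measurable_exploitArm (d : ℕ) (st : State K) :
    Measurable fun ω : Outcome prm => exploitArm P d ω.1 st :=
  (measurable_of_countable fun s : Fin K → ℕ => exploit P (fun i => min (st.pulls i) d) s).comp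
    (measurable_pi_lambda _ fun i => (measurable_successes i _).comp measurable_fst)

theorem measurable_piHat (j : Fin K) (st : State K) :
    Measurable fun ω : Outcome prm => piHat P prm j ω.1 st :=
  (measurable_of_countable fun s : Fin K → ℕ => exploit P _
    fun i => if i = j then s i else 0).comp
    (measurable_pi_lambda _ fun i => (measurable_successes i _).comp measurable_fst)

theorem measurable_arm : Measurable fun ω : Outcome prm => ω.2.1 := by fun_prop

theorem measurable_comp_arm {β : Type*} [MeasurableSpace β] {f : Fin K → Outcome prm → β}
    (hf : ∀ j, Measurable (f j)) : Measurable fun ω : Outcome prm => f ω.2.1 ω := by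
  have h : Measurable fun p : Fin K × Outcome prm => f p.1 p.2 :=
    measurable_from_prod_countable_right fun j => hf j
  exact h.comp ((measurable_arm prm).prodMk measurable_id)

theorem measurable_paddedArm (st : State K) :
    Measurable fun ω : Outcome prm => paddedArm P prm ω.2.1 ω.1 st := by
  refine measurable_comp_arm prm (f := fun j ω => paddedArm P prm j ω.1 st) fun j => ?_
  unfold paddedArm
  exact Measurable.ite (measurable_piHat P prm j st (measurableSet_singleton j)) measurable_const
    (measurable_exploitArm P prm _ st)

theorem measurable_coin (k : ℕ) : Measurable fun ω : Outcome prm => coin ω.2 k := by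
  unfold coin; fun_prop

theorem measurableSet_zerosSeen (st : State K) :
    MeasurableSet {ω : Outcome prm | zerosSeen prm ω.2.1 ω.1 st} := by
  refine measurableSet_setOfPred.2 (measurable_comp_arm prm
    (f := fun j ω => zerosSeen prm j ω.1 st) fun j => ?_)
  refine measurableSet_setOfPred.1 ?_
  simp only [zerosSeen, Set.ofPred_forall]
  exact .iInter fun i => .iInter fun _ => .inter (.const _)
    (((measurable_successes i _).comp measurable_fst) (measurableSet_singleton 0))

theorem measurable_phaseArm (q : ℕ) (st : State K) :
    Measurable fun ω : Outcome prm => phaseArm P prm q st ω := by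
  have hc : ∀ (k : ℕ) (f : Fin K → ℝ), MeasurableSet {ω : Outcome prm | coin ω.2 k ≤ f ω.2.1} :=
    fun k f => measurableSet_le (measurable_coin prm k)
      ((measurable_of_countable f).comp (measurable_arm prm))
  have harm := measurable_arm prm
  have hpad := measurable_paddedArm P prm st
  have hexp := fun d => measurable_exploitArm P prm d st
  have hloop : ∀ m : Fin K, Measurable fun ω : Outcome prm => (ω.2.2.2.1 m : Fin prm.nLam) :=
    fun m => by fun_prop
  have hperm : ∀ m : Fin K, Measurable fun ω : Outcome prm => ω.2.2.1 m := fun m =>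
    (measurable_of_countable fun θ : Equiv.Perm (Fin K) => θ m).comp (by fun_prop)
  unfold phaseArm
  refine Measurable.ite (.const _) ((hexp _).prodMk measurable_const) ?_
  refine Measurable.ite (.const _) (Measurable.ite (measurableSet_zerosSeen prm st)
    (harm.prodMk measurable_const) ((hexp _).prodMk measurable_const)) ?_
  refine Measurable.ite (.const _) (Measurable.ite (hc 0 (startProb prm))
    (harm.prodMk measurable_const) (Measurable.ite (.const _) (hpad.prodMk measurable_const)
    ((hexp _).prodMk measurable_const))) ?_
  refine Measurable.ite (.const _) (Measurable.ite ?_ (hpad.prodMk measurable_const)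
    (Measurable.ite (hc _ fun j => growProb prm j (q - (K + 2)))
    (harm.prodMk measurable_const) ((hexp _).prodMk measurable_const))) ?_
  · exact ((measurable_of_countable fun j : Fin K => st.explored = true ∨
      1 ≤ min 1 (prm.zProb j * (1 + prm.lam) ^ (q - (K + 2)))).comp harm).setOf
  · refine Measurable.ite ?_ ((hperm _).prodMk measurable_const) (hpad.prodMk measurable_const)
    exact ((measurable_of_countable fun l : Fin prm.nLam =>
      (q - (K + 2 + prm.nGrow)) % prm.nLam = (l : ℕ)).comp (hloop _)).setOf

theorem measurable_stateAt (q : ℕ) : Measurable fun ω : Outcome prm => stateAt P prm ω q := by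
  induction q with
  | zero => exact measurable_const
  | succ q ih =>
    have h : Measurable fun p : State K × Outcome prm => phaseArm P prm q p.1 p.2 :=
      measurable_from_prod_countable_right fun st => measurable_phaseArm P prm q st
    have h1 : Measurable fun ω : Outcome prm => phaseArm P prm q (stateAt P prm ω q) ω :=
      h.comp (ih.prodMk measurable_id)
    exact (measurable_of_countable fun p : State K × (Fin K × Bool) =>
      (⟨Function.update p.1.pulls p.2.1 (p.1.pulls p.2.1 + phaseLen prm q), p.2.2⟩ : State K)).comp
      (ih.prodMk h1)

theorem measurable_comp_stateAt {β : Type*} [MeasurableSpace β] (q : ℕ)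
    {f : State K → Outcome prm → β} (hf : ∀ st, Measurable (f st)) :
    Measurable fun ω : Outcome prm => f (stateAt P prm ω q) ω := by
  have h : Measurable fun p : State K × Outcome prm => f p.1 p.2 :=
    measurable_from_prod_countable_right fun st => hf st
  exact h.comp ((measurable_stateAt P prm q).prodMk measurable_id)

theorem measurable_exploring (q : ℕ) (x : Bool) :
    Measurable fun ω : Outcome prm => Exploring q x ω.2 := by
  have hc : ∀ (k : ℕ) (f : Fin K → ℝ), MeasurableSet {ω : Outcome prm | coin ω.2 k ≤ f ω.2.1} :=
    fun k f => measurableSet_le (measurable_coin prm k)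
      ((measurable_of_countable f).comp (measurable_arm prm))
  unfold Exploring
  by_cases h1 : q = K + 1
  · simp only [h1, if_true]
    exact measurableSet_setOfPred.1 (hc 0 (startProb prm))
  · by_cases h2 : q < K + 2 + prm.nGrow
    · simp only [h1, h2, if_true, if_false]
      exact measurableSet_setOfPred.1 ((MeasurableSet.const _).inter
        (hc _ fun j => growProb prm j (q - (K + 2))))
    · simp only [h1, h2, if_false]
      exact (measurable_of_countable fun l : Fin prm.nLam =>
        (q - (K + 2 + prm.nGrow)) % prm.nLam = (l : ℕ)).comp (by fun_prop)

theorem measurable_target (q : ℕ) : Measurable fun ω : Outcome prm => target q ω.2 := by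
  unfold target
  by_cases h2 : q < K + 2 + prm.nGrow
  · simp only [h2, if_true]; exact measurable_arm prm
  · simp only [h2, if_false]
    exact (measurable_of_countable fun θ : Equiv.Perm (Fin K) => θ _).comp (by fun_prop)

theorem measurableSet_arm (q : ℕ) (i : Fin K) :
    MeasurableSet {ω : Outcome prm | (phaseArm P prm q (stateAt P prm ω q) ω).1 = i} :=
  measurable_comp_stateAt P prm q (f := fun st ω => (phaseArm P prm q st ω).1)
    (fun st => (measurable_phaseArm P prm q st).fst) (measurableSet_singleton i)

end Measurability

end IncExp

namespace IncExp

/-! ### Probabilities of events of the internal randomness -/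

section Seeds

/-- The bijections in `hg` carry any fibre of `g` to any other, so all fibres have the same size.
Permutations of the values supply these bijections for `j₀`, for $\theta(m)$ and for $\ell_0(m)$. -/
theorem uniformOn_fiber {Ω α : Type*} [Fintype Ω] [Nonempty Ω] [MeasurableSpace Ω]
    [MeasurableSingletonClass Ω] [Fintype α] (g : Ω → α)
    (hg : ∀ a b, ∃ e : Ω ≃ Ω, ∀ x, g (e x) = b ↔ g x = a) (a : α) :
    (uniformOn (Set.univ : Set Ω)).real {x | g x = a} = 1 / Fintype.card α := by
  classical
  have hcard : ∀ b, (Finset.univ.filter fun x => g x = b).card =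
      (Finset.univ.filter fun x => g x = a).card := fun b => by
    obtain ⟨e, he⟩ := hg b a
    refine Finset.card_bij (fun x _ => e x) (fun x hx => ?_) (fun _ _ _ _ h => e.injective h)
      fun y hy => ⟨e.symm y, ?_, e.apply_symm_apply y⟩
    · simpa [he] using hx
    · simpa [← he] using hy
  have hsum : Fintype.card Ω = Fintype.card α * (Finset.univ.filter fun x => g x = a).card := by
    rw [← Finset.card_univ, Finset.card_eq_sum_card_fiberwise (f := g) (t := Finset.univ)
      fun _ _ => Finset.mem_coe.2 (Finset.mem_univ _), Finset.sum_congr rfl fun b _ => hcard b]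
    simp
  have hΩ : (Fintype.card Ω : ℝ) ≠ 0 := by exact_mod_cast Fintype.card_ne_zero
  have hset : {x | g x = a} = ((Finset.univ.filter fun x => g x = a : Finset Ω) : Set Ω) := by
    ext; simp
  rw [measureReal_def, uniformOn_univ, hset, Measure.count_apply_finset, ENNReal.toReal_div,
    ENNReal.toReal_natCast, ENNReal.toReal_natCast]
  have hsum' : (Fintype.card Ω : ℝ) = Fintype.card α *
      ((Finset.univ.filter fun x => g x = a).card : ℝ) := by exact_mod_cast hsum
  rw [hsum'] at hΩ ⊢
  obtain ⟨h1, h2⟩ := mul_ne_zero_iff.1 hΩ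
  field_simp

variable {K n : ℕ} [NeZero K] [NeZero n]

instance : IsProbabilityMeasure (seedLaw K n) := by unfold seedLaw; infer_instance

theorem seedLaw_coins (i : Fin K) (k : ℕ) (T : ℕ → Set unitInterval)
    (hT : ∀ l, MeasurableSet (T l)) :
    (seedLaw K n).real {s | s.1 = i ∧ ∀ l < k, s.2.2.2 l ∈ T l} =
      1 / K * ∏ l ∈ Finset.range k, (volume : Measure unitInterval).real (T l) := by
  have hset : {s : Seed K n | s.1 = i ∧ ∀ l < k, s.2.2.2 l ∈ T l} =
      {j | j = i} ×ˢ (Set.univ ×ˢ (Set.univ ×ˢ Set.pi (Finset.range k : Set ℕ) T)) := by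
    ext s; simp [Set.mem_prod, Set.mem_pi]
  have hpi : (Measure.infinitePi fun _ : ℕ => (volume : Measure unitInterval)).real
      (Set.pi (Finset.range k : Set ℕ) T) =
      ∏ l ∈ Finset.range k, (volume : Measure unitInterval).real (T l) := by
    rw [measureReal_def, Measure.infinitePi_pi _ fun l _ => hT l, ENNReal.toReal_prod]
    rfl
  rw [hset, seedLaw, measureReal_prod_prod, measureReal_prod_prod, measureReal_prod_prod, hpi,
    uniformOn_fiber (fun j : Fin K => j) fun a b => ⟨Equiv.swap a b, fun x => by
      rw [Equiv.swap_apply_eq_iff, Equiv.swap_apply_right]⟩]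
  simp

theorem seedLaw_perm (m i : Fin K) (l : Fin n) :
    (seedLaw K n).real {s | s.2.2.1 m = l ∧ s.2.1 m = i} = 1 / K * (1 / n) := by
  have hset : {s : Seed K n | s.2.2.1 m = l ∧ s.2.1 m = i} =
      Set.univ ×ˢ ({θ | θ m = i} ×ˢ ({f | f m = l} ×ˢ Set.univ)) := by
    ext s; simp [Set.mem_prod, and_comm]
  rw [hset, seedLaw, measureReal_prod_prod, measureReal_prod_prod, measureReal_prod_prod,
    uniformOn_fiber (fun θ : Equiv.Perm (Fin K) => θ m) fun a b =>
      ⟨Equiv.mulLeft (Equiv.swap a b), fun x => by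
        rw [Equiv.coe_mulLeft, Equiv.Perm.mul_apply, Equiv.swap_apply_eq_iff,
          Equiv.swap_apply_right]⟩,
    uniformOn_fiber (fun f : Fin K → Fin n => f m) fun a b =>
      ⟨Equiv.piCongrRight fun _ => Equiv.swap a b, fun x => by
        rw [Equiv.piCongrRight_apply, Pi.map_apply, Equiv.swap_apply_eq_iff,
          Equiv.swap_apply_right]⟩]
  simp

theorem seedLaw_loop (m i : Fin K) (l : Fin n) :
    (seedLaw K n).real {s | s.1 = i ∧ s.2.2.1 m ≠ l} = 1 / K * (1 - 1 / n) := by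
  have hset : {s : Seed K n | s.1 = i ∧ s.2.2.1 m ≠ l} =
      {j | j = i} ×ˢ (Set.univ ×ˢ ({f | f m = l}ᶜ ×ˢ Set.univ)) := by
    ext s; simp [Set.mem_prod]
  have hm : MeasurableSet {f : Fin K → Fin n | f m = l} := (Set.toFinite _).measurableSet
  rw [hset, seedLaw, measureReal_prod_prod, measureReal_prod_prod, measureReal_prod_prod,
    probReal_compl_eq_one_sub hm,
    uniformOn_fiber (fun j : Fin K => j) fun a b => ⟨Equiv.swap a b, fun x => by
      rw [Equiv.swap_apply_eq_iff, Equiv.swap_apply_right]⟩,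
    uniformOn_fiber (fun f : Fin K → Fin n => f m) fun a b =>
      ⟨Equiv.piCongrRight fun _ => Equiv.swap a b, fun x => by
        rw [Equiv.piCongrRight_apply, Pi.map_apply, Equiv.swap_apply_eq_iff,
          Equiv.swap_apply_right]⟩]
  simp

theorem volume_coin_le {c : ℝ} (h0 : 0 ≤ c) (h1 : c ≤ 1) :
    (volume : Measure unitInterval).real {u | (u : ℝ) ≤ c} = c := by
  have := unitInterval.volume_Iic ⟨c, h0, h1⟩
  rw [measureReal_def, show {u : unitInterval | (u : ℝ) ≤ c} = Set.Iic ⟨c, h0, h1⟩ from rfl, this,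
    ENNReal.toReal_ofReal h0]

theorem volume_coin_gt {c : ℝ} (h0 : 0 ≤ c) (h1 : c ≤ 1) :
    (volume : Measure unitInterval).real {u | ¬ (u : ℝ) ≤ c} = 1 - c := by
  have hm : MeasurableSet {u : unitInterval | (u : ℝ) ≤ c} :=
    measurableSet_le measurable_subtype_coe measurable_const
  have := probReal_compl_eq_one_sub (μ := (volume : Measure unitInterval)) hm
  rw [volume_coin_le h0 h1] at this
  exact this

end Seeds

/-! ### Incentive compatibility -/

section BIC

variable {K : ℕ} [NeZero K] {P : Fin K → Measure unitInterval} [∀ i, IsProbabilityMeasure (P i)]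
  {prm : Params K} [NeZero prm.nLam]

instance : IsProbabilityMeasure (law P prm) := by unfold law; infer_instance

theorem integrable_gap_law (i j : Fin K) :
    Integrable (fun ω : Outcome prm => (ω.1.1 i : ℝ) - (ω.1.1 j : ℝ)) (law P prm) := by
  unfold law
  exact (integrable_gap P i j).comp_fst _

/-- Fubini with the seed outside: for a fixed seed the algorithm is a deterministic function of the
rewards, to which the cylinder argument applies. -/
theorem setIntegral_law {A : Set (Outcome prm)} (hA : MeasurableSet A) (i j : Fin K) :
    ∫ ω in A, ((ω.1.1 i : ℝ) - (ω.1.1 j : ℝ)) ∂(law P prm) =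
      ∫ s, (∫ e in {e | (e, s) ∈ A}, ((e.1 i : ℝ) - (e.1 j : ℝ)) ∂(envLaw P))
        ∂(seedLaw K prm.nLam) := by
  have h := (integrable_gap_law (P := P) (prm := prm) i j).indicator hA
  rw [← integral_indicator hA]
  unfold law at h ⊢
  rw [integral_prod_symm _ h]
  refine integral_congr_ae (.of_forall fun s => ?_)
  have hs : MeasurableSet {e | (e, s) ∈ A} := measurable_prodMk_right hA
  simp only
  rw [← integral_indicator hs]
  rfl

theorem measure_law {A : Set (Outcome prm)} (hA : MeasurableSet A) :
    (law P prm).real A = ∫ s, (envLaw P).real {e | (e, s) ∈ A} ∂(seedLaw K prm.nLam) := by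
  have h : Integrable (A.indicator fun _ : Outcome prm => (1 : ℝ)) (law P prm) :=
    (integrable_const 1).indicator hA
  have h1 : (law P prm).real A = ∫ ω, A.indicator (fun _ => (1 : ℝ)) ω ∂(law P prm) := by
    rw [integral_indicator hA]; simp
  rw [h1]
  unfold law at h ⊢
  rw [integral_prod_symm _ h]
  refine integral_congr_ae (.of_forall fun s => ?_)
  have hs : MeasurableSet {e | (e, s) ∈ A} := measurable_prodMk_right hA
  simp only
  have : ∫ e, A.indicator (fun _ => (1 : ℝ)) (e, s) ∂(envLaw P) =
      ∫ e, {e | (e, s) ∈ A}.indicator (fun _ => (1 : ℝ)) e ∂(envLaw P) := rfl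
  rw [this, integral_indicator hs]
  simp

theorem measure_law_prod (A : Set (Env K)) (B : Set (Seed K prm.nLam)) :
    (law P prm).real (A ×ˢ B) = (envLaw P).real A * (seedLaw K prm.nLam).real B := by
  unfold law; exact measureReal_prod_prod _ _

/-- The gap is at least $-1$: this is the price of exploration. -/
theorem setIntegral_gap_ge {A : Set (Outcome prm)} (i j : Fin K) :
    -(law P prm).real A ≤ ∫ ω in A, ((ω.1.1 i : ℝ) - (ω.1.1 j : ℝ)) ∂(law P prm) := by
  have h := norm_setIntegral_le_of_norm_le_const (μ := law P prm) (s := A)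
    (f := fun ω : Outcome prm => (ω.1.1 i : ℝ) - (ω.1.1 j : ℝ)) (C := 1) (measure_lt_top _ _)
    fun ω _ => by
      rw [Real.norm_eq_abs, abs_le]
      have h1 := (ω.1.1 i).2
      have h2 := (ω.1.1 j).2
      constructor <;> linarith [h1.1, h1.2, h2.1, h2.2]
  rw [one_mul, Real.norm_eq_abs] at h
  exact (abs_le.1 h).1

variable (h : WellTuned P prm)
include h

theorem setIntegral_gap_zeros_nonneg (i j : Fin K) :
    0 ≤ ∫ e in zeros i prm.nBoot, ((e.1 i : ℝ) - (e.1 j : ℝ)) ∂(envLaw P) := by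
  rw [zeros_eq_cyl, setIntegral_gap_cyl P _ _ (by simp)]
  refine mul_nonneg (sub_nonneg.2 ?_) measureReal_nonneg
  by_cases hj : j < i
  · simpa [hj, postMean_zero] using (h.boot j i hj).le
  · simpa [hj, postMean_zero] using h.anti (not_lt.1 hj)

theorem gap_early (q : ℕ) (hq : q ≤ K) (i j : Fin K) :
    0 ≤ ∫ ω in {ω | (phaseArm P prm q (stateAt P prm ω q) ω).1 = i},
      ((ω.1.1 i : ℝ) - (ω.1.1 j : ℝ)) ∂(law P prm) := by
  rw [setIntegral_law (measurableSet_arm P prm q i)]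
  refine integral_nonneg fun s => ?_
  rcases hq.lt_or_eq with hq | rfl
  · have := setIntegral_exploitArm_nonneg (P := P) (d := prm.nBoot) (q := q) le_rfl
      (.inl (by omega)) s (fun _ _ => True) (fun _ _ _ _ _ => trivial) i j
    simpa [phaseArm, hq] using this
  -- The bootstrapping phase; after the substitution `q` is the number of arms. Playing `j₀` on its
  -- event of zeros is optimal, and the complement of this event is decided by data of depth
  -- `nBoot`.
  · have h1 := setIntegral_exploitArm_nonneg (P := P) (d := prm.nBoot) (q := q) le_rfl
      (.inl (by omega)) s (fun e st => ¬ zerosSeen prm s.1 e st)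
      (fun st e e' hag => (not_congr (hag.zerosSeen le_rfl s.1)).2) i j
    set B := {e | ¬ zerosSeen prm s.1 e (stateAt P prm (e, s) q) ∧
      exploitArm P prm.nBoot e (stateAt P prm (e, s) q) = i} with hB
    have hset : {e | (e, s) ∈ {ω | (phaseArm P prm q (stateAt P prm ω q) ω).1 = i}} =
        {e | e ∈ zeros s.1 prm.nBoot ∧ s.1 = i} ∪ B := by
      ext e
      simp only [Set.mem_ofPred_eq, phaseArm, lt_irrefl, if_false, if_true, Set.mem_union, hB]
      rw [zerosSeen_iff h]
      split_ifs with h2 <;> simp [h2]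
    have hmA : MeasurableSet {e : Env q | e ∈ zeros s.1 prm.nBoot ∧ s.1 = i} :=
      (measurableSet_zeros _ _).inter (.const _)
    have hmAB : MeasurableSet ({e : Env q | e ∈ zeros s.1 prm.nBoot ∧ s.1 = i} ∪ B) := by
      rw [← hset]; exact measurable_prodMk_right (measurableSet_arm P prm q i)
    have hdis : Disjoint {e : Env q | e ∈ zeros s.1 prm.nBoot ∧ s.1 = i} B :=
      Set.disjoint_left.2 fun e h2 h3 => h3.1 ((zerosSeen_iff h e s s.1).2 h2.1)
    have hmB : MeasurableSet B := by
      have : B = ({e : Env q | e ∈ zeros s.1 prm.nBoot ∧ s.1 = i} ∪ B) \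
          {e : Env q | e ∈ zeros s.1 prm.nBoot ∧ s.1 = i} := by
        rw [Set.union_sdiff_left, hdis.symm.sdiff_eq_left]
      rw [this]; exact hmAB.diff hmA
    simp only
    rw [hset, setIntegral_union hdis hmB (integrable_gap P i j).integrableOn
      (integrable_gap P i j).integrableOn]
    refine add_nonneg ?_ h1
    by_cases hs : s.1 = i
    · simp only [hs, and_true]
      exact setIntegral_gap_zeros_nonneg h i j
    · simp [hs]

/-- In a phase after the bootstrapping phase, an arm is recommended by exploration at most
`λ` times as often as by a padded phase for this arm. -/
def Balanced (P : Fin K → Measure unitInterval) (prm : Params K) (q : ℕ) (i : Fin K) : Prop :=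
  (law P prm).real {ω | Exploring q (stateAt P prm ω q).explored ω.2 ∧ target q ω.2 = i} ≤
    prm.lam * (law P prm).real {ω | ¬ Exploring q (stateAt P prm ω q).explored ω.2 ∧
      (stateAt P prm ω q).explored = true ∧ ω.2.1 = i}

/-- The coins belong to the seed. Once the seed is fixed, a coin has asked for exploration in every
environment or in none, and only the bootstrapping phase looks at the rewards. -/
theorem section_explored (q : ℕ) (hq : K < q) (s : Seed K prm.nLam) :
    {e : Env K | (stateAt P prm (e, s) q).explored = true} = Set.univ ∨
      {e : Env K | (stateAt P prm (e, s) q).explored = true} = zeros s.1 prm.nBoot := by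
  rcases eq_or_ne q (K + 1) with rfl | hq1
  · right; ext e; exact explored_boot h e s
  by_cases hq2 : K + 2 + prm.nGrow ≤ q
  · left; ext e; simpa using explored_final h (e, s) hq2
  · have h1 : ∀ e, (stateAt P prm (e, s) q).explored = true ↔
        e ∈ zeros s.1 prm.nBoot ∨ CoinExplored (q - (K + 2)) s := fun e => by
      rw [← explored_grow h e s (by omega), show K + 2 + (q - (K + 2)) = q by omega]
    simp only [h1]
    by_cases hc : CoinExplored (q - (K + 2)) s
    · left; simp [hc]
    · right; simp [hc]

/-- The recommendations of `i` are split into exploration `XP`, padding `PG` and exploitation `EX`.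
Their gains are at least $-\Pr[XP]$, $\lambda\Pr[PD]$ and 0, where `PD` contains the padded phases
with `j₀ = i` whatever `piHat` says; balance makes the sum nonnegative. -/
theorem gap_late (q : ℕ) (hq : K < q) (i j : Fin K) (hij : j ≠ i) (hbal : Balanced P prm q i) :
    0 ≤ ∫ ω in {ω | (phaseArm P prm q (stateAt P prm ω q) ω).1 = i},
      ((ω.1.1 i : ℝ) - (ω.1.1 j : ℝ)) ∂(law P prm) := by
  have hmX : MeasurableSet {ω : Outcome prm | Exploring q (stateAt P prm ω q).explored ω.2} :=
    (measurable_comp_stateAt P prm q (f := fun st ω => Exploring q st.explored ω.2)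
      fun st => measurable_exploring prm q st.explored).setOf
  have hmE : MeasurableSet {ω : Outcome prm | (stateAt P prm ω q).explored = true} :=
    measurable_comp_stateAt P prm q (f := fun st _ => st.explored) (fun st => measurable_const)
      (measurableSet_singleton true)
  have hmJ : MeasurableSet {ω : Outcome prm | ω.2.1 = i} :=
    measurable_arm prm (measurableSet_singleton i)
  have hmG : MeasurableSet {ω : Outcome prm |
      piHat P prm ω.2.1 ω.1 (stateAt P prm ω q) = ω.2.1} := by
    refine (measurable_comp_stateAt P prm q
      (f := fun st ω => piHat P prm ω.2.1 ω.1 st = ω.2.1) fun st => ?_).setOf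
    exact measurable_comp_arm prm (f := fun j ω => piHat P prm j ω.1 st = j) fun j =>
      measurableSet_setOfPred.1 (measurable_piHat P prm j st (measurableSet_singleton j))
  have hmT : MeasurableSet {ω : Outcome prm | target q ω.2 = i} :=
    measurable_target prm q (measurableSet_singleton i)
  have hmA : MeasurableSet {ω : Outcome prm | exploitArm P prm.nPad ω.1 (stateAt P prm ω q) = i} :=
    measurable_comp_stateAt P prm q (f := fun st ω => exploitArm P prm.nPad ω.1 st)
      (fun st => measurable_exploitArm P prm _ st) (measurableSet_singleton i)
  set XP := {ω : Outcome prm | Exploring q (stateAt P prm ω q).explored ω.2 ∧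
    target q ω.2 = i} with hXP
  set PD := {ω : Outcome prm | ¬ Exploring q (stateAt P prm ω q).explored ω.2 ∧
      (stateAt P prm ω q).explored = true ∧ ω.2.1 = i} with hPD
  set PG := PD ∩ {ω : Outcome prm | piHat P prm ω.2.1 ω.1 (stateAt P prm ω q) = ω.2.1} with hPG
  set EX := {ω : Outcome prm | (¬ Exploring q (stateAt P prm ω q).explored ω.2 ∧
    ¬ ((stateAt P prm ω q).explored = true ∧
      piHat P prm ω.2.1 ω.1 (stateAt P prm ω q) = ω.2.1)) ∧
    exploitArm P prm.nPad ω.1 (stateAt P prm ω q) = i} with hEX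
  have hmXP : MeasurableSet XP := hmX.inter hmT
  have hmPD : MeasurableSet PD := hmX.compl.inter (hmE.inter hmJ)
  have hmPG : MeasurableSet PG := hmPD.inter hmG
  have hmEX : MeasurableSet EX := (hmX.compl.inter (hmE.inter hmG).compl).inter hmA
  have hset : {ω : Outcome prm | (phaseArm P prm q (stateAt P prm ω q) ω).1 = i} =
      (XP ∪ PG) ∪ EX := by
    ext ω
    simp only [Set.mem_union, hXP, hPG, hPD, hEX, Set.mem_inter_iff, Set.mem_ofPred_eq]
    rw [phaseArm_late h ω hq]
    split_ifs with h1 h2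
    · simp [h1]
    · simp only [h2] at h1
      simp only [h2, paddedArm]
      split_ifs with h3 <;> simp [h1, h3]
    · rw [Bool.not_eq_true] at h2
      simp only [h2] at h1
      simp [h1, h2]
  have hd1 : Disjoint XP PG := Set.disjoint_left.2 fun ω h1 h2 => h2.1.1 h1.1
  have hd2 : Disjoint (XP ∪ PG) EX := Set.disjoint_left.2 fun ω h1 h2 => by
    rcases h1 with h1 | h1
    · exact h2.1.1 h1.1
    · exact h2.1.2 ⟨h1.1.2.1, h1.2⟩
  have hint := integrable_gap_law (P := P) (prm := prm) i j
  rw [hset, setIntegral_union hd2 hmEX hint.integrableOn hint.integrableOn,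
    setIntegral_union hd1 hmPG hint.integrableOn hint.integrableOn]
  have h1 := setIntegral_gap_ge (P := P) (A := XP) i j
  have h2 : prm.lam * (law P prm).real PD ≤
      ∫ ω in PG, ((ω.1.1 i : ℝ) - (ω.1.1 j : ℝ)) ∂(law P prm) := by
    rw [setIntegral_law hmPG, measure_law hmPD, ← integral_const_mul]
    refine integral_mono ?_ ?_ fun s => ?_
    · refine Integrable.const_mul ?_ _
      have := (((integrable_const (1 : ℝ)).indicator hmPD :
        Integrable (PD.indicator fun _ => (1 : ℝ)) (law P prm)))
      unfold law at this
      refine this.integral_prod_right.congr (.of_forall fun s => ?_)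
      have hs : MeasurableSet {e | (e, s) ∈ PD} := measurable_prodMk_right hmPD
      have : ∫ e, PD.indicator (fun _ => (1 : ℝ)) (e, s) ∂(envLaw P) =
        ∫ e, {e | (e, s) ∈ PD}.indicator (fun _ => (1 : ℝ)) e ∂(envLaw P) := rfl
      simp only
      rw [this, integral_indicator hs]
      simp
    · have := hint.indicator hmPG
      unfold law at this
      refine this.integral_prod_right.congr (.of_forall fun s => ?_)
      have hs : MeasurableSet {e | (e, s) ∈ PG} := measurable_prodMk_right hmPG
      simp only
      rw [← integral_indicator hs]
      rfl
    · simp only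
      by_cases hs : ¬ Exploring q true s ∧ s.1 = i
      · obtain ⟨hs1, rfl⟩ := hs
        have e1 : {e | (e, s) ∈ PD} = {e : Env K | (stateAt P prm (e, s) q).explored = true} := by
          ext e
          simp only [hPD, Set.mem_ofPred_eq, and_true]
          exact ⟨fun h => h.2, fun h => ⟨by rwa [h], h⟩⟩
        have e2 : {e | (e, s) ∈ PG} = {e : Env K | (stateAt P prm (e, s) q).explored = true} ∩
            {e | soloExploit P s.1 prm.nPad (successes e s.1 prm.nPad) = s.1} := by
          ext e
          have : e ∈ {e | (e, s) ∈ PD} ↔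
            e ∈ {e : Env K | (stateAt P prm (e, s) q).explored = true} := by rw [e1]
          simp only [Set.mem_ofPred_eq] at this
          simp only [hPG, Set.mem_ofPred_eq, Set.mem_inter_iff, this]
          refine and_congr_right fun hx => ?_
          rw [piHat_of_explored h (ω := (e, s)) hx]
        rw [e1, e2]
        rcases section_explored h q hq s with hs | hs
        · rw [hs, Set.univ_inter, probReal_univ, mul_one]
          exact h.gain_univ j s.1 hij
        · rw [hs, ← h.z_eq]
          exact h.gain_zeros j s.1 hij
      · have e1 : {e | (e, s) ∈ PD} = ∅ := by
          ext e
          simp only [hPD, Set.mem_ofPred_eq, Set.mem_empty_iff_false, iff_false]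
          rintro ⟨h3, h4, h5⟩
          exact hs ⟨by rwa [h4] at h3, h5⟩
        have e2 : {e | (e, s) ∈ PG} = ∅ := by
          refine Set.subset_empty_iff.1 (e1 ▸ fun e he => ?_)
          exact he.1
        rw [e1, e2]; simp
  have h3 : 0 ≤ ∫ ω in EX, ((ω.1.1 i : ℝ) - (ω.1.1 j : ℝ)) ∂(law P prm) := by
    rw [setIntegral_law hmEX]
    refine integral_nonneg fun s => ?_
    exact setIntegral_exploitArm_nonneg (P := P) (prm := prm) (d := prm.nPad) (q := q)
      h.boot_le_pad (.inr le_rfl) s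
      (fun e st => ¬ Exploring q st.explored s ∧
        ¬ (st.explored = true ∧ piHat P prm s.1 e st = s.1))
      (fun st e e' hag => by rw [hag.piHat le_rfl]; exact id) i j
  unfold Balanced at hbal
  linarith

omit [NeZero prm.nLam] in
theorem startProb_mem (i : Fin K) : 0 ≤ startProb prm i ∧ startProb prm i ≤ 1 := by
  have hl := h.lam_pos
  have hz := h.z_pos i
  have h1 : 0 < 1 + prm.lam * prm.zProb i := by positivity
  unfold startProb
  exact ⟨by positivity, (div_le_one h1).2 (by linarith)⟩

omit [NeZero prm.nLam] in
theorem growProb_mem (i : Fin K) {k : ℕ} (hk : growth prm i k < 1) :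
    0 ≤ growProb prm i k ∧ growProb prm i k ≤ 1 := by
  have hl := h.lam_pos
  have hz := h.z_pos i
  have h1 : 0 ≤ growth prm i k := le_min zero_le_one (by positivity)
  exact ⟨le_min zero_le_one (mul_nonneg (div_nonneg h1 (by linarith)) hl.le), min_le_left _ _⟩

/-- Up to the factor $1/K$, exploration has probability $p$ and padding has $z(1-p)$, since at this
point exactly the event of zeros has led to exploration. The value of `startProb` is the solution of
$p=\lambda z(1-p)$. -/
theorem balanced_start (i : Fin K) : Balanced P prm (K + 1) i := by
  obtain ⟨hc0, hc1⟩ := startProb_mem h i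
  have hl := h.lam_pos
  have hz := h.z_pos i
  have hm : MeasurableSet {u : unitInterval | (u : ℝ) ≤ startProb prm i} :=
    measurableSet_le measurable_subtype_coe measurable_const
  have e1 : {ω : Outcome prm | Exploring (K + 1) (stateAt P prm ω (K + 1)).explored ω.2 ∧
      target (K + 1) ω.2 = i} = Set.univ ×ˢ {s : Seed K prm.nLam | s.1 = i ∧
      ∀ l < 1, s.2.2.2 l ∈ {u : unitInterval | (u : ℝ) ≤ startProb prm i}} := by
    ext ω
    simp only [Exploring, if_true, target, show K + 1 < K + 2 + prm.nGrow by omega,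
      Set.mem_ofPred_eq, Set.mem_prod, Set.mem_univ, true_and, Nat.lt_one_iff, forall_eq, coin]
    constructor
    · rintro ⟨h1, h2⟩; exact ⟨h2, h2 ▸ h1⟩
    · rintro ⟨h1, h2⟩; exact ⟨h1 ▸ h2, h1⟩
  have e2 : {ω : Outcome prm | ¬ Exploring (K + 1) (stateAt P prm ω (K + 1)).explored ω.2 ∧
      (stateAt P prm ω (K + 1)).explored = true ∧ ω.2.1 = i} = zeros i prm.nBoot ×ˢ
      {s : Seed K prm.nLam | s.1 = i ∧
        ∀ l < 1, s.2.2.2 l ∈ {u : unitInterval | ¬ (u : ℝ) ≤ startProb prm i}} := by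
    ext ω
    have hx := explored_boot h ω.1 ω.2
    simp only [Exploring, if_true, Set.mem_ofPred_eq, Set.mem_prod, Nat.lt_one_iff, forall_eq,
      coin, hx]
    constructor
    · rintro ⟨h1, h2, h3⟩; exact ⟨h3 ▸ h2, h3, h3 ▸ h1⟩
    · rintro ⟨h1, h2, h3⟩; exact ⟨h2 ▸ h3, h2 ▸ h1, h2⟩
  unfold Balanced
  rw [e1, e2, measure_law_prod, measure_law_prod, seedLaw_coins i 1 (fun _ => _) fun _ => hm,
    seedLaw_coins i 1 (fun _ => {u | ¬ (u : ℝ) ≤ startProb prm i}) fun _ => hm.compl]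
  simp only [probReal_univ, Finset.prod_range_one, volume_coin_le hc0 hc1, ← h.z_eq,
    volume_coin_gt hc0 hc1]
  have h1 : startProb prm i = prm.lam * (prm.zProb i * (1 - startProb prm i)) := by
    unfold startProb
    have : 0 < 1 + prm.lam * prm.zProb i := by positivity
    field_simp
    ring
  refine le_of_eq ?_
  rw [one_mul]
  linear_combination (1 / (K : ℝ)) * h1

/-- Given `j₀ = i`, the probability that no coin before phase `k` of the growth loop asks for
exploration. -/
noncomputable def noCoinProb (prm : Params K) (i : Fin K) (k : ℕ) : ℝ :=
  (1 - startProb prm i) *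
    ∏ l ∈ Finset.range k, (1 - if growth prm i l < 1 then growProb prm i l else 0)

omit [NeZero prm.nLam] in
theorem noCoinProb_nonneg (i : Fin K) (k : ℕ) : 0 ≤ noCoinProb prm i k := by
  refine mul_nonneg (by linarith [(startProb_mem h i).2]) (Finset.prod_nonneg fun l _ => ?_)
  split_ifs with hl
  · linarith [(growProb_mem h i hl).2]
  · norm_num

omit [NeZero prm.nLam] in
/-- The exploration probability grows as intended. -/
theorem growth_le (i : Fin K) (k : ℕ) :
    noCoinProb prm i k * (1 - prm.zProb i) ≤ 1 - growth prm i k := by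
  have hl := h.lam_pos
  have hz := h.z_pos i
  have hz1 : prm.zProb i ≤ 1 := by rw [h.z_eq]; exact measureReal_le_one
  induction k with
  | zero =>
    simp only [noCoinProb, Finset.range_zero, Finset.prod_empty, mul_one, growth, pow_zero,
      min_eq_right hz1]
    nlinarith [(startProb_mem h i).1]
  | succ k ih =>
    have e1 : noCoinProb prm i (k + 1) = noCoinProb prm i k *
        (1 - if growth prm i k < 1 then growProb prm i k else 0) := by
      simp only [noCoinProb, Finset.prod_range_succ]; ring
    have h0 := noCoinProb_nonneg h i k
    have hmono := growth_mono hl.le i hz.le k.le_succ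
    rw [e1]
    split_ifs with hk
    · obtain ⟨hr0, hr1⟩ := growProb_mem h i hk
      by_cases hk' : growth prm i (k + 1) < 1
      · have e2 : growth prm i (k + 1) = growth prm i k * (1 + prm.lam) := by
          have a1 : growth prm i k = prm.zProb i * (1 + prm.lam) ^ k := by
            rcases min_lt_iff.1 hk with h | h
            · linarith
            · exact min_eq_right h.le
          have a2 : growth prm i (k + 1) = prm.zProb i * (1 + prm.lam) ^ (k + 1) := by
            rcases min_lt_iff.1 hk' with h | h
            · linarith
            · exact min_eq_right h.le
          rw [a1, a2, pow_succ]; ring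
        have e3 : growProb prm i k = growth prm i k / (1 - growth prm i k) * prm.lam := by
          refine min_eq_right ?_
          rw [div_mul_eq_mul_div, div_le_one (by linarith)]
          linarith
        have e4 : (1 - growth prm i k) * (1 - growProb prm i k) = 1 - growth prm i (k + 1) := by
          have : 1 - growth prm i k ≠ 0 := by linarith
          rw [e2, e3]
          field_simp
          ring
        rw [← e4]
        nlinarith
      · rw [growProb_eq_one h hk (not_lt.1 hk')]
        have : growth prm i (k + 1) ≤ 1 := min_le_left _ _
        nlinarith
    · have : growth prm i k ≤ growth prm i (k + 1) := hmono
      have : growth prm i (k + 1) ≤ 1 := min_le_left _ _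
      nlinarith

/-- The coins that do not ask for exploration. -/
def quietCoins (prm : Params K) (i : Fin K) : ℕ → Set unitInterval
  | 0 => {u | ¬ (u : ℝ) ≤ startProb prm i}
  | l + 1 => {u | growth prm i l < 1 → ¬ (u : ℝ) ≤ growProb prm i l}

omit h [∀ i, IsProbabilityMeasure (P i)] [NeZero prm.nLam] in
theorem measurableSet_quietCoins (i : Fin K) (l : ℕ) : MeasurableSet (quietCoins prm i l) := by
  cases l with
  | zero => exact (measurableSet_le measurable_subtype_coe measurable_const).compl
  | succ l =>
    by_cases hl : growth prm i l < 1
    · simp only [quietCoins, hl, true_imp_iff]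
      exact (measurableSet_le measurable_subtype_coe measurable_const).compl
    · simp [quietCoins, hl]

omit [NeZero prm.nLam] in
theorem prod_quietCoins (i : Fin K) (k : ℕ) :
    ∏ l ∈ Finset.range (k + 1), (volume : Measure unitInterval).real (quietCoins prm i l) =
      noCoinProb prm i k := by
  rw [Finset.prod_range_succ', mul_comm, noCoinProb]
  congr 1
  · exact volume_coin_gt (startProb_mem h i).1 (startProb_mem h i).2
  · refine Finset.prod_congr rfl fun l _ => ?_
    simp only [quietCoins]
    split_ifs with hl
    · simp only [hl, true_imp_iff]
      exact volume_coin_gt (growProb_mem h i hl).1 (growProb_mem h i hl).2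
    · simp [hl]

omit h [∀ i, IsProbabilityMeasure (P i)] [NeZero prm.nLam] in
theorem not_coinExplored_iff (s : Seed K prm.nLam) (k : ℕ) :
    ¬ CoinExplored k s ↔ ∀ l < k + 1, s.2.2.2 l ∈ quietCoins prm s.1 l := by
  unfold CoinExplored coin
  push Not
  constructor
  · rintro ⟨h1, h2⟩ (_ | l) hl
    · exact not_le.2 h1
    · exact fun h3 => not_le.2 (h2 l (by omega) h3)
  · intro h1
    refine ⟨not_le.1 (h1 0 (by omega)), fun l hl h3 => not_le.1 (h1 (l + 1) (by omega) h3)⟩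

/-- Let $u=Q(1-z)$ be the probability, given `j₀ = i`, of no exploration before phase `k`, where $Q$
refers to the coins. Exploration has probability $ug$ and padding $1-u$. From $u\le1-p$ and
$(1-p)g\le p\lambda$ follows $ug\le\lambda p\le\lambda(1-u)$. -/
theorem balanced_grow (i : Fin K) {k : ℕ} (hk : k < prm.nGrow) :
    Balanced P prm (K + 2 + k) i := by
  have hl := h.lam_pos
  have hz := h.z_pos i
  have hx := fun ω : Outcome prm => explored_grow h ω.1 ω.2 hk.le
  have hexp : ∀ (x : Bool) (s : Seed K prm.nLam), Exploring (K + 2 + k) x s ↔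
      x = false ∧ coin s (k + 1) ≤ growProb prm s.1 k := fun x s => by
    simp only [Exploring, show K + 2 + k ≠ K + 1 by omega, show K + 2 + k < K + 2 + prm.nGrow by
      omega, if_true, if_false, show K + 2 + k - (K + 2) = k by omega]
  have htar : ∀ s : Seed K prm.nLam, target (K + 2 + k) s = s.1 := fun s => by
    simp only [target, show K + 2 + k < K + 2 + prm.nGrow by omega, if_true]
  unfold Balanced
  simp only [hexp, htar]
  by_cases hg : growth prm i k < 1
  · obtain ⟨hr0, hr1⟩ := growProb_mem h i hg
    -- The coins up to `k` stay quiet and coin `k + 1` asks for exploration.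
    let T : ℕ → Set unitInterval := fun l =>
      if l < k + 1 then quietCoins prm i l else {u | (u : ℝ) ≤ growProb prm i k}
    have hT : ∀ l, MeasurableSet (T l) := fun l => by
      simp only [T]
      split_ifs
      · exact measurableSet_quietCoins i l
      · exact measurableSet_le measurable_subtype_coe measurable_const
    have e1 : {ω : Outcome prm | ((stateAt P prm ω (K + 2 + k)).explored = false ∧
        coin ω.2 (k + 1) ≤ growProb prm ω.2.1 k) ∧ ω.2.1 = i} =
        (zeros i prm.nBoot)ᶜ ×ˢ {s : Seed K prm.nLam | s.1 = i ∧
          ∀ l < k + 2, s.2.2.2 l ∈ T l} := by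
      ext ω
      rw [Set.mem_ofPred_eq, ← Bool.not_eq_true, hx ω, not_or, not_coinExplored_iff, Set.mem_prod,
        Set.mem_compl_iff, Set.mem_ofPred_eq]
      have hTi : (∀ l < k + 2, ω.2.2.2.2 l ∈ T l) ↔
          (∀ l < k + 1, ω.2.2.2.2 l ∈ quietCoins prm i l) ∧ coin ω.2 (k + 1) ≤ growProb prm i k := by
        constructor
        · intro h1
          refine ⟨fun l hl => ?_, ?_⟩
          · have := h1 l (by omega)
            simpa only [T, hl, if_true] using this
          · have := h1 (k + 1) (by omega)
            simp only [T, lt_irrefl, if_false] at this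
            exact this
        · rintro ⟨h1, h2⟩ l hl
          simp only [T]
          split_ifs with h3
          · exact h1 l h3
          · obtain rfl : l = k + 1 := by omega
            exact h2
      rw [hTi]
      constructor
      · rintro ⟨⟨⟨h1, h2⟩, h3⟩, rfl⟩; exact ⟨h1, rfl, h2, h3⟩
      · rintro ⟨h1, rfl, h2, h3⟩; exact ⟨⟨⟨h1, h2⟩, h3⟩, rfl⟩
    -- A complement inside `j₀ = i`. The vacuous condition `l < 0` brings also that event into the
    -- form treated by `seedLaw_coins`.
    have e2 : {ω : Outcome prm | ¬ ((stateAt P prm ω (K + 2 + k)).explored = false ∧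
        coin ω.2 (k + 1) ≤ growProb prm ω.2.1 k) ∧
        (stateAt P prm ω (K + 2 + k)).explored = true ∧ ω.2.1 = i} =
        (Set.univ ×ˢ {s : Seed K prm.nLam | s.1 = i ∧
          ∀ l < 0, s.2.2.2 l ∈ quietCoins prm i l}) \
        ((zeros i prm.nBoot)ᶜ ×ˢ {s : Seed K prm.nLam | s.1 = i ∧
          ∀ l < k + 1, s.2.2.2 l ∈ quietCoins prm i l}) := by
      ext ω
      have : (¬ ((stateAt P prm ω (K + 2 + k)).explored = false ∧
          coin ω.2 (k + 1) ≤ growProb prm ω.2.1 k) ∧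
          (stateAt P prm ω (K + 2 + k)).explored = true ∧ ω.2.1 = i) ↔
          ((stateAt P prm ω (K + 2 + k)).explored = true ∧ ω.2.1 = i) :=
        ⟨fun h => h.2, fun h => ⟨by simp [h.1], h⟩⟩
      rw [Set.mem_ofPred_eq, this, hx ω, ← not_not (a := CoinExplored k ω.2), not_coinExplored_iff]
      simp only [Set.mem_sdiff, Set.mem_prod, Set.mem_univ, Set.mem_ofPred_eq, Set.mem_compl_iff,
        Nat.not_lt_zero, true_and, false_imp_iff, forall_const, and_true]
      constructor
      · rintro ⟨h1, rfl⟩; exact ⟨rfl, by tauto⟩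
      · rintro ⟨rfl, h1⟩; exact ⟨by tauto, rfl⟩
    have hsub : (zeros i prm.nBoot)ᶜ ×ˢ {s : Seed K prm.nLam | s.1 = i ∧
          ∀ l < k + 1, s.2.2.2 l ∈ quietCoins prm i l} ⊆ Set.univ ×ˢ
        {s : Seed K prm.nLam | s.1 = i ∧ ∀ l < 0, s.2.2.2 l ∈ quietCoins prm i l} := by
      rintro ω ⟨-, h1⟩
      exact ⟨trivial, h1.1, fun l hl => by omega⟩
    have hmeas : MeasurableSet ((zeros i prm.nBoot)ᶜ ×ˢ {s : Seed K prm.nLam | s.1 = i ∧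
          ∀ l < k + 1, s.2.2.2 l ∈ quietCoins prm i l}) := by
      refine (measurableSet_zeros _ _).compl.prod ?_
      have : {s : Seed K prm.nLam | s.1 = i ∧ ∀ l < k + 1, s.2.2.2 l ∈ quietCoins prm i l} =
          {s | s.1 = i} ∩ ⋂ l, ⋂ (_ : l < k + 1), {s | s.2.2.2 l ∈ quietCoins prm i l} := by
        ext; simp
      rw [this]
      refine (measurable_fst (measurableSet_singleton i)).inter (.iInter fun l => .iInter fun _ => ?_)
      have : Measurable fun s : Seed K prm.nLam => s.2.2.2 l := by fun_prop
      exact this (measurableSet_quietCoins i l)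
    have hprodT : ∏ l ∈ Finset.range (k + 2), (volume : Measure unitInterval).real (T l) =
        noCoinProb prm i k * growProb prm i k := by
      rw [Finset.prod_range_succ, ← prod_quietCoins h]
      congr 1
      · refine Finset.prod_congr rfl fun l hl => ?_
        simp only [T, Finset.mem_range.1 hl, if_true]
      · simp only [T, lt_irrefl, if_false]
        exact volume_coin_le hr0 hr1
    rw [e1, e2, measureReal_sdiff hsub hmeas, measure_law_prod, measure_law_prod, measure_law_prod,
      seedLaw_coins i _ T hT, seedLaw_coins i _ _ (measurableSet_quietCoins i),
      seedLaw_coins i _ _ (measurableSet_quietCoins i), hprodT, prod_quietCoins h,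
      probReal_compl_eq_one_sub (measurableSet_zeros _ _), ← h.z_eq]
    simp only [probReal_univ, Finset.range_zero, Finset.prod_empty]
    have h1 := growth_le h i k
    have h2 := noCoinProb_nonneg h i k
    have hz1 : prm.zProb i ≤ 1 := by rw [h.z_eq]; exact measureReal_le_one
    have h3 : (1 - growth prm i k) * growProb prm i k ≤ growth prm i k * prm.lam := by
      calc _ ≤ (1 - growth prm i k) * (growth prm i k / (1 - growth prm i k) * prm.lam) :=
            mul_le_mul_of_nonneg_left (min_le_right _ _) (by linarith)
        _ = growth prm i k * prm.lam := by
            have : 1 - growth prm i k ≠ 0 := by linarith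
            field_simp
    have h4 : noCoinProb prm i k * (1 - prm.zProb i) * growProb prm i k ≤
        prm.lam * (1 - noCoinProb prm i k * (1 - prm.zProb i)) := by
      calc _ ≤ (1 - growth prm i k) * growProb prm i k := mul_le_mul_of_nonneg_right h1 hr0
        _ ≤ growth prm i k * prm.lam := h3
        _ ≤ _ := by nlinarith
    have h5 : (0 : ℝ) ≤ 1 / K := by positivity
    have h6 := mul_le_mul_of_nonneg_left h4 h5
    linarith
  · have e1 : {ω : Outcome prm | ((stateAt P prm ω (K + 2 + k)).explored = false ∧
        coin ω.2 (k + 1) ≤ growProb prm ω.2.1 k) ∧ ω.2.1 = i} = ∅ := by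
      ext ω
      simp only [Set.mem_ofPred_eq, Set.mem_empty_iff_false, iff_false]
      rintro ⟨⟨h1, -⟩, h2⟩
      have := (hx ω).2 (coinExplored_of_growth h (h2 ▸ not_lt.1 hg) ω.1)
      rw [h1] at this
      exact absurd this (by simp)
    rw [e1, measureReal_empty]
    positivity

/-- The explored arm $\theta(m)$ is uniform and independent of $\ell_0$, and so is `j₀`. Thus both
sides carry $1/K$, and what remains is $1/n\le\lambda(1-1/n)$, that is $n\ge1+1/\lambda$. -/
theorem balanced_final (i : Fin K) {q : ℕ} (hq : K + 2 + prm.nGrow ≤ q) : Balanced P prm q i := by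
  have hl := h.lam_pos
  have hx := fun ω : Outcome prm => explored_final h ω hq
  set r := q - (K + 2 + prm.nGrow)
  let m : Fin K := Fin.ofNat K (r / prm.nLam)
  let a : Fin prm.nLam := ⟨r % prm.nLam, Nat.mod_lt _ (NeZero.pos _)⟩
  have hexp : ∀ (x : Bool) (s : Seed K prm.nLam), Exploring q x s ↔ s.2.2.1 m = a := fun x s => by
    simp only [Exploring, show q ≠ K + 1 by omega, show ¬ q < K + 2 + prm.nGrow by omega, if_false]
    rw [Fin.ext_iff, eq_comm]
  have htar : ∀ s : Seed K prm.nLam, target q s = s.2.1 m := fun s => by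
    simp only [target, show ¬ q < K + 2 + prm.nGrow by omega, if_false]
    rfl
  unfold Balanced
  simp only [hexp, htar, hx, true_and]
  have e1 : {ω : Outcome prm | ω.2.2.2.1 m = a ∧ ω.2.2.1 m = i} =
      Set.univ ×ˢ {s : Seed K prm.nLam | s.2.2.1 m = a ∧ s.2.1 m = i} := by ext; simp
  have e2 : {ω : Outcome prm | ¬ ω.2.2.2.1 m = a ∧ ω.2.1 = i} =
      Set.univ ×ˢ {s : Seed K prm.nLam | s.1 = i ∧ s.2.2.1 m ≠ a} := by
    ext; simp [and_comm]
  rw [e1, e2, measure_law_prod, measure_law_prod, seedLaw_perm, seedLaw_loop, probReal_univ]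
  have hn : (0 : ℝ) < prm.nLam := by exact_mod_cast NeZero.pos prm.nLam
  have h1 : 1 / (prm.nLam : ℝ) ≤ prm.lam * (1 - 1 / prm.nLam) := by
    rw [div_le_iff₀ hn]
    have h2 : prm.lam * (1 - 1 / prm.nLam) * prm.nLam = prm.lam * (prm.nLam - 1) := by field_simp
    rw [h2]
    calc (1 : ℝ) = prm.lam * prm.lam⁻¹ := (mul_inv_cancel₀ hl.ne').symm
      _ ≤ _ := mul_le_mul_of_nonneg_left (by linarith [h.le_nLam]) hl.le
  have h5 : (0 : ℝ) ≤ 1 / K := by positivity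
  have h6 := mul_le_mul_of_nonneg_left h1 h5
  linarith

theorem isBIC (T : ℕ) : IsBIC P prm T := by
  intro t _ i j _
  rw [integral_cond]
  refine mul_nonneg (inv_nonneg.2 measureReal_nonneg) ?_
  by_cases hij : j = i
  · subst hij; simp
  unfold action
  -- The arm depends on the round only through its phase.
  generalize phaseOf prm t = q
  by_cases hq : q ≤ K
  · exact gap_early h q hq i j
  · refine gap_late h q (by omega) i j hij ?_
    by_cases h1 : q = K + 1
    · rw [h1]; exact balanced_start h i
    by_cases h2 : K + 2 + prm.nGrow ≤ q
    · exact balanced_final h i h2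
    · have := balanced_grow h i (k := q - (K + 2)) (by omega)
      rwa [show K + 2 + (q - (K + 2)) = q by omega] at this

end BIC

end IncExp

namespace IncExp

/-! ### Rounds and phases -/

section Rounds

variable {K : ℕ} [NeZero K] (P : Fin K → Measure unitInterval) (prm : Params K)

theorem phaseStart_succ (q : ℕ) : phaseStart prm (q + 1) = phaseStart prm q + phaseLen prm q :=
  Finset.sum_range_succ _ _

theorem phaseStart_mono : Monotone (phaseStart prm) :=
  monotone_nat_of_le_succ fun q => by rw [phaseStart_succ]; omega

theorem phaseOf_eq {t q : ℕ} (hq : q < numPhases prm) (h1 : phaseStart prm q ≤ t)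
    (h2 : t < phaseStart prm (q + 1)) : phaseOf prm t = q := by
  refine Nat.findGreatest_eq_iff.2 ⟨hq.le, fun _ => h1, fun n hn _ => not_le.2 ?_⟩
  exact h2.trans_le (phaseStart_mono prm hn)

theorem action_eq (ω : Outcome prm) {q r : ℕ} (hq : q < numPhases prm) (hr : r < phaseLen prm q) :
    action P prm (phaseStart prm q + r) ω = (phaseArm P prm q (stateAt P prm ω q) ω).1 := by
  unfold action
  rw [phaseOf_eq prm hq (Nat.le_add_right _ _) (by rw [phaseStart_succ]; omega)]

theorem samples_succ (t : ℕ) (i : Fin K) (ω : Outcome prm) :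
    samples P prm (t + 1) i ω = samples P prm t i ω + if action P prm t ω = i then 1 else 0 := by
  unfold samples
  rw [Finset.range_add_one, Finset.filter_insert]
  split_ifs
  · rw [Finset.card_insert_of_notMem (by simp)]
  · rfl

theorem samples_phase (ω : Outcome prm) (i : Fin K) {q : ℕ} (hq : q < numPhases prm)
    (h0 : samples P prm (phaseStart prm q) i ω = (stateAt P prm ω q).pulls i) {r : ℕ}
    (hr : r ≤ phaseLen prm q) : samples P prm (phaseStart prm q + r) i ω =
      (stateAt P prm ω q).pulls i +
        if (phaseArm P prm q (stateAt P prm ω q) ω).1 = i then r else 0 := by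
  induction r with
  | zero => simp [h0]
  | succ r ih =>
    rw [← add_assoc, samples_succ, ih (by omega), action_eq P prm ω hq (by omega)]
    split_ifs <;> omega

theorem samples_phaseStart (ω : Outcome prm) (i : Fin K) {q : ℕ} (hq : q ≤ numPhases prm) :
    samples P prm (phaseStart prm q) i ω = (stateAt P prm ω q).pulls i := by
  induction q with
  | zero => simp [samples, phaseStart, stateAt]
  | succ q ih =>
    rw [phaseStart_succ, samples_phase P prm ω i hq (ih (by omega)) le_rfl]
    simp only [stateAt]
    split_ifs with h1
    · rw [h1, Function.update_self]
    · rw [Function.update_of_ne (Ne.symm h1), add_zero]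

theorem samples_eq (ω : Outcome prm) (i : Fin K) {q r : ℕ} (hq : q < numPhases prm)
    (hr : r ≤ phaseLen prm q) : samples P prm (phaseStart prm q + r) i ω =
      (stateAt P prm ω q).pulls i +
        if (phaseArm P prm q (stateAt P prm ω q) ω).1 = i then r else 0 :=
  samples_phase P prm ω i hq (samples_phaseStart P prm ω i hq.le) hr

theorem phaseStart_final (r : ℕ) : phaseStart prm (K + 2 + prm.nGrow + r) =
    K * prm.nBoot + (2 + prm.nGrow) * prm.nPad + r * prm.nTarget := by
  induction r with
  | zero =>
    unfold phaseStart
    rw [zero_mul, add_zero, add_zero, add_assoc, Finset.sum_range_add]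
    congr 1
    · rw [Finset.sum_congr rfl (g := fun _ => prm.nBoot)
        fun q hq => by simp [phaseLen, Finset.mem_range.1 hq]]
      simp
    · rw [Finset.sum_congr rfl (g := fun _ => prm.nPad) fun q hq => by
        have := Finset.mem_range.1 hq
        exact phaseLen_of_mem prm (by omega) (by omega)]
      simp
  | succ r ih =>
    rw [← add_assoc, phaseStart_succ, ih, phaseLen, if_neg (by omega), if_neg (by omega)]
    ring

theorem horizon_eq : horizon prm =
    K * prm.nBoot + (2 + prm.nGrow) * prm.nPad + K * prm.nLam * prm.nTarget :=
  phaseStart_final prm _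

/-- Arm `i` is played throughout phase $\ell_0(m)$ of the block $m=\theta^{-1}(i)$. This holds for
every outcome. -/
theorem nTarget_le_samples (ω : Outcome prm) (i : Fin K) :
    prm.nTarget ≤ samples P prm (horizon prm) i ω := by
  let m : Fin K := ω.2.2.1.symm i
  let l : Fin prm.nLam := ω.2.2.2.1 m
  have hl := l.2
  set q := K + 2 + prm.nGrow + (m * prm.nLam + l) with hq
  have hr : m * prm.nLam + l < K * prm.nLam := by
    calc m * prm.nLam + l < m * prm.nLam + prm.nLam := by omega
      _ = (m + 1) * prm.nLam := by ring
      _ ≤ K * prm.nLam := Nat.mul_le_mul_right _ m.2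
  have hqn : q + 1 ≤ numPhases prm := by unfold numPhases; omega
  have hm : Fin.ofNat K ((m * prm.nLam + l) / prm.nLam) = m := by
    rw [Nat.add_div_of_dvd_right (Dvd.intro_left _ rfl), Nat.mul_div_cancel _ (by omega),
      Nat.div_eq_of_lt hl, add_zero]
    exact Fin.ofNat_val_eq_self m
  have harm : (phaseArm P prm q (stateAt P prm ω q) ω).1 = i := by
    simp only [phaseArm, show ¬ q < K by omega, show q ≠ K by omega, show q ≠ K + 1 by omega,
      show ¬ q < K + 2 + prm.nGrow by omega, if_false,
      show q - (K + 2 + prm.nGrow) = m * prm.nLam + l by omega, hm]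
    rw [if_pos]
    · exact ω.2.2.1.apply_symm_apply i
    · rw [Nat.add_comm, Nat.add_mul_mod_self_right, Nat.mod_eq_of_lt hl]
  have h1 : prm.nTarget ≤ (stateAt P prm ω (q + 1)).pulls i := by
    simp only [stateAt, harm, Function.update_self]
    rw [phaseLen, if_neg (by omega), if_neg (by omega)]
    omega
  calc prm.nTarget ≤ (stateAt P prm ω (q + 1)).pulls i := h1
    _ ≤ (stateAt P prm ω (numPhases prm)).pulls i := pulls_mono ω i hqn
    _ = _ := (samples_phaseStart P prm ω i le_rfl).symm

end Rounds

/-! ### Length of the run -/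

section Horizon

variable {K : ℕ} [NeZero K] {P : Fin K → Measure unitInterval} [∀ i, IsProbabilityMeasure (P i)]
  {δ : ℝ} (hδ : 0 < δ) (hanti : Antitone fun i => mean (P i)) (h : EasyInstance P δ)
include hδ hanti h

theorem params_nPad_le {Cpad : ℝ} (hC : 100 ≤ Cpad) (N : ℕ) : ((params P δ Cpad N).nPad : ℝ) ≤
    (Cpad + 1) * (1 + Real.log (1 / δ)) * (1 / δ) ^ 2 := by
  have hL := one_half_le_log hδ hanti h
  have hx : 1 ≤ 1 / δ := by
    rw [le_div_iff₀ hδ]; linarith [delta_lt_half hanti h]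
  have h1 : ((params P δ Cpad N).nPad : ℝ) ≤ Cpad * (1 / δ) ^ 2 * Real.log (1 / δ) + 1 :=
    (Nat.ceil_lt_add_one (by positivity)).le
  have h2 : 1 ≤ (1 / δ) ^ 2 := one_le_pow₀ hx
  have h3 : 0 ≤ (1 / δ) ^ 2 * (Cpad + Real.log (1 / δ)) := by positivity
  nlinarith

theorem horizon_le {Cpad : ℝ} (hC : 100 ≤ Cpad) (N : ℕ) :
    (horizon (params P δ Cpad N) : ℝ) ≤ (43 * (Cpad + 1) + 13) * (1 + Real.log (1 / δ)) ^ 2 *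
      (K * N / δ + K / δ ^ 4) := by
  have hL := one_half_le_log hδ hanti h
  have hx : 1 ≤ 1 / δ := by
    rw [le_div_iff₀ hδ]; linarith [delta_lt_half hanti h]
  have hboot := bootN_le_real hδ hanti h
  have hgrow := params_nGrow_le hδ hanti h Cpad N
  have hpad := params_nPad_le hδ hanti h hC N
  have hlam : ((params P δ Cpad N).nLam : ℝ) ≤ 2 + 10 * (1 / δ) := by
    change ((1 + ⌈(δ / 10)⁻¹⌉₊ : ℕ) : ℝ) ≤ _
    have h1 := (Nat.ceil_lt_add_one (show 0 ≤ (δ / 10)⁻¹ by positivity)).le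
    have h2 : (δ / 10)⁻¹ = 10 * (1 / δ) := by field_simp
    push_cast
    linarith
  have hK : (1 : ℝ) ≤ K := by exact_mod_cast NeZero.pos K
  rw [horizon_eq]
  have e1 : (params P δ Cpad N).nBoot = bootN P := rfl
  have e2 : (params P δ Cpad N).nTarget = N := rfl
  rw [e1, e2]
  push_cast
  have e3 : (K * N / δ + K / δ ^ 4 : ℝ) = K * (N * (1 / δ)) + K * (1 / δ) ^ 4 := by
    rw [one_div_pow]; ring
  have e4 : 20 / δ = 20 * (1 / δ) := by ring
  rw [e4] at hgrow
  rw [e3]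
  generalize Real.log (1 / δ) = L at *
  generalize 1 / δ = x at *
  have hN : (0 : ℝ) ≤ N := Nat.cast_nonneg N
  have hx4 : x ≤ x ^ 4 := le_self_pow₀ hx (by norm_num)
  have hx2 : 1 ≤ x ^ 2 := one_le_pow₀ hx
  have hA : 1 ≤ 1 + L := by linarith
  have hA2 : 1 ≤ (1 + L) ^ 2 := one_le_pow₀ hA
  have t1 : (K : ℝ) * bootN P ≤ 2 * (K * x ^ 4) := by
    calc (K : ℝ) * bootN P ≤ K * (2 * x ^ 4) := mul_le_mul_of_nonneg_left (by linarith) (by linarith)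
      _ = _ := by ring
  -- Here `L` is $\log(1/\delta)$ and `x` is $1/\delta$. The constant is 40 from $2x\cdot20x$, where
  -- $N_{boot}\le2x$, plus 3 for two extra phases and a rounding.
  have g1 : (2 : ℝ) + (params P δ Cpad N).nGrow ≤ 43 * (K * (1 + L) * x ^ 2) := by
    have g2 : (bootN P : ℝ) * K * L * (20 * x) ≤ (2 * x) * K * L * (20 * x) := by
      gcongr
      linarith
    have g3 : 1 ≤ K * (1 + L) * x ^ 2 :=
      one_le_mul_of_one_le_of_one_le (one_le_mul_of_one_le_of_one_le hK hA) hx2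
    have g4 : 0 ≤ K * x ^ 2 := by positivity
    nlinarith
  have t2 : (2 + ((params P δ Cpad N).nGrow : ℝ)) * (params P δ Cpad N).nPad ≤
      43 * (Cpad + 1) * (1 + L) ^ 2 * (K * x ^ 4) := by
    calc _ ≤ (43 * (K * (1 + L) * x ^ 2)) * ((Cpad + 1) * (1 + L) * x ^ 2) :=
          mul_le_mul g1 hpad (Nat.cast_nonneg _) (by positivity)
      _ = _ := by ring
  have t3 : (K : ℝ) * (params P δ Cpad N).nLam * N ≤ 12 * (K * (N * x)) := by
    have : (K : ℝ) * (params P δ Cpad N).nLam * N ≤ K * (12 * x) * N := by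
      gcongr
      linarith
    linarith
  have hy : 0 ≤ K * x ^ 4 := by positivity
  have hw : 0 ≤ K * (N * x) := by positivity
  have u1 : K * x ^ 4 ≤ (1 + L) ^ 2 * (K * x ^ 4) := le_mul_of_one_le_left hy hA2
  have u2 : K * (N * x) ≤ (1 + L) ^ 2 * (K * (N * x)) := le_mul_of_one_le_left hw hA2
  have u3 : 0 ≤ (Cpad + 1) * ((1 + L) ^ 2 * (K * (N * x))) := by positivity
  have u4 : 0 ≤ (1 + L) ^ 2 * (K * x ^ 4) := by positivity
  have u5 : 0 ≤ (1 + L) ^ 2 * (K * (N * x)) := by positivity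
  linarith

end Horizon

end IncExp

namespace IncExp

/-! ### Programs without loops -/

section Machine

/-- A program without loops. -/
def Prog.LoopFree : Prog → Prop
  | .seq c d => c.LoopFree ∧ d.LoopFree
  | .branch _ c d => c.LoopFree ∧ d.LoopFree
  | .loop _ _ => False
  | _ => True

/-- A bound for the number of steps of a program without loops. -/
def Prog.maxCost : Prog → ℕ
  | .skip => 1
  | .setNat _ i v => i.cost + v.cost + 1
  | .setReal _ i v => i.cost + v.cost + 1
  | .seq c d => c.maxCost + d.maxCost
  | .branch b c d => b.cost + max c.maxCost d.maxCost + 1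
  | .loop _ _ => 0
  | .call _ _ _ => 1

variable (E : (ℕ → ℕ) → (ℕ → ℕ) → ℕ)

open Classical in
/-- The memory after the execution of a program without loops. -/
noncomputable def Prog.run : Prog → Mem → Mem
  | .skip, m => m
  | .setNat a i v, m => m.setNat a (i.eval m) (v.eval m)
  | .setReal a i v, m => m.setReal a (i.eval m) (v.eval m)
  | .seq c d, m => d.run (c.run m)
  | .branch b c d, m => if b.eval m then c.run m else d.run m
  | .loop _ _, m => m
  | .call a b d, m => m.setNat d 0 (E (m.nat a) (m.nat b))

open Classical in
/-- The calls made by a program without loops. -/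
noncomputable def Prog.calls : Prog → Mem → List ((ℕ → ℕ) × (ℕ → ℕ))
  | .seq c d, m => c.calls m ++ d.calls (c.run E m)
  | .branch b c d, m => if b.eval m then c.calls m else d.calls m
  | .call a b _, m => [(m.nat a, m.nat b)]
  | _, _ => []

/-- Without loops the number of steps is bounded by the syntax alone, whatever the memory holds.
This is the source of the absolute constant per round. -/
theorem Prog.exec_run (c : Prog) (hc : c.LoopFree) (m : Mem) :
    ∃ T ≤ c.maxCost, Exec E c m (c.run E m) T (c.calls E m) := by
  induction c generalizing m with
  | skip => exact ⟨1, le_rfl, .skip m⟩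
  | setNat a i v => exact ⟨_, le_rfl, .setNat a i v m⟩
  | setReal a i v => exact ⟨_, le_rfl, .setReal a i v m⟩
  | seq c d ihc ihd =>
    obtain ⟨T₁, h₁, e₁⟩ := ihc hc.1 m
    obtain ⟨T₂, h₂, e₂⟩ := ihd hc.2 (c.run E m)
    exact ⟨T₁ + T₂, Nat.add_le_add h₁ h₂, .seq e₁ e₂⟩
  | branch b c d ihc ihd =>
    by_cases hb : b.eval m
    · obtain ⟨T, h, e⟩ := ihc hc.1 m
      refine ⟨b.cost + T + 1, ?_, ?_⟩
      · simp only [Prog.maxCost]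
        have := le_max_left c.maxCost d.maxCost
        omega
      · simp only [Prog.run, Prog.calls, hb, if_true]
        exact .branchTrue hb e
    · obtain ⟨T, h, e⟩ := ihd hc.2 m
      refine ⟨b.cost + T + 1, ?_, ?_⟩
      · simp only [Prog.maxCost]
        have := le_max_right c.maxCost d.maxCost
        omega
      · simp only [Prog.run, Prog.calls, hb, if_false]
        exact .branchFalse hb e
  | loop b c => exact hc.elim
  | call a b d => exact ⟨1, le_rfl, .call a b d m⟩

end Machine

/-! ### The program -/

/-- The variables of the program: latest reward and recommendation, current phase `q`, number `r` of
rounds of this phase before the current one and length `len` of this phase, exploration flag,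
number of zeros `zc` observed among the first `N_boot` samples of the arms before `j₀`, iteration
`m` and phase `l` of the final loop, numbers of samples and of successes truncated at `N_boot` and
at `N_pad`, a data set with samples of `j₀` only, the table `ans` of the values of `π̂` for such data
sets, and `w = z (1 + λ) ^ k`. -/
structure Regs where
  rew : ℕ
  arm : ℕ
  started : ℕ
  q : ℕ
  r : ℕ
  len : ℕ
  expl : ℕ
  zc : ℕ
  m : ℕ
  l : ℕ
  sig : ℕ
  res : ℕ
  cntB : ℕ → ℕ
  sucB : ℕ → ℕ
  cntD : ℕ → ℕ
  sucD : ℕ → ℕ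
  solo : ℕ → ℕ
  soloS : ℕ → ℕ
  ans : ℕ → ℕ
  w : ℝ

/-- An array with one entry. -/
def cell (v : ℕ) : ℕ → ℕ := fun i => if i = 0 then v else 0

theorem update_cell (v v' : ℕ) : Function.update (cell v) 0 v' = cell v' := by
  funext i; by_cases h : i = 0 <;> simp [cell, h]

/-! ### Memory as an encoding of the variables -/

section Encoding

variable {K : ℕ} [NeZero K] {prm : Params K} (ω : Outcome prm)

/-- The memory that holds the parameters, the internal randomness and the variables. -/
def enc (R : Regs) : Mem where
  nat := fun a => match a with
    | 0 => fun i => [K, prm.nBoot, prm.nPad, prm.nGrow, prm.nLam, prm.nTarget,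
        (ω.2.1 : ℕ)].getD i 0
    | 1 => fun i => if h : i < K then (ω.2.2.1 ⟨i, h⟩ : ℕ) else 0
    | 2 => fun i => if h : i < K then (ω.2.2.2.1 ⟨i, h⟩ : ℕ) else 0
    | 3 => fun i => if i = 0 then R.rew else if i = 1 then R.arm else 0
    | 4 => cell R.started
    | 5 => R.cntB
    | 6 => R.sucB
    | 7 => R.cntD
    | 8 => R.sucD
    | 9 => R.solo
    | 10 => R.soloS
    | 11 => R.ans
    | 12 => cell R.res
    | 13 => cell R.q
    | 14 => cell R.r
    | 15 => cell R.len
    | 16 => cell R.expl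
    | 17 => cell R.zc
    | 18 => cell R.m
    | 19 => cell R.l
    | 20 => cell R.sig
    | _ => fun _ => 0
  real := fun a => match a with
    | 0 => fun i => if i = 0 then prm.lam else 0
    | 1 => fun i => if h : i < K then prm.zProb ⟨i, h⟩ else 0
    | 2 => fun i => (ω.2.2.2.2 i : ℝ)
    | 3 => fun i => if i = 0 then R.w else 0
    | _ => fun _ => 0

/-- The initial values of the variables. -/
def Regs.init : Regs where
  rew := 0
  arm := 0
  started := 0
  q := 0
  r := 0
  len := 0
  expl := 0
  zc := 0
  m := 0
  l := 0
  sig := 0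
  res := 0
  cntB := fun _ => 0
  sucB := fun _ => 0
  cntD := fun _ => 0
  sucD := fun _ => 0
  solo := fun _ => 0
  soloS := fun _ => 0
  ans := fun _ => 0
  w := 0

theorem cell_eq_zero : cell 0 = fun _ => 0 := by funext i; simp [cell]

theorem initMem_eq : initMem prm ω = enc ω Regs.init := by
  unfold initMem enc Regs.init
  congr 1
  · funext a
    rcases a with _ | _ | _ | _ | _ | _ | _ | _ | _ | _ | _ | _ | _ | _ | _ | _ | _ | _ | _ | _ | _ | a
    all_goals first | rfl | simp [cell_eq_zero]
  · funext a
    rcases a with _ | _ | _ | _ | a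
    all_goals first | rfl | simp

theorem Mem.setNat_eq {m : Mem} {a i v : ℕ} {f : ℕ → ℕ → ℕ}
    (ha : f a = Function.update (m.nat a) i v) (hf : ∀ b, b ≠ a → f b = m.nat b) :
    m.setNat a i v = ⟨f, m.real⟩ := by
  unfold Mem.setNat
  congr 1
  funext b
  by_cases h : b = a
  · subst h; rw [Function.update_self, ha]
  · rw [Function.update_of_ne h, hf b h]

variable (R : Regs)

theorem enc_set_rew (v : ℕ) : (enc ω R).setNat 3 0 v = enc ω { R with rew := v } := by
  refine Mem.setNat_eq ?_ ?_
  · funext i; by_cases h : i = 0 <;> simp [enc, h]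
  · intro b hb; simp only [enc]; split <;> first | rfl | exact absurd rfl hb

theorem enc_set_arm (v : ℕ) : (enc ω R).setNat 3 1 v = enc ω { R with arm := v } := by
  refine Mem.setNat_eq ?_ ?_
  · funext i
    by_cases h : i = 1
    · simp [enc, h]
    · simp [enc, h]
  · intro b hb; simp only [enc]; split <;> first | rfl | exact absurd rfl hb

theorem enc_set_started (v : ℕ) : (enc ω R).setNat 4 0 v = enc ω { R with started := v } := by
  refine Mem.setNat_eq (update_cell _ _).symm fun b hb => ?_
  simp only [enc]; split <;> first | rfl | exact absurd rfl hb

theorem enc_set_cntB (i v : ℕ) :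
    (enc ω R).setNat 5 i v = enc ω { R with cntB := Function.update R.cntB i v } := by
  refine Mem.setNat_eq rfl fun b hb => ?_
  simp only [enc]; split <;> first | rfl | exact absurd rfl hb

theorem enc_set_sucB (i v : ℕ) :
    (enc ω R).setNat 6 i v = enc ω { R with sucB := Function.update R.sucB i v } := by
  refine Mem.setNat_eq rfl fun b hb => ?_
  simp only [enc]; split <;> first | rfl | exact absurd rfl hb

theorem enc_set_cntD (i v : ℕ) :
    (enc ω R).setNat 7 i v = enc ω { R with cntD := Function.update R.cntD i v } := by
  refine Mem.setNat_eq rfl fun b hb => ?_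
  simp only [enc]; split <;> first | rfl | exact absurd rfl hb

theorem enc_set_sucD (i v : ℕ) :
    (enc ω R).setNat 8 i v = enc ω { R with sucD := Function.update R.sucD i v } := by
  refine Mem.setNat_eq rfl fun b hb => ?_
  simp only [enc]; split <;> first | rfl | exact absurd rfl hb

theorem enc_set_solo (i v : ℕ) :
    (enc ω R).setNat 9 i v = enc ω { R with solo := Function.update R.solo i v } := by
  refine Mem.setNat_eq rfl fun b hb => ?_
  simp only [enc]; split <;> first | rfl | exact absurd rfl hb

theorem enc_set_soloS (i v : ℕ) :
    (enc ω R).setNat 10 i v = enc ω { R with soloS := Function.update R.soloS i v } := by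
  refine Mem.setNat_eq rfl fun b hb => ?_
  simp only [enc]; split <;> first | rfl | exact absurd rfl hb

theorem enc_set_ans (i v : ℕ) :
    (enc ω R).setNat 11 i v = enc ω { R with ans := Function.update R.ans i v } := by
  refine Mem.setNat_eq rfl fun b hb => ?_
  simp only [enc]; split <;> first | rfl | exact absurd rfl hb

theorem enc_set_res (v : ℕ) : (enc ω R).setNat 12 0 v = enc ω { R with res := v } := by
  refine Mem.setNat_eq (update_cell _ _).symm fun b hb => ?_
  simp only [enc]; split <;> first | rfl | exact absurd rfl hb

theorem enc_set_q (v : ℕ) : (enc ω R).setNat 13 0 v = enc ω { R with q := v } := by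
  refine Mem.setNat_eq (update_cell _ _).symm fun b hb => ?_
  simp only [enc]; split <;> first | rfl | exact absurd rfl hb

theorem enc_set_r (v : ℕ) : (enc ω R).setNat 14 0 v = enc ω { R with r := v } := by
  refine Mem.setNat_eq (update_cell _ _).symm fun b hb => ?_
  simp only [enc]; split <;> first | rfl | exact absurd rfl hb

theorem enc_set_len (v : ℕ) : (enc ω R).setNat 15 0 v = enc ω { R with len := v } := by
  refine Mem.setNat_eq (update_cell _ _).symm fun b hb => ?_
  simp only [enc]; split <;> first | rfl | exact absurd rfl hb

theorem enc_set_expl (v : ℕ) : (enc ω R).setNat 16 0 v = enc ω { R with expl := v } := by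
  refine Mem.setNat_eq (update_cell _ _).symm fun b hb => ?_
  simp only [enc]; split <;> first | rfl | exact absurd rfl hb

theorem enc_set_zc (v : ℕ) : (enc ω R).setNat 17 0 v = enc ω { R with zc := v } := by
  refine Mem.setNat_eq (update_cell _ _).symm fun b hb => ?_
  simp only [enc]; split <;> first | rfl | exact absurd rfl hb

theorem enc_set_m (v : ℕ) : (enc ω R).setNat 18 0 v = enc ω { R with m := v } := by
  refine Mem.setNat_eq (update_cell _ _).symm fun b hb => ?_
  simp only [enc]; split <;> first | rfl | exact absurd rfl hb

theorem enc_set_l (v : ℕ) : (enc ω R).setNat 19 0 v = enc ω { R with l := v } := by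
  refine Mem.setNat_eq (update_cell _ _).symm fun b hb => ?_
  simp only [enc]; split <;> first | rfl | exact absurd rfl hb

theorem enc_set_sig (v : ℕ) : (enc ω R).setNat 20 0 v = enc ω { R with sig := v } := by
  refine Mem.setNat_eq (update_cell _ _).symm fun b hb => ?_
  simp only [enc]; split <;> first | rfl | exact absurd rfl hb

theorem enc_set_w (v : ℝ) : (enc ω R).setReal 3 0 v = enc ω { R with w := v } := by
  unfold Mem.setReal
  have : Function.update (enc ω R).real 3 (Function.update ((enc ω R).real 3) 0 v) =
      (enc ω { R with w := v }).real := by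
    funext b
    by_cases hb : b = 3
    · subst hb
      funext i
      by_cases h : i = 0 <;> simp [enc, h]
    · rw [Function.update_of_ne hb]
      simp only [enc]; split <;> first | rfl | exact absurd rfl hb
  rw [this]
  rfl

end Encoding

end IncExp

namespace IncExp

/-! ### The program text and its effect on the variables -/

section Program

/-- The variable with number `a`. -/
def var (a : ℕ) : NExp := .get a (.lit 0)

/-- The parameter with number `k`. -/
def par (k : ℕ) : NExp := .get 0 (.lit k)

/-- The latest recommendation. -/
def lastArm : NExp := .get 3 (.lit 1)

/-- Update the data truncated at `N_boot`. -/
def recordBoot : Prog :=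
  .branch (.nle (.add (.get 5 lastArm) (.lit 1)) (par 1))
    (.seq (.setNat 5 lastArm (.add (.get 5 lastArm) (.lit 1)))
      (.seq (.setNat 6 lastArm (.add (.get 6 lastArm) (var 3)))
        (.branch (.nle (.add lastArm (.lit 1)) (par 6))
          (.setNat 17 (.lit 0) (.add (var 17) (.sub (.lit 1) (var 3)))) .skip)))
    .skip

/-- Update the data truncated at `N_pad`. -/
def recordPad : Prog :=
  .branch (.nle (.add (.get 7 lastArm) (.lit 1)) (par 2))
    (.seq (.setNat 7 lastArm (.add (.get 7 lastArm) (.lit 1)))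
      (.setNat 8 lastArm (.add (.get 8 lastArm) (var 3))))
    .skip

/-- Number of phases before the final loop. -/
def finalStart : NExp := .add (.add (par 0) (.lit 2)) (par 3)

/-- Set the length of the current phase. -/
def setLen : Prog :=
  .branch (.nle (.add (var 13) (.lit 1)) (par 0)) (.setNat 15 (.lit 0) (par 1))
    (.branch (.nle (.add (var 13) (.lit 1)) finalStart) (.setNat 15 (.lit 0) (par 2))
      (.setNat 15 (.lit 0) (par 5)))

/-- Update `w`. -/
def growStep : Prog :=
  -- The phase number has already been increased, so the first multiplication happens on entering
  -- growth phase 1.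
  .branch (.nle (.add (par 0) (.lit 3)) (var 13))
    (.setReal 3 (.lit 0) (.mul (.get 3 (.lit 0)) (.add (.lit 1) (.get 0 (.lit 0))))) .skip

/-- Update the counters of the final loop. -/
def loopStep : Prog :=
  .branch (.nle (.add finalStart (.lit 1)) (var 13))
    (.branch (.nle (.add (var 19) (.lit 2)) (par 4))
      (.setNat 19 (.lit 0) (.add (var 19) (.lit 1)))
      (.seq (.setNat 19 (.lit 0) (.lit 0)) (.setNat 18 (.lit 0) (.add (var 18) (.lit 1)))))
    .skip

/-- Start the next phase. -/
def nextPhase : Prog :=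
  .seq (.setNat 13 (.lit 0) (.add (var 13) (.lit 1)))
    (.seq (.setNat 14 (.lit 0) (.lit 0)) (.seq setLen (.seq growStep loopStep)))

/-- Start the first phase of positive length. -/
def firstPhase : Prog :=
  .seq (.setNat 4 (.lit 0) (.lit 1))
    -- If `nBoot = 0`, the first `K` phases are empty and the clock starts in phase `K`.
    (.seq (.branch (.nle (par 1) (.lit 0)) (.setNat 13 (.lit 0) (par 0)) .skip)
      (.seq setLen (.seq (.setReal 3 (.lit 0) (.get 1 (par 6))) (.setNat 9 (par 6) (par 2)))))

/-- Move the clock. -/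
def advance : Prog :=
  .seq (.setNat 14 (.lit 0) (.add (var 14) (.lit 1)))
    (.branch (.nle (var 15) (var 14)) nextPhase .skip)

/-- Record the latest reward and move the clock. -/
def prepare : Prog :=
  .branch (.nle (.lit 1) (var 4)) (.seq recordBoot (.seq recordPad advance)) firstPhase

/-- Exploit the data with counts in the arrays `a` and `b`. -/
def exploitProg (a b : ℕ) : Prog := .seq (.call a b 12) (.setNat 3 (.lit 1) (var 12))

/-- Explore the arm `j₀`. -/
def exploreProg : Prog := .seq (.setNat 3 (.lit 1) (par 6)) (.setNat 16 (.lit 0) (.lit 1))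

/-- The stored value of `π̂`. -/
def storedHat : NExp := .get 11 (.get 8 (par 6))

/-- A padded phase. -/
def paddedProg : Prog :=
  .branch (.nle storedHat (par 6))
    (.branch (.nle (par 6) storedHat) (.setNat 3 (.lit 1) (par 6)) (exploitProg 7 8))
    (exploitProg 7 8)

/-- The arm played in a phase of the final loop. -/
def finalProg : Prog :=
  .branch (.nle (var 19) (.get 2 (var 18)))
    (.branch (.nle (.get 2 (var 18)) (var 19)) (.setNat 3 (.lit 1) (.get 1 (var 18))) paddedProg)
    paddedProg

/-- The arm played in a phase of the growth loop. -/
def growProg : Prog :=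
  .branch (.nle (.lit 1) (var 16)) paddedProg
    -- In growth phase `k` the index of the coin is `k + 1`. The outer `min 1` of the threshold is
    -- left out because coins are at most 1.
    (.branch (.rle (.get 2 (.sub (var 13) (.add (par 0) (.lit 1))))
      (.mul (.div (.get 3 (.lit 0)) (.sub (.lit 1) (.get 3 (.lit 0)))) (.get 0 (.lit 0))))
      exploreProg (exploitProg 7 8))

/-- The arm played in the phase before the growth loop. -/
def startProg : Prog :=
  .branch (.rle (.get 2 (.lit 0)) (.div (.mul (.get 0 (.lit 0)) (.get 1 (par 6)))
      (.add (.lit 1) (.mul (.get 0 (.lit 0)) (.get 1 (par 6))))))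
    exploreProg (.branch (.nle (.lit 1) (var 16)) paddedProg (exploitProg 7 8))

/-- The arm played in the bootstrapping phase. -/
def bootProg : Prog :=
  -- Checking each arm before `j₀` would take too many steps; the count of zeros attains `j₀ *
  -- nBoot` exactly when the event has been observed.
  .branch (.nle (.mul (par 6) (par 1)) (var 17)) exploreProg (exploitProg 5 6)

/-- Choose the arm of a new phase. -/
def decideProg : Prog :=
  .branch (.nle (.add (var 13) (.lit 1)) (par 0)) (exploitProg 5 6)
    (.branch (.nle (var 13) (par 0)) bootProg
      (.branch (.nle (var 13) (.add (par 0) (.lit 1))) startProg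
        (.branch (.nle (.add (var 13) (.lit 1)) finalStart) growProg finalProg)))

/-- Choose the data set of `j₀` for which `π̂` is computed in advance. -/
def pickProg : Prog :=
  .branch (.nle (par 2) (.get 7 (par 6))) (.setNat 20 (.lit 0) (.get 8 (par 6)))
    (.branch (.nle (par 2) (.add (.get 7 (par 6)) (.lit 1)))
      (.setNat 20 (.lit 0) (.add (.get 8 (par 6)) (var 3)))
      (.setNat 20 (.lit 0) (.add (.get 8 (par 6)) (.lit 1))))

/-- Compute a value of `π̂` in advance. -/
def tableProg : Prog :=
  .seq pickProg (.seq (.setNat 10 (par 6) (var 20))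
    (.seq (.call 9 10 12) (.setNat 11 (var 20) (var 12))))

/-- The program that is run in each round. -/
def mainProg : Prog := .seq prepare (.branch (.nle (var 14) (.lit 0)) decideProg tableProg)

theorem mainProg_loopFree : mainProg.LoopFree := by
  simp [mainProg, prepare, recordBoot, recordPad, advance, nextPhase, setLen, growStep, loopStep,
    firstPhase, decideProg, exploitProg, bootProg, exploreProg, startProg, paddedProg, growProg,
    finalProg, tableProg, pickProg, Prog.LoopFree]

variable {K : ℕ} [NeZero K] {prm : Params K} (ω : Outcome prm) (R : Regs)
  (E : (ℕ → ℕ) → (ℕ → ℕ) → ℕ)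

theorem eval_par_zero : (par 0).eval (enc ω R) = K := rfl
theorem eval_par_one : (par 1).eval (enc ω R) = prm.nBoot := rfl
theorem eval_par_two : (par 2).eval (enc ω R) = prm.nPad := rfl
theorem eval_par_three : (par 3).eval (enc ω R) = prm.nGrow := rfl
theorem eval_par_four : (par 4).eval (enc ω R) = prm.nLam := rfl
theorem eval_par_five : (par 5).eval (enc ω R) = prm.nTarget := rfl
theorem eval_par_six : (par 6).eval (enc ω R) = ω.2.1 := rfl
theorem eval_rew : (var 3).eval (enc ω R) = R.rew := rfl
theorem eval_lastArm : lastArm.eval (enc ω R) = R.arm := rfl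
theorem eval_started : (var 4).eval (enc ω R) = R.started := rfl
theorem eval_res : (var 12).eval (enc ω R) = R.res := rfl
theorem eval_q : (var 13).eval (enc ω R) = R.q := rfl
theorem eval_r : (var 14).eval (enc ω R) = R.r := rfl
theorem eval_len : (var 15).eval (enc ω R) = R.len := rfl
theorem eval_zc : (var 17).eval (enc ω R) = R.zc := rfl
theorem eval_m : (var 18).eval (enc ω R) = R.m := rfl
theorem eval_l : (var 19).eval (enc ω R) = R.l := rfl
theorem eval_sig : (var 20).eval (enc ω R) = R.sig := rfl
theorem enc_cntB : (enc ω R).nat 5 = R.cntB := rfl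
theorem enc_sucB : (enc ω R).nat 6 = R.sucB := rfl
theorem enc_cntD : (enc ω R).nat 7 = R.cntD := rfl
theorem enc_sucD : (enc ω R).nat 8 = R.sucD := rfl
theorem enc_solo : (enc ω R).nat 9 = R.solo := rfl
theorem enc_soloS : (enc ω R).nat 10 = R.soloS := rfl
theorem enc_perm (m : Fin K) : (enc ω R).nat 1 m = ω.2.2.1 m := by simp [enc]
theorem enc_loop (m : Fin K) : (enc ω R).nat 2 m = ω.2.2.2.1 m := by simp [enc]
theorem enc_lam : (enc ω R).real 0 0 = prm.lam := rfl
theorem enc_z (j : Fin K) : (enc ω R).real 1 j = prm.zProb j := by simp [enc]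
theorem enc_coin (k : ℕ) : (enc ω R).real 2 k = coin ω.2 k := rfl
theorem enc_w : (enc ω R).real 3 0 = R.w := rfl
theorem eval_finalStart : finalStart.eval (enc ω R) = K + 2 + prm.nGrow := rfl
theorem eval_storedHat : storedHat.eval (enc ω R) = R.ans (R.sucD ω.2.1) := rfl

/-- Effect of `recordBoot`. -/
def Regs.recordBoot (b j : ℕ) (R : Regs) : Regs :=
  if R.cntB R.arm + 1 ≤ b then
    { R with
      cntB := Function.update R.cntB R.arm (R.cntB R.arm + 1)
      sucB := Function.update R.sucB R.arm (R.sucB R.arm + R.rew)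
      zc := if R.arm + 1 ≤ j then R.zc + (1 - R.rew) else R.zc }
  else R

theorem run_recordBoot :
    recordBoot.run E (enc ω R) = enc ω (R.recordBoot prm.nBoot ω.2.1) := by
  unfold recordBoot Regs.recordBoot
  simp only [Prog.run, Test.eval, NExp.eval, eval_lastArm, eval_par_one, enc_cntB, enc_set_cntB,
    enc_sucB, enc_set_sucB, eval_rew, eval_par_six, eval_zc, enc_set_zc]
  split_ifs <;> rfl

/-- Effect of `recordPad`. -/
def Regs.recordPad (d : ℕ) (R : Regs) : Regs :=
  if R.cntD R.arm + 1 ≤ d then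
    { R with
      cntD := Function.update R.cntD R.arm (R.cntD R.arm + 1)
      sucD := Function.update R.sucD R.arm (R.sucD R.arm + R.rew) }
  else R

theorem run_recordPad : recordPad.run E (enc ω R) = enc ω (R.recordPad prm.nPad) := by
  unfold recordPad Regs.recordPad
  simp only [Prog.run, Test.eval, NExp.eval, eval_lastArm, eval_par_two, enc_cntD, enc_set_cntD,
    enc_sucD, enc_set_sucD, eval_rew]
  split_ifs <;> rfl

theorem run_setLen : setLen.run E (enc ω R) = enc ω { R with len := phaseLen prm R.q } := by
  unfold setLen phaseLen
  simp only [Prog.run, Test.eval, NExp.eval, eval_q, eval_par_zero, eval_par_one, eval_par_two,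
    eval_par_five, eval_finalStart, enc_set_len, Nat.succ_le_iff]
  split_ifs <;> rfl

theorem run_growStep : growStep.run E (enc ω R) =
    enc ω { R with w := if K + 3 ≤ R.q then R.w * (1 + prm.lam) else R.w } := by
  unfold growStep
  simp only [Prog.run, Test.eval, NExp.eval, RExp.eval, eval_q, eval_par_zero, enc_w, enc_lam,
    enc_set_w, Nat.cast_one]
  split_ifs <;> rfl

theorem run_loopStep : loopStep.run E (enc ω R) =
    enc ω { R with
      l := if K + 2 + prm.nGrow + 1 ≤ R.q then if R.l + 2 ≤ prm.nLam then R.l + 1 else 0 else R.l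
      m := if K + 2 + prm.nGrow + 1 ≤ R.q then if R.l + 2 ≤ prm.nLam then R.m else R.m + 1
        else R.m } := by
  unfold loopStep
  simp only [Prog.run, Test.eval, NExp.eval, eval_q, eval_finalStart, eval_l, eval_par_four,
    enc_set_l, eval_m, enc_set_m]
  split_ifs <;> rfl

/-- Effect of `advance`. -/
def Regs.advance (prm : Params K) (R : Regs) : Regs :=
  if R.len ≤ R.r + 1 then
    { R with
      q := R.q + 1
      r := 0
      len := phaseLen prm (R.q + 1)
      w := if K + 3 ≤ R.q + 1 then R.w * (1 + prm.lam) else R.w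
      l := if K + 2 + prm.nGrow + 1 ≤ R.q + 1 then
        if R.l + 2 ≤ prm.nLam then R.l + 1 else 0 else R.l
      m := if K + 2 + prm.nGrow + 1 ≤ R.q + 1 then
        if R.l + 2 ≤ prm.nLam then R.m else R.m + 1 else R.m }
  else { R with r := R.r + 1 }

theorem run_advance : advance.run E (enc ω R) = enc ω (R.advance prm) := by
  unfold advance nextPhase Regs.advance
  simp only [Prog.run, Test.eval, NExp.eval, eval_r, enc_set_r, eval_len, eval_q, enc_set_q,
    run_setLen, run_growStep, run_loopStep]
  split_ifs <;> rfl

theorem run_firstPhase : firstPhase.run E (enc ω R) = enc ω { R with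
    started := 1
    q := if prm.nBoot ≤ 0 then K else R.q
    len := phaseLen prm (if prm.nBoot ≤ 0 then K else R.q)
    w := prm.zProb ω.2.1
    solo := Function.update R.solo ω.2.1 prm.nPad } := by
  unfold firstPhase
  simp only [Prog.run, Test.eval, NExp.eval, RExp.eval, enc_set_started, eval_par_one,
    eval_par_zero, enc_set_q]
  split_ifs <;> simp only [run_setLen, eval_par_six, enc_z, enc_set_w, eval_par_two, enc_set_solo]

theorem calls_prepare : prepare.calls E (enc ω R) = [] := by
  unfold prepare recordBoot recordPad firstPhase advance nextPhase setLen growStep loopStep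
  simp only [Prog.calls, List.append_nil, ite_self]

theorem run_exploitBoot : (exploitProg 5 6).run E (enc ω R) =
    enc ω { R with res := E R.cntB R.sucB, arm := E R.cntB R.sucB } := by
  unfold exploitProg
  simp only [Prog.run, NExp.eval, enc_cntB, enc_sucB, enc_set_res, eval_res, enc_set_arm]

theorem calls_exploitBoot :
    (exploitProg 5 6).calls E (enc ω R) = [(R.cntB, R.sucB)] := rfl

theorem run_exploitPad : (exploitProg 7 8).run E (enc ω R) =
    enc ω { R with res := E R.cntD R.sucD, arm := E R.cntD R.sucD } := by
  unfold exploitProg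
  simp only [Prog.run, NExp.eval, enc_cntD, enc_sucD, enc_set_res, eval_res, enc_set_arm]

theorem calls_exploitPad :
    (exploitProg 7 8).calls E (enc ω R) = [(R.cntD, R.sucD)] := rfl

theorem run_exploreProg :
    exploreProg.run E (enc ω R) = enc ω { R with arm := ω.2.1, expl := 1 } := by
  unfold exploreProg
  simp only [Prog.run, NExp.eval, eval_par_six, enc_set_arm, enc_set_expl]

theorem calls_exploreProg : exploreProg.calls E (enc ω R) = [] := rfl

/-- The choice of the data set for which `π̂` is computed in advance. -/
def Regs.pick (R : Regs) (d j : ℕ) : ℕ :=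
  -- With one sample missing, the final number of successes is $h$ or $h+1$, where $h$ is the
  -- present one, and both entries are needed. When `j` was also sampled in the previous round and
  -- that round made its entry in advance, it stored one more than the successes before the latest
  -- reward: $h+1$ if this reward was 0, and $h$ if it was 1. Adding the reward to $h$ picks the
  -- other candidate.
  if d ≤ R.cntD j then R.sucD j else if d ≤ R.cntD j + 1 then R.sucD j + R.rew else R.sucD j + 1

theorem run_pickProg :
    pickProg.run E (enc ω R) = enc ω { R with sig := R.pick prm.nPad ω.2.1 } := by
  unfold pickProg Regs.pick
  simp only [Prog.run, Test.eval, NExp.eval, eval_par_two, eval_par_six, enc_cntD, enc_sucD,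
    eval_rew, enc_set_sig]
  split_ifs <;> rfl

/-- The data set for which `π̂` is computed in advance. -/
def Regs.pickData (R : Regs) (d j : ℕ) : ℕ → ℕ := Function.update R.soloS j (R.pick d j)

theorem run_tableProg : tableProg.run E (enc ω R) = enc ω { R with
    sig := R.pick prm.nPad ω.2.1
    soloS := R.pickData prm.nPad ω.2.1
    res := E R.solo (R.pickData prm.nPad ω.2.1)
    ans := Function.update R.ans (R.pick prm.nPad ω.2.1)
      (E R.solo (R.pickData prm.nPad ω.2.1)) } := by
  unfold tableProg
  simp only [Prog.run, run_pickProg, eval_par_six, eval_sig, enc_set_soloS, enc_solo,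
    enc_soloS, enc_set_res, eval_res, enc_set_ans, Regs.pickData]

theorem calls_tableProg :
    tableProg.calls E (enc ω R) = [(R.solo, R.pickData prm.nPad ω.2.1)] := by
  have h : pickProg.calls E (enc ω R) = [] := by
    unfold pickProg
    simp only [Prog.calls, ite_self]
  unfold tableProg
  simp only [Prog.calls, h, Prog.run, run_pickProg, eval_par_six, eval_sig,
    enc_set_soloS, enc_solo, enc_soloS, List.nil_append, List.append_nil, Regs.pickData]

end Program

end IncExp

namespace IncExp

/-! ### Componentwise description of the updates -/

section Registers

variable {K : ℕ} [NeZero K] {prm : Params K}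

/-- Effect of recording the latest reward and moving the clock. -/
def Regs.next (prm : Params K) (j : ℕ) (R : Regs) : Regs :=
  ((R.recordBoot prm.nBoot j).recordPad prm.nPad).advance prm

theorem Regs.recordBoot_eq (b j : ℕ) (R : Regs) : R.recordBoot b j =
    { R with
      cntB := (R.recordBoot b j).cntB
      sucB := (R.recordBoot b j).sucB
      zc := (R.recordBoot b j).zc } := by
  unfold Regs.recordBoot; split_ifs <;> rfl

theorem Regs.recordPad_eq (d : ℕ) (R : Regs) : R.recordPad d =
    { R with
      cntD := (R.recordPad d).cntD
      sucD := (R.recordPad d).sucD } := by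
  unfold Regs.recordPad; split_ifs <;> rfl

theorem Regs.advance_eq (R : Regs) : R.advance prm =
    { R with
      q := (R.advance prm).q
      r := (R.advance prm).r
      len := (R.advance prm).len
      w := (R.advance prm).w
      l := (R.advance prm).l
      m := (R.advance prm).m } := by
  unfold Regs.advance; split_ifs <;> rfl

theorem Regs.recordBoot_cntB (b j i : ℕ) (R : Regs) : (R.recordBoot b j).cntB i =
    if i = R.arm ∧ R.cntB R.arm + 1 ≤ b then R.cntB i + 1 else R.cntB i := by
  unfold Regs.recordBoot
  by_cases h : R.cntB R.arm + 1 ≤ b <;> by_cases hi : i = R.arm <;> simp [h, hi]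

theorem Regs.recordBoot_sucB (b j i : ℕ) (R : Regs) : (R.recordBoot b j).sucB i =
    if i = R.arm ∧ R.cntB R.arm + 1 ≤ b then R.sucB i + R.rew else R.sucB i := by
  unfold Regs.recordBoot
  by_cases h : R.cntB R.arm + 1 ≤ b <;> by_cases hi : i = R.arm <;> simp [h, hi]

theorem Regs.recordBoot_zc (b j : ℕ) (R : Regs) : (R.recordBoot b j).zc =
    if R.arm < j ∧ R.cntB R.arm + 1 ≤ b then R.zc + (1 - R.rew) else R.zc := by
  unfold Regs.recordBoot
  by_cases h : R.cntB R.arm + 1 ≤ b <;> by_cases hi : R.arm < j <;> simp [h, hi]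

theorem Regs.recordPad_cntD (d i : ℕ) (R : Regs) : (R.recordPad d).cntD i =
    if i = R.arm ∧ R.cntD R.arm + 1 ≤ d then R.cntD i + 1 else R.cntD i := by
  unfold Regs.recordPad
  by_cases h : R.cntD R.arm + 1 ≤ d <;> by_cases hi : i = R.arm <;> simp [h, hi]

theorem Regs.recordPad_sucD (d i : ℕ) (R : Regs) : (R.recordPad d).sucD i =
    if i = R.arm ∧ R.cntD R.arm + 1 ≤ d then R.sucD i + R.rew else R.sucD i := by
  unfold Regs.recordPad
  by_cases h : R.cntD R.arm + 1 ≤ d <;> by_cases hi : i = R.arm <;> simp [h, hi]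

end Registers

/-! ### Invariants of the simulation -/

section Simulation

variable {K : ℕ} [NeZero K] (P : Fin K → Measure unitInterval) {prm : Params K} (ω : Outcome prm)

/-- The registers show round `r` of phase `q`. -/
structure Clock (q r : ℕ) (R : Regs) : Prop where
  started : R.started = 1
  phase : R.q = q
  round : R.r = r
  len : R.len = phaseLen prm q
  w : R.w = prm.zProb ω.2.1 * (1 + prm.lam) ^ (q - (K + 2))
  block : R.m * prm.nLam + R.l = q - (K + 2 + prm.nGrow)
  block_lt : R.l < prm.nLam

/-- The registers hold the data available in round `t`. -/
structure Data (t : ℕ) (R : Regs) : Prop where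
  cntB : ∀ i : Fin K, R.cntB i = min (samples P prm t i ω) prm.nBoot
  sucB : ∀ i : Fin K, R.sucB i = successes ω.1 i (min (samples P prm t i ω) prm.nBoot)
  cntD : ∀ i : Fin K, R.cntD i = min (samples P prm t i ω) prm.nPad
  sucD : ∀ i : Fin K, R.sucD i = successes ω.1 i (min (samples P prm t i ω) prm.nPad)
  -- Zeros plus ones equals samples; the additive form avoids truncated subtraction.
  zc : R.zc + ∑ i ∈ Finset.Iio ω.2.1, successes ω.1 i (min (samples P prm t i ω) prm.nBoot) =
    ∑ i ∈ Finset.Iio ω.2.1, min (samples P prm t i ω) prm.nBoot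
  solo : ∀ i : Fin K, R.solo i = if i = ω.2.1 then prm.nPad else 0
  soloS : ∀ i : Fin K, i ≠ ω.2.1 → R.soloS i = 0

variable {P ω}

theorem Clock.advance_same {q r : ℕ} {R : Regs} (h : Clock ω q r R)
    (hr : r + 1 < phaseLen prm q) : Clock ω q (r + 1) (R.advance prm) := by
  have e : R.advance prm = { R with r := R.r + 1 } := by
    unfold Regs.advance; rw [if_neg]; rw [h.len, h.round]; omega
  rw [e]
  exact ⟨h.started, h.phase, by rw [← h.round], h.len, h.w, h.block, h.block_lt⟩

theorem Clock.advance_next {q r : ℕ} {R : Regs} (h : Clock ω q r R)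
    (hr : phaseLen prm q ≤ r + 1) : Clock ω (q + 1) 0 (R.advance prm) := by
  have hl := h.block_lt
  have hb := h.block
  unfold Regs.advance
  rw [if_pos (by rw [h.len, h.round]; omega)]
  refine ⟨h.started, by rw [← h.phase], rfl, by rw [← h.phase], ?_, ?_, ?_⟩
  · simp only [h.phase]
    split_ifs with h1
    · rw [h.w, mul_assoc, ← pow_succ]; congr 2; omega
    · rw [h.w]; congr 2; omega
  · simp only [h.phase]
    split_ifs with h1 h2
    · omega
    · rw [add_mul]; omega
    · omega
  · simp only [h.phase]
    split_ifs with h1 h2 <;> omega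

theorem min_succ_eq (s d : ℕ) :
    min (s + 1) d = if min s d + 1 ≤ d then min s d + 1 else min s d := by
  split_ifs <;> omega

theorem successes_min_succ (e : Env K) (i : Fin K) (s d : ℕ) : successes e i (min (s + 1) d) =
    if min s d + 1 ≤ d then successes e i (min s d) + reward e i s else successes e i (min s d) := by
  rw [min_succ_eq]
  split_ifs with h
  · rw [successes_succ]; congr 2; omega
  · rfl

theorem min_samples_succ (t : ℕ) (i : Fin K) (d : ℕ) : min (samples P prm (t + 1) i ω) d =
    if i = action P prm t ω ∧ min (samples P prm t (action P prm t ω) ω) d + 1 ≤ d then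
      min (samples P prm t i ω) d + 1 else min (samples P prm t i ω) d := by
  rw [samples_succ]
  by_cases h : action P prm t ω = i
  · subst h; simp only [if_true, true_and]; exact min_succ_eq _ _
  · rw [if_neg h, if_neg (fun h1 => h h1.1.symm), add_zero]

theorem successes_samples_succ (t : ℕ) (i : Fin K) (d : ℕ) :
    successes ω.1 i (min (samples P prm (t + 1) i ω) d) =
    if i = action P prm t ω ∧ min (samples P prm t (action P prm t ω) ω) d + 1 ≤ d then
      successes ω.1 i (min (samples P prm t i ω) d) + roundReward P prm t ω
    else successes ω.1 i (min (samples P prm t i ω) d) := by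
  rw [samples_succ]
  by_cases h : action P prm t ω = i
  · subst h; simp only [if_true, true_and]; exact successes_min_succ _ _ _ _
  · rw [if_neg h, if_neg (fun h1 => h h1.1.symm), add_zero]

theorem roundReward_le_one (t : ℕ) : roundReward P prm t ω ≤ 1 := reward_le_one _ _ _

theorem Data.next {t : ℕ} {R : Regs} (h : Data P ω t R) (ha : R.arm = action P prm t ω)
    (hr : R.rew = roundReward P prm t ω) : Data P ω (t + 1) (R.next prm ω.2.1) := by
  have hrew := roundReward_le_one (P := P) (ω := ω) t
  unfold Regs.next
  rw [Regs.advance_eq, Regs.recordPad_eq]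
  have e1 := Regs.recordBoot_eq prm.nBoot ω.2.1 R
  generalize hR' : R.recordBoot prm.nBoot ω.2.1 = R' at e1
  have harm : R'.arm = action P prm t ω := by rw [e1]; exact ha
  have hrew' : R'.rew = roundReward P prm t ω := by rw [e1]; exact hr
  have hcD : ∀ i, R'.cntD i = R.cntD i := fun i => by rw [e1]
  have hsD : ∀ i, R'.sucD i = R.sucD i := fun i => by rw [e1]
  have hsolo : R'.solo = R.solo := by rw [e1]
  have hsoloS : R'.soloS = R.soloS := by rw [e1]
  refine ⟨fun i => ?_, fun i => ?_, fun i => ?_, fun i => ?_, ?_, ?_, ?_⟩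
  · change R'.cntB i = _
    rw [← hR', Regs.recordBoot_cntB, min_samples_succ, ha, h.cntB, h.cntB]
    simp only [Fin.val_inj]
  · change R'.sucB i = _
    rw [← hR', Regs.recordBoot_sucB, successes_samples_succ, ha, h.cntB, h.sucB, hr]
    simp only [Fin.val_inj]
  · change (R'.recordPad prm.nPad).cntD i = _
    rw [Regs.recordPad_cntD, min_samples_succ, harm, hcD, hcD, h.cntD, h.cntD]
    simp only [Fin.val_inj]
  · change (R'.recordPad prm.nPad).sucD i = _
    rw [Regs.recordPad_sucD, successes_samples_succ, harm, hcD, hsD, h.cntD, h.sucD, hrew']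
    simp only [Fin.val_inj]
  · change R'.zc + _ = _
    rw [← hR', Regs.recordBoot_zc, ha, h.cntB, hr]
    simp only [successes_samples_succ]
    simp only [min_samples_succ, Fin.val_fin_lt]
    have hz := h.zc
    by_cases h1 : min (samples P prm t (action P prm t ω) ω) prm.nBoot + 1 ≤ prm.nBoot
    · simp only [h1, and_true]
      have e2 : ∀ (f : Fin K → ℕ) (c : ℕ), ∑ i ∈ Finset.Iio ω.2.1,
          (if i = action P prm t ω then f i + c else f i) = ∑ i ∈ Finset.Iio ω.2.1, f i +
          if action P prm t ω < ω.2.1 then c else 0 := by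
        intro f c
        have e3 : ∀ i, (if i = action P prm t ω then f i + c else f i) =
            f i + if i = action P prm t ω then c else 0 := fun i => by split_ifs <;> rfl
        simp only [e3, Finset.sum_add_distrib, Finset.sum_ite_eq', Finset.mem_Iio]
      rw [e2, e2]
      split_ifs <;> omega
    · simp only [h1, and_false, if_false]
      exact hz
  · change ∀ i : Fin K, R'.solo i = _
    rw [hsolo]; exact h.solo
  · change ∀ i : Fin K, i ≠ ω.2.1 → R'.soloS i = _
    rw [hsoloS]; exact h.soloS

theorem Regs.next_eq (j : ℕ) (R : Regs) : (R.next prm j).started = R.started ∧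
    (R.next prm j).arm = R.arm ∧ (R.next prm j).rew = R.rew ∧ (R.next prm j).expl = R.expl ∧
    (R.next prm j).ans = R.ans := by
  unfold Regs.next
  rw [Regs.advance_eq, Regs.recordPad_eq, Regs.recordBoot_eq]
  exact ⟨rfl, rfl, rfl, rfl, rfl⟩

theorem Clock.record {q r : ℕ} {R : Regs} (h : Clock ω q r R) :
    Clock ω q r ((R.recordBoot prm.nBoot ω.2.1).recordPad prm.nPad) := by
  rw [Regs.recordPad_eq, Regs.recordBoot_eq]
  exact ⟨h.started, h.phase, h.round, h.len, h.w, h.block, h.block_lt⟩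

variable (P ω)

/-- The table holds the value of `π̂` for `N_pad` samples with `s` successes. -/
def Stored (R : Regs) (s : ℕ) : Prop := R.ans s = (soloExploit P ω.2.1 prm.nPad s : ℕ)

/-- The number of successes among the first `N_pad` samples of `j₀` available in round `t`. -/
noncomputable def hits (t : ℕ) : ℕ := successes ω.1 ω.2.1 (min (samples P prm t ω.2.1 ω) prm.nPad)

/-- The registers in round `r` of phase `q` after the latest reward has been recorded. -/
structure Ready (q r : ℕ) (R : Regs) : Prop where
  clock : Clock ω q r R
  data : Data P ω (phaseStart prm q + r) R
  rew : R.rew = lastReward P prm ω (phaseStart prm q + r)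
  expl : R.expl =
    (if r = 0 then (stateAt P prm ω q).explored else (stateAt P prm ω (q + 1)).explored).toNat
  arm : 0 < r → R.arm = action P prm (phaseStart prm q + r) ω
  stored : (stateAt P prm ω q).explored = true → Stored P ω R (hits P ω (phaseStart prm q + r))
  -- The index is one more than the number of successes before the latest reward, which is what the
  -- previous round stored. The first round of a phase stores nothing, hence `2 ≤ r`.
  ahead : 2 ≤ r → action P prm (phaseStart prm q + r) ω = ω.2.1 →
    samples P prm (phaseStart prm q + r) ω.2.1 ω < prm.nPad →
    Stored P ω R (hits P ω (phaseStart prm q + r) + 1 -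
      lastReward P prm ω (phaseStart prm q + r))

/-- The registers at the end of round `r` of phase `q`. -/
structure Finished (q r : ℕ) (R : Regs) : Prop where
  clock : Clock ω q r R
  data : Data P ω (phaseStart prm q + r) R
  expl : R.expl = (stateAt P prm ω (q + 1)).explored.toNat
  arm : R.arm = action P prm (phaseStart prm q + r) ω
  stored : (stateAt P prm ω q).explored = true → Stored P ω R (hits P ω (phaseStart prm q + r))
  full : 1 ≤ r → action P prm (phaseStart prm q + r) ω = ω.2.1 →
    prm.nPad ≤ samples P prm (phaseStart prm q + r) ω.2.1 ω →
    Stored P ω R (hits P ω (phaseStart prm q + r))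
  ahead : 1 ≤ r → action P prm (phaseStart prm q + r) ω = ω.2.1 →
    samples P prm (phaseStart prm q + r) ω.2.1 ω < prm.nPad →
    (2 ≤ r ∨ samples P prm (phaseStart prm q + r) ω.2.1 ω + 2 ≤ prm.nPad) →
    Stored P ω R (hits P ω (phaseStart prm q + r) + 1)
  last : 2 ≤ r → action P prm (phaseStart prm q + r) ω = ω.2.1 →
    samples P prm (phaseStart prm q + r) ω.2.1 ω + 1 = prm.nPad →
    Stored P ω R (hits P ω (phaseStart prm q + r))

variable {P ω}

theorem hits_succ (t : ℕ) : hits P ω (t + 1) =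
    if action P prm t ω = ω.2.1 ∧ samples P prm t ω.2.1 ω < prm.nPad then
      hits P ω t + roundReward P prm t ω else hits P ω t := by
  unfold hits
  rw [successes_samples_succ]
  by_cases h : action P prm t ω = ω.2.1
  · rw [h]
    refine if_congr ?_ rfl rfl
    simp only [true_and]
    omega
  · rw [if_neg fun h1 => h h1.1.symm, if_neg fun h1 => h h1.1]

theorem Stored.congr {R R' : Regs} (h : R'.ans = R.ans) {s : ℕ} (hs : Stored P ω R s) :
    Stored P ω R' s := by
  unfold Stored at *; rwa [h]

/-- The transition between two rounds of a phase. -/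
theorem Finished.next_same {q r : ℕ} {R : Regs} (h : Finished P ω q r R)
    (hr : R.rew = roundReward P prm (phaseStart prm q + r) ω) (hq : q < numPhases prm)
    (hlen : r + 1 < phaseLen prm q) : Ready P ω q (r + 1) (R.next prm ω.2.1) := by
  obtain ⟨-, n2, n3, n4, n5⟩ := Regs.next_eq (prm := prm) (ω.2.1 : ℕ) R
  have hact : action P prm (phaseStart prm q + (r + 1)) ω =
      action P prm (phaseStart prm q + r) ω := by
    rw [action_eq P prm ω hq hlen, action_eq P prm ω hq (by omega)]
  have hsucc := samples_succ P prm (phaseStart prm q + r) ω.2.1 ω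
  have hhit := hits_succ (P := P) (ω := ω) (phaseStart prm q + r)
  rw [add_assoc] at hsucc hhit
  refine ⟨h.clock.record.advance_same hlen, ?_, ?_, ?_, fun _ => ?_, fun hx => ?_, ?_⟩
  · rw [← add_assoc]; exact h.data.next h.arm hr
  · rw [n3, hr]; rfl
  · rw [n4, h.expl, if_neg (by omega)]
  · rw [n2, hact, h.arm]
  · refine Stored.congr n5 ?_
    have h1 : prm.nPad ≤ samples P prm (phaseStart prm q + r) ω.2.1 ω := by
      rw [samples_eq P prm ω _ hq (by omega)]
      exact (pulls_of_explored ω q hx).trans (Nat.le_add_right _ _)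
    rw [hhit, if_neg (by omega)]
    exact h.stored hx
  · intro h2 ha hs
    rw [hact] at ha
    rw [ha, if_pos rfl] at hsucc
    refine Stored.congr n5 ?_
    rw [hhit, if_pos ⟨ha, by omega⟩]
    change Stored P ω R (_ + 1 - roundReward P prm (phaseStart prm q + r) ω)
    have := h.ahead (by omega) ha (by omega) (.inr (by omega))
    convert this using 1
    omega

variable [∀ i, IsProbabilityMeasure (P i)]

omit [∀ i, IsProbabilityMeasure (P i)] in
/-- A phase that sets the exploration flag plays `j₀`. -/
theorem phaseArm_of_explored (ω : Outcome prm) {q : ℕ}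
    (h0 : (stateAt P prm ω q).explored = false) (h1 : (stateAt P prm ω (q + 1)).explored = true) :
    (phaseArm P prm q (stateAt P prm ω q) ω).1 = ω.2.1 ∧ phaseLen prm q = prm.nPad := by
  have h2 : (phaseArm P prm q (stateAt P prm ω q) ω).2 = true := h1
  have h3 : (phaseArm P prm q (stateAt P prm ω q) ω).1 = ω.2.1 ∧ K ≤ q ∧
      q < K + 2 + prm.nGrow := by
    unfold phaseArm at h2 ⊢
    simp only [h0] at h2 ⊢
    split_ifs at h2 ⊢ <;> first | exact ⟨rfl, by omega, by omega⟩ | simp_all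
  exact ⟨h3.1, phaseLen_of_mem prm h3.2.1 h3.2.2⟩

/-- The transition between two phases. -/
theorem Finished.next_phase (hw : WellTuned P prm) {q r : ℕ} {R : Regs} (h : Finished P ω q r R)
    (hr : R.rew = roundReward P prm (phaseStart prm q + r) ω) (hq : q < numPhases prm)
    (hlen : r + 1 = phaseLen prm q) : Ready P ω (q + 1) 0 (R.next prm ω.2.1) := by
  obtain ⟨-, n2, n3, n4, n5⟩ := Regs.next_eq (prm := prm) (ω.2.1 : ℕ) R
  have ht : phaseStart prm (q + 1) + 0 = phaseStart prm q + r + 1 := by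
    rw [phaseStart_succ, ← hlen]; omega
  have hhit := hits_succ (P := P) (ω := ω) (phaseStart prm q + r)
  refine ⟨h.clock.record.advance_next hlen.ge, ?_, ?_, ?_, fun h0 => absurd h0 (lt_irrefl 0),
    fun hx => ?_, fun h2 => absurd h2 (by omega)⟩
  · rw [ht]; exact h.data.next h.arm hr
  · rw [n3, hr, ht]; rfl
  · rw [n4, h.expl, if_pos rfl]
  · refine Stored.congr n5 ?_
    rw [ht, hhit]
    by_cases h0 : (stateAt P prm ω q).explored = true
    · have h1 : prm.nPad ≤ samples P prm (phaseStart prm q + r) ω.2.1 ω := by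
        rw [samples_eq P prm ω _ hq (by omega)]
        exact (pulls_of_explored ω q h0).trans (Nat.le_add_right _ _)
      rw [if_neg (by omega)]
      exact h.stored h0
    · obtain ⟨h1, h2⟩ := phaseArm_of_explored ω (Bool.not_eq_true _ ▸ h0) hx
      have ha : action P prm (phaseStart prm q + r) ω = ω.2.1 := by
        rw [action_eq P prm ω hq (by omega), h1]
      have h3 := samples_eq P prm ω ω.2.1 hq (r := r) (by omega)
      rw [h1, if_pos rfl] at h3
      have h4 := hw.three_le_pad
      -- The phase that raised the flag has `nPad` rounds of `j₀`. So before its last reward either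
      -- all `nPad` samples are present, or exactly one is missing and the entries for both possible
      -- outcomes are stored. The latter takes a deciding round and two storing rounds, whence
      -- `three_le_pad`.
      by_cases h5 : prm.nPad ≤ samples P prm (phaseStart prm q + r) ω.2.1 ω
      · rw [if_neg (by omega)]
        exact h.full (by omega) ha h5
      · rw [if_pos ⟨ha, by omega⟩]
        rcases reward_eq_zero_or_one ω.1 (action P prm (phaseStart prm q + r) ω)
          (samples P prm (phaseStart prm q + r) (action P prm (phaseStart prm q + r) ω) ω) with
          h6 | h6
        · rw [show roundReward P prm (phaseStart prm q + r) ω = 0 from h6]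
          exact h.last (by omega) ha (by omega)
        · rw [show roundReward P prm (phaseStart prm q + r) ω = 1 from h6]
          exact h.ahead (by omega) ha (by omega) (.inl (by omega))

end Simulation

end IncExp

namespace IncExp

/-! ### The program chooses the arm prescribed by the algorithm -/

section Decisions

variable {K : ℕ} [NeZero K] (P : Fin K → Measure unitInterval) {prm : Params K} (ω : Outcome prm)

/-- At most one call, on a data set with at most `S` samples of each arm. -/
def FewCalls (K S : ℕ) (l : List ((ℕ → ℕ) × (ℕ → ℕ))) : Prop :=
  l.length ≤ 1 ∧ ∀ d ∈ l, ∀ i < K, d.2 i ≤ d.1 i ∧ d.1 i ≤ S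

theorem fewCalls_nil (K S : ℕ) : FewCalls K S [] := ⟨by simp, by simp⟩

/-- The program `c` chooses the arm `d.1` and sets the exploration flag to `d.2`. -/
def Chooses (c : Prog) (R : Regs) (d : Fin K × Bool) : Prop :=
  (∃ res, c.run (exploitRoutine P) (enc ω R) =
    enc ω { R with arm := d.1, expl := d.2.toNat, res := res }) ∧
  FewCalls K prm.nPad (c.calls (exploitRoutine P) (enc ω R))

variable {P ω}

theorem chooses_branch {b : Test} {c c' : Prog} {R : Regs} {d : Fin K × Bool}
    (h : b.eval (enc ω R) → Chooses P ω c R d) (h' : ¬ b.eval (enc ω R) → Chooses P ω c' R d) :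
    Chooses P ω (.branch b c c') R d := by
  unfold Chooses
  simp only [Prog.run, Prog.calls]
  split_ifs with hb
  · exact h hb
  · exact h' hb

theorem chooses_explore (R : Regs) : Chooses P ω exploreProg R (ω.2.1, true) := by
  refine ⟨⟨R.res, ?_⟩, ?_⟩
  · rw [run_exploreProg]; rfl
  · rw [calls_exploreProg]; exact fewCalls_nil _ _

theorem chooses_setArm {R : Regs} {v : NExp} {i : Fin K} {b : Bool}
    (hv : v.eval (enc ω R) = i) (hb : R.expl = b.toNat) :
    Chooses P ω (.setNat 3 (.lit 1) v) R (i, b) := by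
  refine ⟨⟨R.res, ?_⟩, fewCalls_nil _ _⟩
  simp only [Prog.run, NExp.eval, hv, enc_set_arm, ← hb]

variable {q : ℕ} {R : Regs}

theorem chooses_exploitBoot (hb : prm.nBoot ≤ prm.nPad) (hq : q < numPhases prm)
    (h : Data P ω (phaseStart prm q) R) {b : Bool} (hx : R.expl = b.toNat) :
    Chooses P ω (exploitProg 5 6) R (exploitArm P prm.nBoot ω.1 (stateAt P prm ω q), b) := by
  have hE : exploitRoutine P R.cntB R.sucB =
      (exploitArm P prm.nBoot ω.1 (stateAt P prm ω q) : ℕ) := by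
    unfold exploitRoutine exploitArm
    simp only [h.cntB, h.sucB, samples_phaseStart P prm ω _ hq.le]
  refine ⟨⟨_, by rw [run_exploitBoot, hE, ← hx]⟩, ?_⟩
  rw [calls_exploitBoot]
  refine ⟨by simp, fun d hd i hi => ?_⟩
  rw [List.mem_singleton.1 hd]
  have h1 := h.cntB ⟨i, hi⟩
  have h2 := h.sucB ⟨i, hi⟩
  simp only at h1 h2 ⊢
  rw [h1, h2]
  exact ⟨successes_le _ _ _, (min_le_right _ _).trans hb⟩

theorem chooses_exploitPad (hq : q < numPhases prm)
    (h : Data P ω (phaseStart prm q) R) {b : Bool} (hx : R.expl = b.toNat) :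
    Chooses P ω (exploitProg 7 8) R (exploitArm P prm.nPad ω.1 (stateAt P prm ω q), b) := by
  have hE : exploitRoutine P R.cntD R.sucD =
      (exploitArm P prm.nPad ω.1 (stateAt P prm ω q) : ℕ) := by
    unfold exploitRoutine exploitArm
    simp only [h.cntD, h.sucD, samples_phaseStart P prm ω _ hq.le]
  refine ⟨⟨_, by rw [run_exploitPad, hE, ← hx]⟩, ?_⟩
  rw [calls_exploitPad]
  refine ⟨by simp, fun d hd i hi => ?_⟩
  rw [List.mem_singleton.1 hd]
  have h1 := h.cntD ⟨i, hi⟩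
  have h2 := h.sucD ⟨i, hi⟩
  simp only at h1 h2 ⊢
  rw [h1, h2]
  exact ⟨successes_le _ _ _, min_le_right _ _⟩

variable [∀ i, IsProbabilityMeasure (P i)] (hw : WellTuned P prm)
include hw

/-- The table already holds the value of `piHat`, which leaves the only call for exploitation. -/
theorem chooses_padded (hq : q < numPhases prm) (h : Data P ω (phaseStart prm q) R)
    (hx : (stateAt P prm ω q).explored = true) (hR : R.expl = 1)
    (hs : Stored P ω R (hits P ω (phaseStart prm q))) :
    Chooses P ω paddedProg R (paddedArm P prm ω.2.1 ω.1 (stateAt P prm ω q), true) := by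
  have h1 : min (samples P prm (phaseStart prm q) ω.2.1 ω) prm.nPad = prm.nPad := by
    rw [samples_phaseStart P prm ω _ hq.le]
    exact min_eq_right (pulls_of_explored ω q hx)
  have hhat : storedHat.eval (enc ω R) = (piHat P prm ω.2.1 ω.1 (stateAt P prm ω q) : ℕ) := by
    unfold Stored hits at hs
    rw [h1] at hs
    rw [eval_storedHat, h.sucD, h1, hs, piHat_of_explored hw hx]
  unfold paddedProg paddedArm
  refine chooses_branch (fun h2 => chooses_branch (fun h3 => ?_) fun h3 => ?_) fun h2 => ?_
  all_goals simp only [Test.eval, hhat, eval_par_six] at h2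
  · simp only [Test.eval, hhat, eval_par_six] at h3
    rw [if_pos (Fin.ext (le_antisymm h2 h3))]
    exact chooses_setArm (eval_par_six ω R) hR
  · simp only [Test.eval, hhat, eval_par_six] at h3
    rw [if_neg fun h4 => h3 (by rw [h4])]
    exact chooses_exploitPad hq h hR
  · rw [if_neg fun h4 => h2 (by rw [h4])]
    exact chooses_exploitPad hq h hR

omit hw [∀ i, IsProbabilityMeasure (P i)] in
-- The counter is the truncated number of samples minus the successes, and each arm contributes at
-- most `nBoot` samples. Reaching the maximum forces equality for every arm: full counts and no
-- success.
theorem zeros_counted_iff (h : Data P ω (phaseStart prm q) R) (hq : q ≤ numPhases prm) :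
    ω.2.1 * prm.nBoot ≤ R.zc ↔ zerosSeen prm ω.2.1 ω.1 (stateAt P prm ω q) := by
  have hz := h.zc
  simp only [samples_phaseStart P prm ω _ hq] at hz
  have hc : ∑ i ∈ Finset.Iio ω.2.1, prm.nBoot = ω.2.1 * prm.nBoot := by simp
  have hle : ∀ i ∈ Finset.Iio ω.2.1, min ((stateAt P prm ω q).pulls i) prm.nBoot ≤ prm.nBoot :=
    fun i _ => min_le_right _ _
  have hsum := Finset.sum_le_sum hle
  constructor
  · intro h1
    have e1 : ∑ i ∈ Finset.Iio ω.2.1, successes ω.1 i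
        (min ((stateAt P prm ω q).pulls i) prm.nBoot) = 0 := by omega
    have e2 : ∑ i ∈ Finset.Iio ω.2.1, min ((stateAt P prm ω q).pulls i) prm.nBoot =
        ∑ i ∈ Finset.Iio ω.2.1, prm.nBoot := by omega
    rw [Finset.sum_eq_zero_iff] at e1
    rw [Finset.sum_eq_sum_iff_of_le hle] at e2
    intro i hi
    have a1 := e1 i (Finset.mem_Iio.2 hi)
    have a2 := e2 i (Finset.mem_Iio.2 hi)
    rw [a2] at a1
    exact ⟨min_eq_right_iff.1 a2, a1⟩
  · intro h1
    have e1 : ∑ i ∈ Finset.Iio ω.2.1, successes ω.1 i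
        (min ((stateAt P prm ω q).pulls i) prm.nBoot) = 0 := by
      refine Finset.sum_eq_zero fun i hi => ?_
      obtain ⟨a1, a2⟩ := h1 i (Finset.mem_Iio.1 hi)
      rw [min_eq_right a1, a2]
    have e2 : ∑ i ∈ Finset.Iio ω.2.1, min ((stateAt P prm ω q).pulls i) prm.nBoot =
        ∑ i ∈ Finset.Iio ω.2.1, prm.nBoot := by
      refine Finset.sum_congr rfl fun i hi => min_eq_right (h1 i (Finset.mem_Iio.1 hi)).1
    omega

theorem chooses_start (h : Ready P ω (K + 1) 0 R) (hq : K + 1 < numPhases prm) :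
    Chooses P ω startProg R (phaseArm P prm (K + 1) (stateAt P prm ω (K + 1)) ω) := by
  have hd : Data P ω (phaseStart prm (K + 1)) R := h.data
  have hx : R.expl = (stateAt P prm ω (K + 1)).explored.toNat := h.expl
  have ht : (Test.rle (.get 2 (.lit 0)) (.div (.mul (.get 0 (.lit 0)) (.get 1 (par 6)))
      (.add (.lit 1) (.mul (.get 0 (.lit 0)) (.get 1 (par 6)))))).eval (enc ω R) ↔
      (ω.2.2.2.2 0 : ℝ) ≤ prm.lam * prm.zProb ω.2.1 / (1 + prm.lam * prm.zProb ω.2.1) := by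
    simp only [Test.eval, RExp.eval, NExp.eval, eval_par_six, enc_z, enc_lam, enc_coin, coin,
      Nat.cast_one]
  unfold startProg phaseArm
  simp only [show ¬ K + 1 < K by omega, show K + 1 ≠ K by omega, if_false, if_true]
  refine chooses_branch (fun h1 => ?_) fun h1 => chooses_branch (fun h2 => ?_) fun h2 => ?_
  all_goals rw [ht] at h1
  · rw [if_pos h1]; exact chooses_explore R
  · have h2 : 1 ≤ R.expl := h2
    have h3 : (stateAt P prm ω (K + 1)).explored = true := by
      by_contra h3; rw [hx, eq_false_of_ne_true h3] at h2; simp at h2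
    rw [if_neg h1, if_pos h3]
    exact chooses_padded hw hq hd h3 (by rw [hx, h3]; rfl) (h.stored h3)
  · have h2 : ¬ 1 ≤ R.expl := h2
    have h3 : (stateAt P prm ω (K + 1)).explored = false := by
      by_contra h3; rw [hx, eq_true_of_ne_false h3] at h2; simp at h2
    rw [if_neg h1, if_neg (by simp [h3])]
    exact chooses_exploitPad hq hd (by rw [hx, h3])

theorem chooses_grow (h : Ready P ω q 0 R) (hq : q < numPhases prm) (h1 : K + 2 ≤ q)
    (h2 : q < K + 2 + prm.nGrow) :
    Chooses P ω growProg R (phaseArm P prm q (stateAt P prm ω q) ω) := by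
  have hd : Data P ω (phaseStart prm q) R := h.data
  have hx : R.expl = (stateAt P prm ω q).explored.toNat := h.expl
  unfold growProg phaseArm
  simp only [show ¬ q < K by omega, show q ≠ K by omega, show q ≠ K + 1 by omega, h2, if_false,
    if_true]
  by_cases h3 : (stateAt P prm ω q).explored = true
  · rw [if_pos (.inl h3), h3]
    have hR : R.expl = 1 := by rw [hx, h3]; rfl
    exact chooses_branch (fun _ => chooses_padded hw hq hd h3 hR (h.stored h3))
      fun h4 => absurd hR.ge h4
  · have hR : R.expl = 0 := by rw [hx, eq_false_of_ne_true h3]; rfl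
    -- As the flag is down, $p<1$. Then `w` equals $p$ without truncation, and the program needs no
    -- test for $p=1$.
    have hp : ¬ 1 ≤ growth prm ω.2.1 (q - (K + 2)) := fun hp => by
      have h4 := (explored_grow hw ω.1 ω.2 (k := q - (K + 2)) (by omega)).2
        (coinExplored_of_growth hw hp ω.1)
      rw [show K + 2 + (q - (K + 2)) = q by omega] at h4
      exact h3 h4
    have hp' : growth prm ω.2.1 (q - (K + 2)) = R.w := by
      rw [h.clock.w]
      unfold growth at hp ⊢
      refine min_eq_right (le_of_not_ge fun h4 => hp (le_min le_rfl h4))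
    change ¬ 1 ≤ min 1 (prm.zProb ω.2.1 * (1 + prm.lam) ^ (q - (K + 2))) at hp
    change min 1 (prm.zProb ω.2.1 * (1 + prm.lam) ^ (q - (K + 2))) = R.w at hp'
    rw [if_neg (not_or.2 ⟨h3, hp⟩), hp']
    have hc : (ω.2.2.2.2 (q - (K + 2) + 1) : ℝ) ≤ 1 := coin_le_one ω.2 _
    refine chooses_branch (fun h4 => ?_) fun _ => chooses_branch (fun h4 => ?_) fun h4 => ?_
    · have h4 : 1 ≤ R.expl := h4
      omega
    all_goals
      simp only [Test.eval, RExp.eval, NExp.eval, enc_coin, enc_w, enc_lam, eval_q, eval_par_zero,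
        h.clock.phase, Nat.cast_one, coin,
        show q - (K + 1) = q - (K + 2) + 1 by omega] at h4
    · rw [if_pos (le_min hc h4)]
      exact chooses_explore R
    · rw [if_neg fun h5 => h4 (h5.trans (min_le_right _ _))]
      exact chooses_exploitPad hq hd hR

theorem chooses_final (h : Ready P ω q 0 R) (hq : q < numPhases prm)
    (h1 : K + 2 + prm.nGrow ≤ q) :
    Chooses P ω finalProg R (phaseArm P prm q (stateAt P prm ω q) ω) := by
  have hd : Data P ω (phaseStart prm q) R := h.data
  have hx : R.expl = (stateAt P prm ω q).explored.toNat := h.expl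
  have h3 := explored_final hw ω h1
  have hR : R.expl = 1 := by rw [hx, h3]; rfl
  have hl := h.clock.block_lt
  have hb := h.clock.block
  have hdiv : (q - (K + 2 + prm.nGrow)) / prm.nLam = R.m := by
    rw [← hb, Nat.mul_comm, Nat.mul_add_div (by omega), Nat.div_eq_of_lt hl, add_zero]
  have hmod : (q - (K + 2 + prm.nGrow)) % prm.nLam = R.l := by
    rw [← hb, Nat.mul_comm, Nat.mul_add_mod, Nat.mod_eq_of_lt hl]
  have hm : R.m < K := by
    rw [← hdiv, Nat.div_lt_iff_lt_mul (by omega)]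
    unfold numPhases at hq
    omega
  obtain ⟨m, hm⟩ : ∃ m : Fin K, R.m = m := ⟨⟨R.m, hm⟩, rfl⟩
  have e1 : (NExp.get 2 (var 18)).eval (enc ω R) = ω.2.2.2.1 m := by
    simp only [NExp.eval, eval_m, hm, enc_loop]
  have e2 : (NExp.get 1 (var 18)).eval (enc ω R) = ω.2.2.1 m := by
    simp only [NExp.eval, eval_m, hm, enc_perm]
  have hpad := chooses_padded hw hq hd h3 hR (h.stored h3)
  unfold finalProg phaseArm
  simp only [show ¬ q < K by omega, show q ≠ K by omega, show q ≠ K + 1 by omega,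
    show ¬ q < K + 2 + prm.nGrow by omega, if_false, hdiv, hmod, hm, h3, Fin.ofNat_val_eq_self]
  refine chooses_branch (fun h4 => chooses_branch (fun h5 => ?_) fun h5 => ?_) fun h4 => ?_
  all_goals simp only [Test.eval, e1, eval_l] at h4
  · simp only [Test.eval, e1, eval_l] at h5
    rw [if_pos (le_antisymm h4 h5)]
    exact chooses_setArm e2 hR
  · simp only [Test.eval, e1, eval_l] at h5
    rw [if_neg fun h6 => h5 h6.ge]
    exact hpad
  · rw [if_neg fun h6 => h4 h6.le]
    exact hpad

theorem chooses_decide (h : Ready P ω q 0 R) (hq : q < numPhases prm) :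
    Chooses P ω decideProg R (phaseArm P prm q (stateAt P prm ω q) ω) := by
  have hd : Data P ω (phaseStart prm q) R := h.data
  have hx : R.expl = (stateAt P prm ω q).explored.toNat := h.expl
  unfold decideProg
  refine chooses_branch (fun h1 => ?_) fun h1 => chooses_branch (fun h2 => ?_) fun h2 =>
    chooses_branch (fun h3 => ?_) fun h3 => chooses_branch (fun h4 => ?_) fun h4 => ?_
  all_goals simp only [Test.eval, NExp.eval, eval_q, eval_par_zero, h.clock.phase] at h1
  · have hqK : q < K := h1
    simp only [phaseArm, hqK, if_true]
    exact chooses_exploitBoot hw.boot_le_pad hq hd hx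
  all_goals simp only [Test.eval, eval_q, eval_par_zero, h.clock.phase] at h2
  · obtain rfl : q = K := by omega
    have hz := zeros_counted_iff hd hq.le
    simp only [phaseArm, lt_irrefl, if_false, if_true]
    refine chooses_branch (fun h3 => ?_) fun h3 => ?_
    · rw [if_pos (hz.1 h3)]
      exact chooses_explore R
    · rw [if_neg fun h4 => h3 (hz.2 h4)]
      exact chooses_exploitBoot hw.boot_le_pad hq hd hx
  all_goals simp only [Test.eval, NExp.eval, eval_q, eval_par_zero, h.clock.phase] at h3
  · obtain rfl : q = K + 1 := by omega
    exact chooses_start hw h hq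
  all_goals simp only [Test.eval, NExp.eval, eval_q, eval_finalStart, h.clock.phase] at h4
  · exact chooses_grow hw h hq (by omega) (by omega)
  · exact chooses_final hw h hq (by omega)

end Decisions

end IncExp

namespace IncExp

/-! ### The table of values of π̂ and the induction over the rounds -/

section Table

variable {K : ℕ} [NeZero K] {P : Fin K → Measure unitInterval} {prm : Params K} {ω : Outcome prm}
  {q r : ℕ} {R : Regs}

theorem lastReward_le_one (t : ℕ) : lastReward P prm ω t ≤ 1 := by
  cases t with
  | zero => exact Nat.zero_le _
  | succ t => exact reward_le_one _ _ _

theorem exploit_pickData (h : ∀ i : Fin K, R.solo i = if i = ω.2.1 then prm.nPad else 0)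
    (h' : ∀ i : Fin K, i ≠ ω.2.1 → R.soloS i = 0) :
    exploitRoutine P R.solo (R.pickData prm.nPad ω.2.1) =
      (soloExploit P ω.2.1 prm.nPad (R.pick prm.nPad ω.2.1) : ℕ) := by
  unfold exploitRoutine soloExploit
  congr 2
  · funext i; exact h i
  · funext i
    unfold Regs.pickData
    by_cases hi : i = ω.2.1
    · rw [if_pos hi, hi, Function.update_self]
    · rw [if_neg hi, Function.update_of_ne (fun h1 => hi (Fin.ext h1)), h' i hi]

/-- Round `r ≥ 1` of a phase. -/
theorem Ready.table (h : Ready P ω q r R) (hr : 1 ≤ r) :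
    ∃ R', tableProg.run (exploitRoutine P) (enc ω R) = enc ω R' ∧ Finished P ω q r R' ∧
      FewCalls K prm.nPad (tableProg.calls (exploitRoutine P) (enc ω R)) := by
  have hE := exploit_pickData (P := P) h.data.solo h.data.soloS
  have hrew := lastReward_le_one (P := P) (ω := ω) (phaseStart prm q + r)
  have hc := h.data.cntD ω.2.1
  have hs : R.sucD ω.2.1 = hits P ω (phaseStart prm q + r) := h.data.sucD ω.2.1
  have hle : hits P ω (phaseStart prm q + r) ≤
      min (samples P prm (phaseStart prm q + r) ω.2.1 ω) prm.nPad := successes_le _ _ _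
  have hpick : R.pick prm.nPad ω.2.1 =
      if prm.nPad ≤ samples P prm (phaseStart prm q + r) ω.2.1 ω then
        hits P ω (phaseStart prm q + r)
      else if prm.nPad = samples P prm (phaseStart prm q + r) ω.2.1 ω + 1 then
        hits P ω (phaseStart prm q + r) + lastReward P prm ω (phaseStart prm q + r)
      else hits P ω (phaseStart prm q + r) + 1 := by
    unfold Regs.pick
    rw [hc, hs, h.rew]
    split_ifs <;> omega
  refine ⟨_, run_tableProg _ _ _, ?_, ?_⟩
  · rw [hE]
    generalize hR' : ({ R with
      sig := R.pick prm.nPad ω.2.1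
      soloS := R.pickData prm.nPad ω.2.1
      res := (soloExploit P ω.2.1 prm.nPad (R.pick prm.nPad ω.2.1) : ℕ)
      ans := Function.update R.ans (R.pick prm.nPad ω.2.1)
        (soloExploit P ω.2.1 prm.nPad (R.pick prm.nPad ω.2.1)) } : Regs) = R'
    have hnew : Stored P ω R' (R.pick prm.nPad ω.2.1) := by
      rw [← hR']; exact Function.update_self _ _ _
    -- Correct entries survive: if one is overwritten, the new value is the correct value for the
    -- same index.
    have hold : ∀ s, Stored P ω R s → Stored P ω R' s := fun s h1 => by
      by_cases h2 : s = R.pick prm.nPad ω.2.1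
      · rw [h2]; exact hnew
      · rw [← hR']
        exact (Function.update_of_ne h2 _ _).trans h1
    rw [hpick] at hnew
    have hck := h.clock
    have hx := h.expl
    have ha := h.arm hr
    have hda := h.data
    have hr0 : r ≠ 0 := by omega
    rw [if_neg hr0] at hx
    refine ⟨?_, ?_, ?_, ?_, fun h1 => hold _ (h.stored h1), fun _ _ h1 => ?_,
      fun _ h0 h1 h2 => ?_, fun h2 h0 h1 => ?_⟩
    · rw [← hR']
      exact ⟨hck.started, hck.phase, hck.round, hck.len, hck.w, hck.block, hck.block_lt⟩
    · rw [← hR']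
      refine ⟨hda.cntB, hda.sucB, hda.cntD, hda.sucD, hda.zc, hda.solo, fun i hi => ?_⟩
      exact (Function.update_of_ne (fun h1 => hi (Fin.ext h1)) _ _).trans (hda.soloS i hi)
    · rw [← hR']; exact hx
    · rw [← hR']; exact ha
    · rwa [if_pos h1] at hnew
    · rw [if_neg (by omega)] at hnew
      by_cases h3 : prm.nPad = samples P prm (phaseStart prm q + r) ω.2.1 ω + 1
      · rw [if_pos h3] at hnew
        have h4 := hold _ (h.ahead (by omega) h0 h1)
        rcases Nat.le_one_iff_eq_zero_or_eq_one.1 hrew with h5 | h5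
        · rwa [h5] at h4
        · rwa [h5] at hnew
      · rwa [if_neg h3] at hnew
    · rw [if_neg (by omega), if_pos h1.symm] at hnew
      have h4 := hold _ (h.ahead h2 h0 (by omega))
      rcases Nat.le_one_iff_eq_zero_or_eq_one.1 hrew with h5 | h5
      · rwa [h5] at hnew
      · rwa [h5] at h4
  · rw [calls_tableProg]
    refine ⟨by simp, fun d hd i hi => ?_⟩
    rw [List.mem_singleton.1 hd]
    have h1 := h.data.solo ⟨i, hi⟩
    have h2 := h.data.soloS ⟨i, hi⟩
    simp only at h1 h2 ⊢
    rw [h1]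
    unfold Regs.pickData
    by_cases h3 : (⟨i, hi⟩ : Fin K) = ω.2.1
    · have h4 : i = ω.2.1 := by rw [← h3]
      rw [if_pos h3, h4, Function.update_self, hpick]
      refine ⟨?_, le_rfl⟩
      split_ifs <;> omega
    · rw [if_neg h3, Function.update_of_ne (fun h4 => h3 (Fin.ext h4)), h2 h3]
      exact ⟨le_rfl, Nat.zero_le _⟩

variable [∀ i, IsProbabilityMeasure (P i)] (hw : WellTuned P prm)
include hw

/-- The first round of a phase. -/
theorem Ready.decide (h : Ready P ω q 0 R) (hq : q < numPhases prm) (hlen : 0 < phaseLen prm q) :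
    ∃ R', decideProg.run (exploitRoutine P) (enc ω R) = enc ω R' ∧ Finished P ω q 0 R' ∧
      FewCalls K prm.nPad (decideProg.calls (exploitRoutine P) (enc ω R)) := by
  obtain ⟨⟨res, hrun⟩, hcalls⟩ := chooses_decide hw h hq
  have hck := h.clock
  have hda := h.data
  refine ⟨_, hrun, ⟨?_, ?_, rfl, ?_, h.stored, fun h1 => absurd h1 (by omega),
    fun h1 => absurd h1 (by omega), fun h1 => absurd h1 (by omega)⟩, hcalls⟩
  · exact ⟨hck.started, hck.phase, hck.round, hck.len, hck.w, hck.block, hck.block_lt⟩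
  · exact ⟨hda.cntB, hda.sucB, hda.cntD, hda.sucD, hda.zc, hda.solo, hda.soloS⟩
  · rw [action_eq P prm ω hq hlen]

/-- A round after the latest reward has been recorded. -/
theorem Ready.finish (h : Ready P ω q r R) (hq : q < numPhases prm) (hr : r < phaseLen prm q)
    {m : Mem} (hm : prepare.run (exploitRoutine P) m = enc ω R)
    (hm' : prepare.calls (exploitRoutine P) m = []) :
    ∃ R', mainProg.run (exploitRoutine P) m = enc ω R' ∧ Finished P ω q r R' ∧
      FewCalls K prm.nPad (mainProg.calls (exploitRoutine P) m) := by
  unfold mainProg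
  have hround : (var 14).eval (enc ω R) = r := by rw [eval_r, h.clock.round]
  simp only [Prog.run, Prog.calls, hm, hm', List.nil_append, Test.eval, hround, NExp.eval]
  by_cases h0 : r ≤ 0
  · obtain rfl : r = 0 := by omega
    simp only [le_refl, if_true]
    exact h.decide hw hq hr
  · simp only [h0, if_false]
    exact h.table (by omega)

/-- The clock never has to skip an empty phase after the start: `nBoot = 0` forces `K = 1`, so that
phase 0 is the only initial one, and if `nTarget = 0` no round is left when the final loop begins.
-/
theorem phaseLen_pos (h0 : q ≠ 0)
    (h : phaseStart prm q < horizon prm) : 0 < phaseLen prm q := by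
  rw [Nat.pos_iff_ne_zero]
  intro hz
  unfold phaseLen at hz
  split_ifs at hz with h1 h2
  · have := hw.boot_zero hz
    omega
  · have := hw.three_le_pad
    omega
  · have h3 := phaseStart_final prm (q - (K + 2 + prm.nGrow))
    rw [show K + 2 + prm.nGrow + (q - (K + 2 + prm.nGrow)) = q by omega, hz] at h3
    rw [horizon_eq, hz] at h
    omega

/-- One round. -/
theorem Finished.step (h : Finished P ω q r R) (hq : q < numPhases prm)
    (hr : r < phaseLen prm q) (ht : phaseStart prm q + r + 1 < horizon prm) :
    ∃ q' r' R', q' < numPhases prm ∧ r' < phaseLen prm q' ∧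
      phaseStart prm q' + r' = phaseStart prm q + r + 1 ∧
      mainProg.run (exploitRoutine P)
        ((enc ω R).setNat 3 0 (roundReward P prm (phaseStart prm q + r) ω)) = enc ω R' ∧
      Finished P ω q' r' R' ∧ FewCalls K prm.nPad (mainProg.calls (exploitRoutine P)
        ((enc ω R).setNat 3 0 (roundReward P prm (phaseStart prm q + r) ω))) := by
  rw [enc_set_rew]
  generalize hR₁ : ({ R with rew := roundReward P prm (phaseStart prm q + r) ω } : Regs) = R₁
  have h₁ : Finished P ω q r R₁ := by
    have hck := h.clock
    have hda := h.data
    rw [← hR₁]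
    exact ⟨⟨hck.started, hck.phase, hck.round, hck.len, hck.w, hck.block, hck.block_lt⟩,
      ⟨hda.cntB, hda.sucB, hda.cntD, hda.sucD, hda.zc, hda.solo, hda.soloS⟩,
      h.expl, h.arm, h.stored, h.full, h.ahead, h.last⟩
  have hrew : R₁.rew = roundReward P prm (phaseStart prm q + r) ω := by rw [← hR₁]
  have hrun : prepare.run (exploitRoutine P) (enc ω R₁) = enc ω (R₁.next prm ω.2.1) := by
    unfold prepare
    simp only [Prog.run, Test.eval, NExp.eval, eval_started, h₁.clock.started, le_refl, if_true,
      run_recordBoot, run_recordPad, run_advance, Regs.next]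
  have hcalls := calls_prepare ω R₁ (exploitRoutine P)
  by_cases h1 : r + 1 < phaseLen prm q
  · obtain ⟨R', e1, e2, e3⟩ := (h₁.next_same hrew hq h1).finish hw hq h1 hrun hcalls
    exact ⟨q, r + 1, R', hq, h1, rfl, e1, e2, e3⟩
  · have h2 : r + 1 = phaseLen prm q := by omega
    have h3 : phaseStart prm (q + 1) = phaseStart prm q + r + 1 := by
      rw [phaseStart_succ, ← h2, add_assoc]
    have hq' : q + 1 < numPhases prm := by
      refine lt_of_le_of_ne hq fun h4 => ?_
      rw [← h3, h4] at ht
      exact lt_irrefl _ ht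
    have hlen := phaseLen_pos hw (Nat.succ_ne_zero q) (h3 ▸ ht)
    obtain ⟨R', e1, e2, e3⟩ := (h₁.next_phase hw hrew hq h2).finish hw hq' hlen hrun hcalls
    exact ⟨q + 1, 0, R', hq', hlen, h3, e1, e2, e3⟩

/-- The first round. -/
theorem first_round (ω : Outcome prm) : ∃ q R', q < numPhases prm ∧ 0 < phaseLen prm q ∧
    phaseStart prm q = 0 ∧
    mainProg.run (exploitRoutine P) ((initMem prm ω).setNat 3 0 0) = enc ω R' ∧
    Finished P ω q 0 R' ∧ FewCalls K prm.nPad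
      (mainProg.calls (exploitRoutine P) ((initMem prm ω).setNat 3 0 0)) := by
  have hK := NeZero.pos K
  have hpad := hw.three_le_pad
  -- The draw of $\ell_0$ itself shows that a block has at least one phase.
  have hlam : 0 < prm.nLam := ω.2.2.2.1 0 |>.pos
  set q := if prm.nBoot ≤ 0 then K else 0 with hq
  have hqK : q ≤ K := by rw [hq]; split_ifs <;> omega
  have hqn : q < numPhases prm := by unfold numPhases; omega
  have hlen : 0 < phaseLen prm q := by
    rw [hq]
    split_ifs with h1
    · rw [phaseLen_of_mem prm le_rfl (by omega)]; omega
    · rw [phaseLen, if_pos hK]; omega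
  have hstart : phaseStart prm q = 0 := by
    rw [hq]
    split_ifs with h1
    · unfold phaseStart
      refine Finset.sum_eq_zero fun k hk => ?_
      rw [phaseLen, if_pos (Finset.mem_range.1 hk)]
      omega
    · simp [phaseStart]
  rw [initMem_eq, enc_set_rew]
  have hrun : prepare.run (exploitRoutine P) (enc ω { Regs.init with rew := 0 }) = enc ω
      { Regs.init with
        started := 1
        q := q
        len := phaseLen prm q
        w := prm.zProb ω.2.1
        solo := Function.update Regs.init.solo ω.2.1 prm.nPad } := by
    exact (if_neg (show ¬ 1 ≤ 0 by omega)).trans (run_firstPhase _ _ _)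
  have hsamples : ∀ i, samples P prm 0 i ω = 0 := fun i => by simp [samples]
  have hready : Ready P ω q 0 { Regs.init with
        started := 1
        q := q
        len := phaseLen prm q
        w := prm.zProb ω.2.1
        solo := Function.update Regs.init.solo ω.2.1 prm.nPad } := by
    refine ⟨⟨rfl, rfl, rfl, rfl, ?_, ?_, hlam⟩, ?_, ?_, ?_, fun h => absurd h (lt_irrefl 0),
      fun h => ?_, fun h => absurd h (by omega)⟩
    · simp [show q - (K + 2) = 0 by omega]
    · simp [Regs.init, show q - (K + 2 + prm.nGrow) = 0 by omega]
    · rw [hstart]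
      refine ⟨?_, ?_, ?_, ?_, ?_, fun i => ?_, ?_⟩
      any_goals simp [hsamples, successes, Regs.init]
      by_cases hi : i = ω.2.1
      · simp [hi]
      · rw [if_neg hi, Function.update_of_ne (fun h1 => hi (Fin.ext h1))]
    · rw [hstart]; rfl
    · rw [if_pos rfl, explored_false ω hqK]; rfl
    · rw [explored_false ω hqK] at h; exact absurd h (by simp)
  obtain ⟨R', e1, e2, e3⟩ := hready.finish hw hqn hlen hrun (calls_prepare ω _ _)
  exact ⟨q, R', hqn, hlen, hstart, e1, e2, e3⟩

/-- The program implements the algorithm. -/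
theorem implements_mainProg {S : ℝ} (hS : prm.nPad ≤ S) (ω : Outcome prm) :
    Implements P prm mainProg mainProg.maxCost S ω := by
  let mem : ℕ → Mem := fun t => Nat.rec (initMem prm ω)
    (fun t m => mainProg.run (exploitRoutine P) (m.setNat 3 0 (lastReward P prm ω t))) t
  have hmem : ∀ t, mem (t + 1) =
      mainProg.run (exploitRoutine P) ((mem t).setNat 3 0 (lastReward P prm ω t)) := fun t => rfl
  have hinv : ∀ t < horizon prm, ∃ q r R, q < numPhases prm ∧ r < phaseLen prm q ∧
      phaseStart prm q + r = t ∧ mem (t + 1) = enc ω R ∧ Finished P ω q r R ∧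
      FewCalls K prm.nPad (mainProg.calls (exploitRoutine P)
        ((mem t).setNat 3 0 (lastReward P prm ω t))) := by
    intro t ht
    induction t with
    | zero =>
      obtain ⟨q, R, h1, h2, h3, h4, h5, h6⟩ := first_round hw ω
      exact ⟨q, 0, R, h1, h2, h3, h4, h5, h6⟩
    | succ t ih =>
      obtain ⟨q, r, R, h1, h2, h3, h4, h5, -⟩ := ih (by omega)
      subst h3
      obtain ⟨q', r', R', e1, e2, e3, e4, e5, e6⟩ := h5.step hw h1 h2 ht
      rw [← h4] at e4 e6
      exact ⟨q', r', R', e1, e2, e3, e4, e5, e6⟩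
  refine ⟨mem, rfl, fun t ht => ?_⟩
  obtain ⟨q, r, R, -, -, h3, h4, h5, h6, h7⟩ := hinv t ht
  obtain ⟨T, hT, hexec⟩ := mainProg.exec_run (exploitRoutine P) mainProg_loopFree
    ((mem t).setNat 3 0 (lastReward P prm ω t))
  refine ⟨T, _, hexec, ?_, hT, h6, fun d hd i hi => ?_⟩
  · rw [h4, ← h3]
    exact h5.arm
  · obtain ⟨a1, a2⟩ := h7 d hd i hi
    exact ⟨a1, (Nat.cast_le.2 a2).trans hS⟩

end Table

end IncExp

/-! ### The main theorem -/

open MeasureTheory in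
theorem theorem6p1 :
    ∃ (C₀ : ℝ) (prog : IncExp.Prog) (B : ℕ),
      ∀ Cpad : ℝ, C₀ ≤ Cpad → ∃ (C : ℝ) (a : ℕ),
        ∀ (K : ℕ) [NeZero K] (P : Fin K → Measure unitInterval) [∀ i, IsProbabilityMeasure (P i)]
          (δ : ℝ) (N : ℕ),
          0 < δ → Antitone (fun i => IncExp.mean (P i)) → IncExp.EasyInstance P δ →
          IncExp.IsBIC P (IncExp.params P δ Cpad N)
              (IncExp.horizon (IncExp.params P δ Cpad N)) ∧
          (∀ᵐ ω ∂(IncExp.law P (IncExp.params P δ Cpad N)), ∀ i : Fin K,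
            N ≤ IncExp.samples P (IncExp.params P δ Cpad N)
              (IncExp.horizon (IncExp.params P δ Cpad N)) i ω) ∧
          (IncExp.horizon (IncExp.params P δ Cpad N) : ℝ) ≤
            C * (1 + Real.log (1 / δ)) ^ a * (K * N / δ + K / δ ^ 4) ∧
          ∀ ω, IncExp.Implements P (IncExp.params P δ Cpad N) prog B
            (C * (1 + Real.log (1 / δ)) ^ a * (1 / δ ^ 2)) ω := by
  -- With $C_{pad}\ge100$ and $\log(1/\delta)\ge1/2$ one has $N_{pad}\ge50/\delta^2$, as tuning
  -- requires. The constant and the exponent are those of `horizon_le`; they are also large enough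
  -- to bound $N_{pad}$, the size of the data sets.
  refine ⟨100, IncExp.mainProg, IncExp.mainProg.maxCost, fun Cpad hC =>
    ⟨43 * (Cpad + 1) + 13, 2, fun K _ P _ δ N hδ hanti h => ?_⟩⟩
  have hw := IncExp.wellTuned_params hδ hanti h hC N
  have : NeZero (IncExp.params P δ Cpad N).nLam :=
    ⟨by change 1 + ⌈(δ / 10)⁻¹⌉₊ ≠ 0; omega⟩
  refine ⟨IncExp.isBIC hw _, .of_forall fun ω i => IncExp.nTarget_le_samples P _ ω i,
    IncExp.horizon_le hδ hanti h hC N, IncExp.implements_mainProg hw ?_⟩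
  refine (IncExp.params_nPad_le hδ hanti h hC N).trans ?_
  have hL := IncExp.one_half_le_log hδ hanti h
  rw [one_div_pow]
  refine mul_le_mul_of_nonneg_right ?_ (by positivity)
  have h1 : 1 + Real.log (1 / δ) ≤ (1 + Real.log (1 / δ)) ^ 2 :=
    le_self_pow₀ (by linarith) (by norm_num)
  calc (Cpad + 1) * (1 + Real.log (1 / δ))
      ≤ (43 * (Cpad + 1) + 13) * (1 + Real.log (1 / δ)) :=
        mul_le_mul_of_nonneg_right (by linarith) (by linarith)
    _ ≤ _ := mul_le_mul_of_nonneg_left h1 (by linarith)
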